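/- Let $m\ge 0$ and let $F_m$ be the free group on $m$ generators. A representation of $F_m$ over a field $k$ is called indecomposable if it is nonzero and is not a direct sum of two nonzero subrepresentations, and absolutely indecomposable if it stays indecomposable after extension of scalars to every finite field extension of $k$. In $\mathbb{Q}(q)[[t]]$, for $n\ge1$ let $\psi_n$ be the substitution $q\mapsto q^n$, $t\mapsto t^n$, and for a power series $f$ with constant coefficient $1$ define the plethystic logarithm $$\operatorname{Log}(f)=\sum_{n\ge1}\frac{\mu(n)}{n}\,\psi_n(\log f),$$ where $\mu$ is the Möbius function; this is the inverse of the plethystic exponential $\operatorname{Exp}(g)=\exp\bigl(\sum_{n\ge1}\tfrac1n\psi_n(g)\bigr)$. For a partition $\lambda=(\lambda_1\ge\lambda_2\ge\cdots)$ (with $\lambda_n=0$ for large $n$) put $|\lambda|=\sum_n\lambda_n$ and $$r_\lambda=\prod_{n\ge1}q^{\lambda_n^2}(q^{-1})_{\lambda_n-\lambda_{n+1}}\in\mathbb{Q}(q),\qquad (x)_n=(1-x)(1-x^2)\cdots(1-x^n).$$ Theorem. For every $d\ge1$ there is a polynomial $A_d^{\mathrm{ind}}(q)\in\mathbb{Z}[q]$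 such that, for every finite field $k$, the number of isomorphism classes of absolutely indecomposable representations of $F_m$ of dimension $d$ over $k$ equals $A_d^{\mathrm{ind}}(|k|)$. These polynomials satisfy, in $\mathbb{Q}(q)[[t]]$, $$\sum_{d\ge1}A_d^{\mathrm{ind}}(q)\,t^d=(q-1)\operatorname{Log}\Bigl(\sum_{\lambda}r_\lambda^{\,m-1}\,t^{|\lambda|}\Bigr),$$ where the sum on the right ranges over all partitions, including the empty one. -/

import Mathlib

noncomputable section

namespace FreeGroupRep

open scoped TensorProduct PowerSeries

section Representations

universe u v w

variable {F : Type u} [Field F] {G : Type v} [Monoid G] {V : Type w} [AddCommGroup V] [Module F V]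

/-- Extension of scalars of a representation: `g` acts on `K ⊗ V` by `id ⊗ ρ g`. -/
def baseChange (K : Type u) [Field K] [Algebra F K] (ρ : Representation F G V) :
    Representation K G (K ⊗[F] V) :=
  ((Module.End.baseChangeHom F K V : Module.End F V →ₐ[F] Module.End K (K ⊗[F] V)) :
    Module.End F V →* Module.End K (K ⊗[F] V)).comp ρ

/-- A representation is indecomposable if it is nonzero and is not the direct sum of two nonzero
subrepresentations. -/
def IsIndecomposable (ρ : Representation F G V) : Prop :=
  Nontrivial V ∧ ∀ U W : Subrepresentation ρ, IsCompl U W → U = ⊥ ∨ W = ⊥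

/-- A representation is absolutely indecomposable if it stays indecomposable under every finite
extension of the base field. -/
def IsAbsIndecomposable (ρ : Representation F G V) : Prop :=
  ∀ (K : Type u) [Field K] [Algebra F K] [FiniteDimensional F K],
    IsIndecomposable (baseChange K ρ)

variable (F G) in
/-- The absolutely indecomposable representations of `G` on `F ^ d`, up to isomorphism. -/
def absIndecSetoid (d : ℕ) :
    Setoid {ρ : Representation F G (Fin d → F) // IsAbsIndecomposable ρ} where
  r ρ σ := Nonempty (Representation.Equiv ρ.1 σ.1)
  iseqv :=
    ⟨fun _ => ⟨.refl _⟩, fun ⟨e⟩ => ⟨e.symm⟩, fun ⟨e⟩ ⟨f⟩ => ⟨e.trans f⟩⟩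

variable (F G) in
/-- The set of isomorphism classes of absolutely indecomposable representations of `G` of
dimension `d` over `F`. -/
def AbsIndecClasses (d : ℕ) : Type (max u v) :=
  Quotient (absIndecSetoid F G d)

end Representations

/-- The Adams operation `ψ_n` on `ℚ(q)[[t]]` for `n ≥ 1`: the substitution `q ↦ q ^ n`, `t ↦ t ^ n`.
The variable `q` is `RatFunc.X`, the variable `t` is `PowerSeries.X`. -/
def adams (n : ℕ) (f : (RatFunc ℚ)⟦X⟧) : (RatFunc ℚ)⟦X⟧ :=
  PowerSeries.mk fun d =>
    if n ∣ d then
      RatFunc.eval (algebraMap ℚ (RatFunc ℚ)) (RatFunc.X ^ n) (PowerSeries.coeff (d / n) f)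
    else 0

/-- The plethystic logarithm `Log f = ∑_{n ≥ 1} (μ(n) / n) ψ_n (log f)` of a power series `f` with
constant coefficient `1`. As `log f` has no constant coefficient, only those `n` that divide `d`
contribute to the coefficient of `t ^ d`, and none does for `d = 0`. -/
def plethLog (f : (RatFunc ℚ)⟦X⟧) : (RatFunc ℚ)⟦X⟧ :=
  PowerSeries.mk fun d => ∑ n ∈ d.divisors,
    ((ArithmeticFunction.moebius n : ℚ) / (n : ℚ)) •
      PowerSeries.coeff d (adams n (PowerSeries.logOf f))

/-- `(x)_n = (1 - x) (1 - x ^ 2) ⋯ (1 - x ^ n)`. -/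
def qPoch (x : RatFunc ℚ) (n : ℕ) : RatFunc ℚ :=
  ∏ i ∈ Finset.range n, (1 - x ^ (i + 1))

/-- The parts of a partition in decreasing order, continued by zeros, indexed from `0`:
`part l n` is `λ_{n+1}`. -/
def part {d : ℕ} (l : Nat.Partition d) (n : ℕ) : ℕ :=
  (l.parts.sort (· ≥ ·)).getD n 0

/-- `r_λ = ∏_{n ≥ 1} q ^ (λ_n ^ 2) (q⁻¹)_{λ_n - λ_{n+1}}`. A partition of `d` has at most `d` parts,
so that the factors left out are equal to `1`. -/
def rFactor {d : ℕ} (l : Nat.Partition d) : RatFunc ℚ :=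
  ∏ n ∈ Finset.range d,
    RatFunc.X ^ (part l n ^ 2) * qPoch (RatFunc.X)⁻¹ (part l n - part l (n + 1))

/-- `∑_λ r_λ ^ (m - 1) t ^ |λ|`, the sum over all partitions. The exponent `m - 1` is an integer,
equal to `-1` for `m = 0`. -/
def partitionSeries (m : ℕ) : (RatFunc ℚ)⟦X⟧ :=
  PowerSeries.mk fun d => ∑ l : Nat.Partition d, rFactor l ^ ((m : ℤ) - 1)

end FreeGroupRep

end

noncomputable section

namespace FreeGroupRep

universe u v w

/-! ### Finite rings with trivial idempotents -/

section FiniteRings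

/-! Let `F` have `q` elements and let `f` be monic irreducible of degree `n` over `F`. The proof
counts, in two ways and divided by `|GL_d(F)|`, the tuples `(g_1, …, g_m, θ)` on `F ^ d` with all
`g_i` invertible, `θ` commuting with every `g_i`, and `f(θ)` nilpotent
(`sum_nilCount_eq_sum_autCard_pow`).

Sorted by `θ`, the tuples run over the `F[X]`-modules killed by a power of `f`. These have types
indexed by partitions, and the automorphism group of a type has order `r_λ(q ^ n)`. A type
contributes `|Aut| ^ m` for the tuples and `1 / |Aut|` for its orbit, so the generating series is `∑
r_λ(q ^ n) ^ (m - 1) t ^ (n |λ|)`, which is `ψ_n` of the partition series at `q`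
(`sum_autCard_pow`).

Sorted by the representation, Krull–Schmidt applies. The endomorphism ring of `⨁ I_i ^ (n_i)` maps
onto `∏ Mat_{n_i}(K_i)` with nil kernel, where `K_i` is the residue field of `End I_i`. Nilpotency
and invertibility are detected in the quotient, and the order of the kernel cancels against `|Aut|`,
so the series is a product over the indecomposables (`nilCount_div_card_units`, `sum_nilCount`).
Over `K_i`, of degree `r_i` over `F`, the polynomial `f` splits into `gcd(n, r_i)` distinct factors
of equal degree, so the `i`-th factor is a power of the series for `m = 0` (`coeff_matMass`). That
series counts nilpotent matrices and equals `∏_{i ≥ 1} (1 - q ^ (-i) t)⁻¹` with `q` replaced by a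
power; the logarithm of this product has coefficients `1 / (j (q ^ j - 1))`
(`coeff_logOf_nilSeries`).

After taking logarithms, `I_i` of dimension `d_i` contributes `n / (l (q ^ (r_i l) - 1))` to the
coefficient of `t ^ d` when `d = d_i l` and `n ∣ r_i l`, and nothing otherwise. Summation against
`μ(n) / n` leaves only `r_i l = 1`: each `I_i` of dimension `d` with residue field `F` counts `1 /
(q - 1)` (`card_indec_eq`). These `I_i` are the absolutely indecomposable representations
(`isAbsIndecomposable_iff`), which gives the formula at every prime power `q`.

It remains to see that the rational function so obtained is an integral polynomial. Its values at
the powers of `2` are integers, which forces a polynomial over `ℚ` (`exists_eq_polynomial`). For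
each prime `p`, the congruence `f ^ p ≡ ψ_p f` modulo `p` shows that `Log` preserves integrality for
the Gauss valuation (`coeff_plethLog_mem`), so the coefficients are integers. -/

theorem exists_pow_isIdempotentElem {R : Type*} [Monoid R] [Finite R] (x : R) :
    ∃ n, 0 < n ∧ IsIdempotentElem (x ^ n) := by
  obtain ⟨a, b, hne, hab⟩ := Finite.exists_ne_map_eq_of_infinite (fun n : ℕ => x ^ n)
  wlog h : a < b generalizing a b
  · exact this b a hne.symm hab.symm (by omega)
  obtain ⟨k, rfl⟩ := Nat.exists_eq_add_of_lt h
  replace hab : x ^ a = x ^ (a + (k + 1)) := hab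
  have step : ∀ c, x ^ (a + c) = x ^ (a + c + (k + 1)) := fun c => by
    rw [show a + c + (k + 1) = a + (k + 1) + c by ring, pow_add, hab, ← pow_add]
  have steps : ∀ j c, x ^ (a + c) = x ^ (a + c + j * (k + 1)) := fun j c => by
    induction j with
    | zero => simp
    | succ j ih => rw [ih, add_assoc, step]; congr 1; ring
  -- The powers of `x` have period `k + 1` from exponent `a` on; the chosen exponent is a positive
  -- multiple of the period that is at least `a`.
  refine ⟨(a + 1) * (k + 1), by positivity, ?_⟩
  have := steps (a + 1) (a * k + k + 1)
  rw [IsIdempotentElem, ← pow_add]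
  convert this.symm using 2 <;> ring

/-- A ring whose only idempotents are `0` and `1`. -/
def TrivialIdempotents (R : Type*) [Ring R] : Prop :=
  Nontrivial R ∧ ∀ e : R, IsIdempotentElem e → e = 0 ∨ e = 1

/-- Some positive power of `x` is idempotent. It cannot be `1`, since `x` would then be a unit, so
it is `0`. -/
theorem TrivialIdempotents.isNilpotent_of_not_isUnit {R : Type*} [Ring R] [Finite R]
    (h : TrivialIdempotents R) {x : R} (hx : ¬ IsUnit x) : IsNilpotent x := by
  obtain ⟨n, hn, he⟩ := exists_pow_isIdempotentElem x
  rcases h.2 _ he with h0 | h1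
  · exact ⟨n, h0⟩
  · exact absurd (IsUnit.of_pow_eq_one h1 hn.ne') hx

/-- In a finite monoid one-sided inverses are two-sided. -/
theorem isUnit_of_mul_eq_isUnit {R : Type*} [Monoid R] [Finite R] {x y : R}
    (h : IsUnit (x * y)) : IsUnit x ∧ IsUnit y := by
  obtain ⟨u, hu⟩ := h
  have hr : x * (y * ↑u⁻¹) = 1 := by rw [← mul_assoc, ← hu, Units.mul_inv]
  have hl : (↑u⁻¹ * x) * y = 1 := by rw [mul_assoc, ← hu, Units.inv_mul]
  exact ⟨IsUnit.of_mul_eq_one _ hr, IsUnit.of_mul_eq_one_right _ hl⟩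

/-- The nonunits of a finite ring with trivial idempotents. -/
def nonunitIdeal {R : Type*} [Ring R] [Finite R] (h : TrivialIdempotents R) : Ideal R where
  carrier := {x | ¬ IsUnit x}
  zero_mem' := by
    have := h.1
    exact not_isUnit_zero
  add_mem' := by
    intro x y hx hy hxy
    obtain ⟨u, hu⟩ := hxy
    have hux : ¬ IsUnit (↑u⁻¹ * x) := fun h' => hx (isUnit_of_mul_eq_isUnit h').2
    have huy : ¬ IsUnit (↑u⁻¹ * y) := fun h' => hy (isUnit_of_mul_eq_isUnit h').2
    refine huy ?_
    have : (↑u⁻¹ : R) * y = 1 - ↑u⁻¹ * x := by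
      rw [eq_sub_iff_add_eq', ← mul_add, ← hu, Units.inv_mul]
    rw [this]
    exact (h.isNilpotent_of_not_isUnit hux).isUnit_one_sub
  smul_mem' := by
    intro c x hx hcx
    exact hx (isUnit_of_mul_eq_isUnit hcx).2

/-- The nonunits form a two-sided ideal whose quotient is a finite division ring, which is
commutative by Wedderburn's little theorem. -/
theorem exists_residueField (F : Type u) (E : Type v) [CommRing F] [Ring E] [Algebra F E] [Finite E]
    (h : TrivialIdempotents E) :
    ∃ (K : Type v) (_ : Field K) (_ : Algebra F K) (_ : Finite K) (π : E →ₐ[F] K),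
      Function.Surjective π ∧ ∀ x, π x = 0 ↔ ¬ IsUnit x := by
  let I := nonunitIdeal h
  have hI : ∀ x, x ∈ I ↔ ¬ IsUnit x := fun x => Iff.rfl
  have : I.IsTwoSided := ⟨fun {a} b ha => by
    rw [hI] at ha ⊢
    exact fun h' => ha (isUnit_of_mul_eq_isUnit h').1⟩
  let π : E →ₐ[F] E ⧸ I := Ideal.Quotient.mkₐ F I
  have hπ : Function.Surjective π := Ideal.Quotient.mkₐ_surjective F I
  have hker : ∀ x, π x = 0 ↔ ¬ IsUnit x := fun x => by
    rw [← hI]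
    exact Ideal.Quotient.eq_zero_iff_mem
  have : Finite (E ⧸ I) := Finite.of_surjective π hπ
  have : Nontrivial (E ⧸ I) := by
    refine ⟨1, 0, fun h10 => ?_⟩
    rw [← map_one π, hker] at h10
    exact h10 isUnit_one
  have hu : ∀ y : E ⧸ I, y ≠ 0 → IsUnit y := fun y hy => by
    obtain ⟨x, rfl⟩ := hπ y
    exact (not_not.mp ((hker x).not.mp hy)).map π
  let _ : DivisionRing (E ⧸ I) := DivisionRing.ofIsUnitOrEqZero fun y => by
    by_cases hy : y = 0
    · exact Or.inr hy
    · exact Or.inl (hu y hy)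
  let fld : Field (E ⧸ I) := littleWedderburn _
  exact ⟨E ⧸ I, fld, inferInstance, inferInstance, π, hπ, hker⟩

theorem card_eq_card_ker_mul {R S : Type*} [AddGroup R] [AddGroup S] [Finite R] (f : R →+ S)
    (hf : Function.Surjective f) (P : S → Prop) :
    Nat.card {x : R // P (f x)} = Nat.card f.ker * Nat.card {y : S // P y} := by
  classical
  have : Finite S := Finite.of_surjective f hf
  choose g hg using hf
  rw [mul_comm, ← Nat.card_prod]
  refine Nat.card_congr
    { toFun := fun x => (⟨f x, x.2⟩, ⟨x.1 - g (f x.1), by simp [AddMonoidHom.mem_ker, hg]⟩)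
      invFun := fun y => ⟨y.2.1 + g y.1.1, by
        have := y.2.2
        rw [AddMonoidHom.mem_ker] at this
        rw [map_add, this, zero_add, hg]; exact y.1.2⟩
      left_inv := fun x => by simp
      right_inv := fun y => by
        have := y.2.2
        rw [AddMonoidHom.mem_ker] at this
        ext <;> simp [this, hg] }

theorem card_units_eq_card_isUnit (R : Type*) [Monoid R] :
    Nat.card Rˣ = Nat.card {x : R // IsUnit x} :=
  Nat.card_congr
    { toFun := fun u => ⟨u, u.isUnit⟩
      invFun := fun x => x.2.unit
      left_inv := fun u => by ext; rfl
      right_inv := fun x => by ext; rfl }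

/-- For a surjective ring homomorphism with nil kernel. -/
theorem isUnit_map_iff_of_nil_ker {R S : Type*} [Ring R] [Ring S] (f : R →+* S)
    (hf : Function.Surjective f) (hker : ∀ x, f x = 0 → IsNilpotent x) (x : R) :
    IsUnit (f x) ↔ IsUnit x := by
  refine ⟨fun h => ?_, fun h => h.map f⟩
  obtain ⟨y, hy⟩ := hf ↑(h.unit⁻¹)
  have h1 : IsUnit (x * y) := by
    have : IsNilpotent (1 - x * y) := hker _ (by
      rw [map_sub, map_mul, hy, map_one, IsUnit.mul_val_inv, sub_self])
    simpa using this.isUnit_one_sub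
  have h2 : IsUnit (y * x) := by
    have : IsNilpotent (1 - y * x) := hker _ (by
      rw [map_sub, map_mul, hy, map_one, IsUnit.val_inv_mul, sub_self])
    simpa using this.isUnit_one_sub
  obtain ⟨u, hu⟩ := h1
  obtain ⟨w, hw⟩ := h2
  have hr : x * (y * ↑u⁻¹) = 1 := by rw [← mul_assoc, ← hu, Units.mul_inv]
  have hl : (↑w⁻¹ * y) * x = 1 := by rw [mul_assoc, ← hw, Units.inv_mul]
  exact isUnit_iff_exists_and_exists.mpr ⟨⟨_, hr⟩, ⟨_, hl⟩⟩

theorem isNilpotent_map_iff_of_nil_ker {R S : Type*} [Ring R] [Ring S] (f : R →+* S)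
    (hker : ∀ x, f x = 0 → IsNilpotent x) (x : R) :
    IsNilpotent (f x) ↔ IsNilpotent x := by
  refine ⟨fun ⟨n, hn⟩ => ?_, fun h => h.map f⟩
  rw [← map_pow] at hn
  exact (isNilpotent_pow_iff' (hker _ hn))
where
  isNilpotent_pow_iff' {R : Type _} [Ring R] {x : R} {n : ℕ} (h : IsNilpotent (x ^ n)) :
      IsNilpotent x := by
    obtain ⟨k, hk⟩ := h
    exact ⟨n * k, by rw [pow_mul, hk]⟩

end FiniteRings

/-! ### Indecomposable summands of finite modules -/

section Summands

variable {A : Type*} [Ring A] {M : Type*} [AddCommGroup M] [Module A M]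

/-- A nonzero module that is not a direct sum of two nonzero submodules. -/
def IndecModule (A : Type*) (M : Type*) [Ring A] [AddCommGroup M] [Module A M] : Prop :=
  TrivialIdempotents (Module.End A M)

theorem finite_linearMap (A : Type*) [Ring A] (M N : Type*) [AddCommGroup M] [Module A M]
    [AddCommGroup N] [Module A N] [Finite M] [Finite N] : Finite (M →ₗ[A] N) :=
  Finite.of_injective (fun f => (f : M → N)) DFunLike.coe_injective

instance (A : Type*) [Ring A] (M N : Type*) [AddCommGroup M] [Module A M]
    [AddCommGroup N] [Module A N] [Finite M] [Finite N] : Finite (M →ₗ[A] N) :=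
  finite_linearMap A M N

instance (A : Type*) [Ring A] (M N : Type*) [AddCommGroup M] [Module A M]
    [AddCommGroup N] [Module A N] [Finite M] [Finite N] : Finite (M ≃ₗ[A] N) :=
  Finite.of_injective (fun f => (f : M → N)) DFunLike.coe_injective

theorem IndecModule.of_equiv {N : Type*} [AddCommGroup N] [Module A N] (e : M ≃ₗ[A] N)
    (h : IndecModule A M) : IndecModule A N := by
  have := h.1
  refine ⟨(e.conjRingEquiv.symm.toEquiv).nontrivial, fun f hf => ?_⟩
  have hf' : IsIdempotentElem (e.conjRingEquiv.symm f) := hf.map e.conjRingEquiv.symm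
  rcases h.2 _ hf' with h0 | h1
  · left; simpa using h0
  · right; simpa using h1

/-- Among the nonzero idempotents `e'` with `e * e' = e'`, take one with the smallest image. A
nonzero idempotent of that image extends by `e'` to another such idempotent of `M`, so by minimality
it is surjective, hence the identity. -/
theorem exists_indecModule_summand [Finite M] (e : Module.End A M) (he : IsIdempotentElem e)
    (hne : e ≠ 0) :
    ∃ (X : Submodule A M) (β : M →ₗ[A] X), IndecModule A X ∧ β ∘ₗ X.subtype = LinearMap.id ∧
      e ∘ₗ X.subtype = X.subtype := by
  obtain ⟨e', ⟨he'0, he', hee'⟩, hmin⟩ := Set.exists_min_image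
    {e' : Module.End A M | e' ≠ 0 ∧ IsIdempotentElem e' ∧ e * e' = e'}
    (fun e' => Nat.card (LinearMap.range e')) (Set.toFinite _) ⟨e, hne, he, he⟩
  have hfix : ∀ x : LinearMap.range e', e' x = x := by
    rintro ⟨_, y, rfl⟩
    exact LinearMap.congr_fun he' y
  refine ⟨LinearMap.range e', e'.rangeRestrict, ⟨?_, ?_⟩, ?_, ?_⟩
  · refine ⟨0, 1, fun h01 => he'0 ?_⟩
    ext y
    have := LinearMap.congr_fun h01 ⟨e' y, y, rfl⟩
    simpa using (congrArg Subtype.val this).symm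
  · intro f hf
    have key : ∀ f : Module.End A (LinearMap.range e'), IsIdempotentElem f → f ≠ 0 →
        Function.Surjective f := by
      intro f hf hf0
      let g : Module.End A M := (LinearMap.range e').subtype ∘ₗ f ∘ₗ e'.rangeRestrict
      have hgr : LinearMap.range g ≤ LinearMap.range e' := by
        rintro _ ⟨y, rfl⟩
        exact (f _).2
      have hrestr : ∀ x : LinearMap.range e', e'.rangeRestrict x = x := fun x =>
        Subtype.ext (hfix x)
      have hg := hmin g ⟨?_, ?_, ?_⟩
      · have hcard : Nat.card (LinearMap.range g) = Nat.card (LinearMap.range e') :=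
          le_antisymm (Nat.card_le_card_of_injective _ (Submodule.inclusion_injective hgr)) hg
        have heq : LinearMap.range g = LinearMap.range e' := by
          apply SetLike.coe_injective
          exact Set.eq_of_subset_of_ncard_le hgr
            (by rw [← Nat.card_coe_set_eq, ← Nat.card_coe_set_eq]; exact hcard.ge) (Set.toFinite _)
        intro x
        have hx : (x : M) ∈ LinearMap.range g := by rw [heq]; exact x.2
        obtain ⟨y, hy⟩ := hx
        exact ⟨e'.rangeRestrict y, Subtype.ext hy⟩
      · intro hg0
        apply hf0
        ext x
        have := LinearMap.congr_fun hg0 x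
        simpa [g, hrestr] using this
      · ext y
        simp only [g, Module.End.mul_apply, LinearMap.comp_apply, Submodule.subtype_apply, hrestr]
        exact congrArg Subtype.val (LinearMap.congr_fun hf _)
      · ext y
        simp only [g, Module.End.mul_apply, LinearMap.comp_apply, Submodule.subtype_apply]
        obtain ⟨z, hz⟩ := (f (e'.rangeRestrict y)).2
        rw [← hz, ← Module.End.mul_apply, hee']
    by_cases hf0 : f = 0
    · exact Or.inl hf0
    · right
      ext x
      obtain ⟨y, rfl⟩ := key f hf hf0 x
      exact congrArg Subtype.val (LinearMap.congr_fun hf y)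
  · ext x
    exact hfix x
  · ext x
    obtain ⟨z, hz⟩ := x.2
    simp only [LinearMap.comp_apply, Submodule.subtype_apply]
    rw [← hz, ← Module.End.mul_apply, hee']

end Summands

/-- A finite family of pairwise non-isomorphic indecomposable finite modules, with the residue
fields of their endomorphism rings. -/
structure IndecFamily (F : Type u) (A : Type v) [Field F] [Ring A] [Algebra F A] (ι : Type) where
  I : ι → Type u
  [acg : ∀ i, AddCommGroup (I i)]
  [modF : ∀ i, Module F (I i)]
  [modA : ∀ i, Module A (I i)]
  [tower : ∀ i, IsScalarTower F A (I i)]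
  [finI : ∀ i, Finite (I i)]
  K : ι → Type u
  [fieldK : ∀ i, Field (K i)]
  [algK : ∀ i, Algebra F (K i)]
  [finK : ∀ i, Finite (K i)]
  π : ∀ i, Module.End A (I i) →ₐ[F] K i
  surj : ∀ i, Function.Surjective (π i)
  ker : ∀ i x, π i x = 0 ↔ ¬ IsUnit x
  triv : ∀ i, IndecModule A (I i)
  noniso : ∀ i j, Nonempty (I i ≃ₗ[A] I j) → i = j

/-! ### Krull–Schmidt: the residue homomorphism of a direct sum of indecomposables -/

namespace IndecFamily

attribute [instance] acg modF modA tower finI fieldK algK finK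

variable {F : Type u} {A : Type v} [Field F] [Ring A] [Algebra F A] {ι : Type} [Fintype ι]
  [DecidableEq ι] (B : IndecFamily F A ι)

/-- The direct sum of `n i` copies of `I i`. -/
abbrev obj (n : ι → ℕ) : Type u := (s : Σ i, Fin (n i)) → B.I s.1

-- Were the composite invertible, `g` would split, and `I j` being indecomposable, `g` would be an
-- isomorphism. This vanishing is what makes the residue matrices multiplicative.
omit [Fintype ι] [DecidableEq ι] in
theorem π_comp_eq_zero {i j : ι} (hij : i ≠ j) (f : B.I j →ₗ[A] B.I i) (g : B.I i →ₗ[A] B.I j) :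
    B.π i (f ∘ₗ g) = 0 := by
  rw [B.ker]
  rintro ⟨u, hu⟩
  refine hij (B.noniso i j ?_)
  -- `g` is a split monomorphism into an indecomposable module
  have hr : ((↑u⁻¹ : Module.End A (B.I i)) ∘ₗ f) ∘ₗ g = LinearMap.id := by
    rw [LinearMap.comp_assoc, ← hu]
    exact u.inv_mul
  set f' := (↑u⁻¹ : Module.End A (B.I i)) ∘ₗ f with hf'
  have hid : IsIdempotentElem (g ∘ₗ f' : Module.End A (B.I j)) := by
    change (g ∘ₗ f') ∘ₗ (g ∘ₗ f') = g ∘ₗ f'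
    rw [LinearMap.comp_assoc, ← LinearMap.comp_assoc f' g f', hr, LinearMap.id_comp]
  rcases (B.triv j).2 _ hid with h0 | h1
  · exfalso
    have h1 : (LinearMap.id : B.I i →ₗ[A] B.I i) = 0 := by
      calc (LinearMap.id : B.I i →ₗ[A] B.I i) = (f' ∘ₗ g) ∘ₗ (f' ∘ₗ g) := by
            rw [hr, LinearMap.id_comp]
        _ = f' ∘ₗ (g ∘ₗ f') ∘ₗ g := rfl
        _ = 0 := by rw [h0]; simp
    have := (B.triv i).1
    exact one_ne_zero h1
  · exact ⟨LinearEquiv.ofLinearMap g f' h1 hr⟩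

/-- The matrix of the residues of the components. -/
def phi {n n' : ι → ℕ} (f : B.obj n' →ₗ[A] B.obj n) (i : ι) :
    Matrix (Fin (n i)) (Fin (n' i)) (B.K i) :=
  Matrix.of fun a b => B.π i (LinearMap.proj (φ := fun s : Σ i, Fin (n i) => B.I s.1) ⟨i, a⟩ ∘ₗ f ∘ₗ
    LinearMap.single A (fun s : Σ i, Fin (n' i) => B.I s.1) ⟨i, b⟩)

omit [Fintype ι] in
theorem phi_add {n n' : ι → ℕ} (f g : B.obj n' →ₗ[A] B.obj n) (i : ι) :
    B.phi (f + g) i = B.phi f i + B.phi g i := by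
  ext a b
  simp only [phi, Matrix.of_apply, Matrix.add_apply, ← map_add]
  congr 1

omit [Fintype ι] in
theorem phi_smul {n n' : ι → ℕ} (c : F) (f : B.obj n' →ₗ[A] B.obj n) (i : ι) :
    B.phi (c • f) i = c • B.phi f i := by
  ext a b
  simp only [phi, Matrix.of_apply, Matrix.smul_apply, ← map_smul]
  congr 1

theorem sum_single_comp_proj (n : ι → ℕ) :
    ∑ s : Σ i, Fin (n i), LinearMap.single A (fun s : Σ i, Fin (n i) => B.I s.1) s ∘ₗ
      LinearMap.proj s = LinearMap.id := by
  ext s x t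
  simp [Finset.sum_apply]

/-- Insert the identity of the middle object as a sum over its summands: the paths through copies of
`I i` give the matrix product, and those through other indecomposables have residue zero. -/
theorem phi_comp {n n' n'' : ι → ℕ} (f : B.obj n' →ₗ[A] B.obj n) (g : B.obj n'' →ₗ[A] B.obj n')
    (i : ι) : B.phi (f ∘ₗ g) i = B.phi f i * B.phi g i := by
  ext a b
  rw [Matrix.mul_apply]
  simp only [phi, Matrix.of_apply]
  have h1 : LinearMap.proj (φ := fun s : Σ i, Fin (n i) => B.I s.1) ⟨i, a⟩ ∘ₗ (f ∘ₗ g) ∘ₗ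
      LinearMap.single A (fun s : Σ i, Fin (n'' i) => B.I s.1) ⟨i, b⟩ =
      ∑ s : Σ i, Fin (n' i), (LinearMap.proj (φ := fun s : Σ i, Fin (n i) => B.I s.1) ⟨i, a⟩ ∘ₗ f ∘ₗ
        LinearMap.single A (fun s : Σ i, Fin (n' i) => B.I s.1) s) ∘ₗ
        (LinearMap.proj s ∘ₗ g ∘ₗ
          LinearMap.single A (fun s : Σ i, Fin (n'' i) => B.I s.1) ⟨i, b⟩) := by
    conv_lhs => rw [← LinearMap.id_comp g, ← B.sum_single_comp_proj n']
    ext x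
    simp [LinearMap.sum_apply, map_sum]
  rw [h1, map_sum, Fintype.sum_sigma, Finset.sum_eq_single i]
  · refine Finset.sum_congr rfl fun c _ => ?_
    exact map_mul (B.π i) _ _
  · intro j _ hj
    exact Finset.sum_eq_zero fun c _ => B.π_comp_eq_zero hj.symm _ _
  · simp

omit [Fintype ι] in
theorem phi_id (n : ι → ℕ) (i : ι) :
    B.phi (LinearMap.id : B.obj n →ₗ[A] B.obj n) i = 1 := by
  ext a b
  simp only [phi, Matrix.of_apply, Matrix.one_apply]
  split_ifs with h
  · subst h
    rw [← map_one (B.π i)]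
    congr 1
    ext x
    simp
  · rw [← map_zero (B.π i)]
    congr 1
    ext x
    simp [h]

/-- The residue homomorphism of the endomorphism algebra of `obj n`. -/
def Phi (n : ι → ℕ) :
    Module.End A (B.obj n) →ₐ[F] ((i : ι) → Matrix (Fin (n i)) (Fin (n i)) (B.K i)) :=
  AlgHom.ofLinearMap
    { toFun := fun f i => B.phi f i
      map_add' := fun f g => funext fun i => B.phi_add f g i
      map_smul' := fun c f => funext fun i => B.phi_smul c f i }
    (funext fun i => B.phi_id n i)
    (fun f g => funext fun i => B.phi_comp f g i)

theorem Phi_surjective (n : ι → ℕ) : Function.Surjective (B.Phi n) := by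
  intro X
  choose g hg using fun (i : ι) (a b : Fin (n i)) => B.surj i (X i a b)
  -- A preimage is block diagonal: entries are lifted within each isotypic block, and the other
  -- components vanish.
  refine ⟨LinearMap.pi fun s => ∑ b : Fin (n s.1), g s.1 s.2 b ∘ₗ
    LinearMap.proj (φ := fun s : Σ i, Fin (n i) => B.I s.1) ⟨s.1, b⟩, ?_⟩
  funext i
  ext a b
  change B.π i _ = _
  rw [← hg i a b]
  congr 1
  ext x
  simp only [LinearMap.comp_apply, LinearMap.pi_apply, LinearMap.proj_apply, LinearMap.sum_apply,
    LinearMap.single_apply]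
  rw [Finset.sum_eq_single b]
  · simp
  · intro c _ hc
    rw [Pi.single_eq_of_ne (by simpa using hc), map_zero]
  · simp

/-- Some power of `f` is an idempotent `e` of residue zero. If `e ≠ 0`, its image has an
indecomposable summand `X`, and the identity of `X` is a sum of paths through the components of `e`.
As `End X` is local, one path is invertible; then a component of `e` between two copies of the same
`I i` is an isomorphism, against its zero residue. -/
theorem Phi_ker_nil (n : ι → ℕ) (f : Module.End A (B.obj n)) (hf : B.Phi n f = 0) :
    IsNilpotent f := by
  obtain ⟨N, hN, he⟩ := exists_pow_isIdempotentElem f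
  refine ⟨N, by_contra fun hne => ?_⟩
  have hker : B.Phi n (f ^ N) = 0 := by rw [map_pow, hf, zero_pow hN.ne']
  generalize f ^ N = e at he hne hker
  obtain ⟨X, β, hX, hβ, heX⟩ := exists_indecModule_summand e he hne
  obtain ⟨K, _, _, _, κ, -, hκ⟩ := exists_residueField ℤ (Module.End A X) hX
  let single := fun s : Σ i, Fin (n i) =>
    LinearMap.single A (fun s : Σ i, Fin (n i) => B.I s.1) s
  let proj := fun s : Σ i, Fin (n i) =>
    LinearMap.proj (R := A) (φ := fun s : Σ i, Fin (n i) => B.I s.1) s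
  let term := fun s t => (β ∘ₗ single s) ∘ₗ (proj s ∘ₗ e ∘ₗ single t) ∘ₗ (proj t ∘ₗ X.subtype)
  have hsum : ∑ s, ∑ t, term s t = (1 : Module.End A X) := by
    have hid : ∀ v : B.obj n, ∑ s, single s (proj s v) = v := fun v => by
      have := LinearMap.congr_fun (B.sum_single_comp_proj n) v
      rwa [LinearMap.sum_apply] at this
    refine LinearMap.ext fun x => ?_
    have h1 : β (e (x : B.obj n)) = x := by
      have h2 : e (x : B.obj n) = x := LinearMap.congr_fun heX x
      rw [h2]
      exact LinearMap.congr_fun hβ x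
    conv_rhs => rw [Module.End.one_apply, ← h1, ← hid (e (x : B.obj n)), map_sum]
    rw [LinearMap.sum_apply]
    refine Finset.sum_congr rfl fun s _ => ?_
    conv_rhs => rw [← hid (x : B.obj n), map_sum, map_sum, map_sum, map_sum]
    rw [LinearMap.sum_apply]
    rfl
  -- The terms sum to `1`, so not all of their residues in the residue field of `End X` vanish.
  have hex : ∃ s t, κ (term s t) ≠ 0 := by
    by_contra hall
    push Not at hall
    have := congrArg κ hsum
    simp [map_sum, hall] at this
  obtain ⟨s, t, hst⟩ := hex
  have hu : IsUnit (term s t) := not_not.mp ((hκ _).not.mp hst)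
  obtain ⟨w, hw⟩ := hu
  have := hX.1
  -- the three maps are split, hence isomorphisms
  have split : ∀ (Y : Type u) [AddCommGroup Y] [Module A Y] (a : X →ₗ[A] Y) (b : Y →ₗ[A] X),
      IndecModule A Y → b ∘ₗ a = LinearMap.id → a ∘ₗ b = LinearMap.id := by
    intro Y _ _ a b hY hba
    have hid : IsIdempotentElem (a ∘ₗ b : Module.End A Y) := by
      change (a ∘ₗ b) ∘ₗ (a ∘ₗ b) = a ∘ₗ b
      rw [LinearMap.comp_assoc, ← LinearMap.comp_assoc b a b, hba, LinearMap.id_comp]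
    refine (hY.2 _ hid).resolve_left fun h0 => ?_
    have : (1 : Module.End A X) = 0 := by
      calc (1 : Module.End A X) = (b ∘ₗ a) ∘ₗ (b ∘ₗ a) := by rw [hba]; rfl
        _ = b ∘ₗ (a ∘ₗ b) ∘ₗ a := rfl
        _ = 0 := by rw [h0]; simp
    exact one_ne_zero this
  let w' : Module.End A X := ↑w⁻¹
  have hw1 : w' ∘ₗ term s t = LinearMap.id := by rw [← hw]; exact w.inv_mul
  have ht := split (B.I t.1) (proj t ∘ₗ X.subtype)
    (w' ∘ₗ (β ∘ₗ single s) ∘ₗ (proj s ∘ₗ e ∘ₗ single t)) (B.triv _) hw1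
  have hs := split (B.I s.1) ((proj s ∘ₗ e ∘ₗ single t) ∘ₗ (proj t ∘ₗ X.subtype))
    (w' ∘ₗ (β ∘ₗ single s)) (B.triv _) hw1
  have hiso : Nonempty (B.I s.1 ≃ₗ[A] B.I t.1) :=
    ⟨LinearEquiv.ofLinearMap ((proj t ∘ₗ X.subtype) ∘ₗ (w' ∘ₗ (β ∘ₗ single s)))
      (proj s ∘ₗ e ∘ₗ single t) ht hs⟩
  obtain ⟨i, a⟩ := s
  obtain ⟨j, b⟩ := t
  obtain rfl : i = j := B.noniso i j hiso
  have hz : B.π i (proj ⟨i, a⟩ ∘ₗ e ∘ₗ single ⟨i, b⟩) = 0 :=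
    congrFun (congrFun (congrFun hker i) a) b
  rw [B.ker] at hz
  refine hz (isUnit_iff_exists_and_exists.mpr ⟨⟨(proj ⟨i, b⟩ ∘ₗ X.subtype) ∘ₗ (w' ∘ₗ (β ∘ₗ single ⟨i, a⟩)), hs⟩,
    ⟨(proj ⟨i, b⟩ ∘ₗ X.subtype) ∘ₗ (w' ∘ₗ (β ∘ₗ single ⟨i, a⟩)), ht⟩⟩)

/-- The residue matrices of `e` and of its inverse are mutually inverse, hence square. This is the
uniqueness part of Krull–Schmidt. -/
theorem eq_of_equiv {n n' : ι → ℕ} (e : B.obj n ≃ₗ[A] B.obj n') : n = n' := by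
  funext i
  have h1 : B.phi (e : B.obj n →ₗ[A] B.obj n') i * B.phi (e.symm : B.obj n' →ₗ[A] B.obj n) i = 1 := by
    rw [← phi_comp, ← phi_id]; congr 1; ext; simp
  have h2 : B.phi (e.symm : B.obj n' →ₗ[A] B.obj n) i * B.phi (e : B.obj n →ₗ[A] B.obj n') i = 1 := by
    rw [← phi_comp, ← phi_id]; congr 1; ext; simp
  have := Matrix.square_of_invertible _ _ h1 h2
  simpa using this.symm

end IndecFamily

/-! ### Decomposition into members of a family, and counting modulo a nil kernel -/

open Polynomial

namespace IndecFamily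

variable {F : Type u} {A : Type v} [Field F] [Ring A] [Algebra F A] {ι : Type} [Fintype ι]
  [DecidableEq ι] (B : IndecFamily F A ι)

-- Split off an indecomposable summand and induct on the cardinality. The hypothesis concerns all
-- indecomposable submodules of `M`, so it passes to the complement `ker β`.
omit [Fintype ι] [DecidableEq ι] in
theorem exists_equiv_pi :
    ∀ (N : ℕ) (M : Type w) [AddCommGroup M] [Module A M] [Finite M], Nat.card M = N →
      (∀ X : Submodule A M, IndecModule A X → ∃ i, Nonempty (X ≃ₗ[A] B.I i)) →
      ∃ (κ : Type) (_ : Fintype κ) (c : κ → ι), Nonempty (M ≃ₗ[A] ((k : κ) → B.I (c k))) := by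
  intro N
  induction N using Nat.strong_induction_on with
  | _ N ih =>
    intro M _ _ _ hN hM
    by_cases hsub : Subsingleton M
    · refine ⟨Empty, inferInstance, Empty.elim, ⟨?_⟩⟩
      exact
        { toFun := fun _ k => k.elim
          map_add' := fun _ _ => funext fun k => k.elim
          map_smul' := fun _ _ => funext fun k => k.elim
          invFun := fun _ => 0
          left_inv := fun _ => Subsingleton.elim _ _
          right_inv := fun _ => funext fun k => k.elim }
    · have hnt : Nontrivial M := not_subsingleton_iff_nontrivial.mp hsub
      obtain ⟨X, β, hX, hβ, -⟩ := exists_indecModule_summand (1 : Module.End A M)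
        IsIdempotentElem.one one_ne_zero
      have hc : IsCompl X (LinearMap.ker β) := LinearMap.isCompl_of_proj fun x =>
        LinearMap.congr_fun hβ x
      obtain ⟨i, ⟨ei⟩⟩ := hM X hX
      have hlt : Nat.card (LinearMap.ker β) < N := by
        rw [← hN]
        have hXnt : Nontrivial X := by
          by_contra h
          rw [not_nontrivial_iff_subsingleton] at h
          have := hX.1
          exact one_ne_zero (α := Module.End A X) (Subsingleton.elim _ _)
        obtain ⟨x, hx⟩ := exists_ne (0 : X)
        have hx' : (x : M) ∉ LinearMap.ker β := fun h => hx (by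
          rw [LinearMap.mem_ker] at h
          rw [← h]
          exact (LinearMap.congr_fun hβ x).symm)
        have := Set.ncard_lt_card (s := (LinearMap.ker β : Set M)) (fun h => hx' (by
          rw [← SetLike.mem_coe, h]; trivial))
        rwa [← Nat.card_coe_set_eq] at this
      obtain ⟨κ, _, c, ⟨eκ⟩⟩ := ih _ hlt (LinearMap.ker β) rfl (fun Y hY => by
        let e := Submodule.equivMapOfInjective (LinearMap.ker β).subtype
          (Submodule.injective_subtype _) Y
        obtain ⟨j, ⟨ej⟩⟩ := hM _ (hY.of_equiv e)
        exact ⟨j, ⟨e.trans ej⟩⟩)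
      refine ⟨Option κ, inferInstance, fun o => o.elim i c, ⟨?_⟩⟩
      exact (Submodule.prodEquivOfIsCompl _ _ hc).symm.trans ((ei.prodCongr eκ).trans
        (LinearEquiv.piOptionEquivProd (R := A) (M := fun o : Option κ => B.I (o.elim i c))).symm)

omit [Fintype ι] in
theorem exists_equiv_obj {M : Type w} [AddCommGroup M] [Module A M] [Finite M]
    (hM : ∀ X : Submodule A M, IndecModule A X → ∃ i, Nonempty (X ≃ₗ[A] B.I i)) :
    ∃ n : ι → ℕ, Nonempty (M ≃ₗ[A] B.obj n) := by
  obtain ⟨κ, _, c, ⟨e⟩⟩ := B.exists_equiv_pi _ M rfl hM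
  let n : ι → ℕ := fun i => Fintype.card {k // c k = i}
  let ε : (Σ i, Fin (n i)) ≃ κ :=
    (Equiv.sigmaCongrRight fun i => (Fintype.equivFin {k // c k = i}).symm).trans
      (Equiv.sigmaFiberEquiv c)
  have hε : ∀ s, c (ε s) = s.1 := fun s => ((Fintype.equivFin {k // c k = s.1}).symm s.2).2
  have castEquiv : ∀ {i j : ι}, i = j → Nonempty (B.I i ≃ₗ[A] B.I j) := by
    rintro i _ rfl
    exact ⟨LinearEquiv.refl _ _⟩
  exact ⟨n, ⟨e.trans ((LinearEquiv.piCongrLeft A (fun k => B.I (c k)) ε).symm.trans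
    (LinearEquiv.piCongrRight fun s => (castEquiv (hε s)).some))⟩⟩

end IndecFamily

/-- The number of elements `x` of an algebra for which `f x` is nilpotent. -/
def nilCount {F : Type*} [Field F] (f : F[X]) (R : Type*) [Ring R] [Algebra F R] : ℕ :=
  Nat.card {x : R // IsNilpotent (aeval x f)}

/-- The mass of the `n × n` matrices over `K` on which `f` is nilpotent. -/
def matMass {F : Type*} [Field F] (f : F[X]) (K : Type*) [Field K] [Algebra F K] (n : ℕ) : ℚ :=
  (nilCount f (Matrix (Fin n) (Fin n) K) : ℚ) / Nat.card (Matrix (Fin n) (Fin n) K)ˣ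

theorem isNilpotent_pi_iff {ι : Type*} [Finite ι] {R : ι → Type*} [∀ i, Ring (R i)]
    (x : ∀ i, R i) : IsNilpotent x ↔ ∀ i, IsNilpotent (x i) := by
  have := Fintype.ofFinite ι
  refine ⟨fun ⟨n, hn⟩ i => ⟨n, by simpa using congrFun hn i⟩, fun h => ?_⟩
  choose n hn using h
  refine ⟨∑ i, n i, funext fun i => ?_⟩
  exact pow_eq_zero_of_le (Finset.single_le_sum (f := n) (fun _ _ => Nat.zero_le _)
    (Finset.mem_univ i)) (hn i)

theorem nilCount_pi {F : Type*} [Field F] (f : F[X]) {ι : Type*} [Fintype ι] (R : ι → Type*)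
    [∀ i, Ring (R i)] [∀ i, Algebra F (R i)] :
    nilCount f (∀ i, R i) = ∏ i, nilCount f (R i) := by
  unfold nilCount
  rw [← Nat.card_pi]
  have key : ∀ (x : ∀ i, R i) i, aeval x f i = aeval (x i) f := fun x i =>
    (Polynomial.aeval_algHom_apply (Pi.evalAlgHom F R i) x f).symm
  have key2 : ∀ (x : ∀ i, R i), IsNilpotent (aeval x f) ↔ ∀ i, IsNilpotent (aeval (x i) f) :=
    fun x => by
      rw [isNilpotent_pi_iff]
      exact forall_congr' fun i => by rw [key]
  exact Nat.card_congr
    { toFun := fun x i => ⟨x.1 i, (key2 x.1).mp x.2 i⟩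
      invFun := fun x => ⟨fun i => (x i).1, (key2 _).mpr fun i => (x i).2⟩
      left_inv := fun _ => rfl
      right_inv := fun _ => rfl }

/-- Nilpotency of `f(x)` is detected modulo a nil kernel, so the set counted is a union of cosets of
the kernel. -/
theorem nilCount_eq_of_nil_ker {F : Type*} [Field F] (f : F[X]) {R S : Type*} [Ring R] [Ring S]
    [Algebra F R] [Algebra F S] [Finite R] (φ : R →ₐ[F] S) (hφ : Function.Surjective φ)
    (hker : ∀ x, φ x = 0 → IsNilpotent x) :
    nilCount f R = Nat.card (φ : R →+ S).ker * nilCount f S := by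
  unfold nilCount
  rw [← card_eq_card_ker_mul (φ : R →+ S) hφ (fun y => IsNilpotent (aeval y f))]
  refine Nat.card_congr (Equiv.subtypeEquivRight fun x => ?_)
  have h := isNilpotent_map_iff_of_nil_ker (φ : R →+* S) hker (aeval x f)
  have h2 : (φ : R →+* S) (aeval x f) = aeval (φ x) f :=
    (Polynomial.aeval_algHom_apply φ x f).symm
  rw [h2] at h
  exact h.symm

theorem card_units_eq_of_nil_ker {R S : Type*} [Ring R] [Ring S]
    [Finite R] (φ : R →+* S) (hφ : Function.Surjective φ)
    (hker : ∀ x, φ x = 0 → IsNilpotent x) :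
    Nat.card Rˣ = Nat.card (φ : R →+ S).ker * Nat.card Sˣ := by
  rw [card_units_eq_card_isUnit, card_units_eq_card_isUnit,
    ← card_eq_card_ker_mul (φ : R →+ S) hφ (fun y => IsUnit y)]
  exact Nat.card_congr (Equiv.subtypeEquivRight fun x =>
    (isUnit_map_iff_of_nil_ker φ hφ hker x).symm)

namespace IndecFamily

variable {F : Type u} {A : Type v} [Field F] [Ring A] [Algebra F A] {ι : Type} [Fintype ι]
  [DecidableEq ι] (B : IndecFamily F A ι)

/-- The order of the kernel of `Phi` divides both counts and cancels, leaving matrix rings over the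
residue fields. Hence the mass is multiplicative over the indecomposables. -/
theorem nilCount_div_card_units (f : F[X]) (n : ι → ℕ) :
    (nilCount f (Module.End A (B.obj n)) : ℚ) / Nat.card (Module.End A (B.obj n))ˣ =
      ∏ i, matMass f (B.K i) (n i) := by
  rw [nilCount_eq_of_nil_ker f (B.Phi n) (B.Phi_surjective n) (B.Phi_ker_nil n),
    card_units_eq_of_nil_ker (B.Phi n).toRingHom (B.Phi_surjective n) (B.Phi_ker_nil n),
    nilCount_pi, Nat.card_congr (MulEquiv.piUnits).toEquiv, Nat.card_pi]
  simp only [matMass, Finset.prod_div_distrib]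
  push_cast
  refine mul_div_mul_left _ _ ?_
  exact_mod_cast Nat.card_pos.ne'

end IndecFamily

/-- The order of `GL_n(K)`. -/
def glCard (K : Type*) [Field K] (n : ℕ) : ℕ := Nat.card (Matrix (Fin n) (Fin n) K)ˣ

theorem glCard_pos (K : Type*) [Field K] [Finite K] (n : ℕ) : 0 < glCard K n := by
  have : Finite (Matrix (Fin n) (Fin n) K) := inferInstanceAs (Finite (Fin n → Fin n → K))
  exact Nat.card_pos

theorem card_linearEquiv_self (R : Type*) [Semiring R] (M : Type*) [AddCommMonoid M] [Module R M] :
    Nat.card (M ≃ₗ[R] M) = Nat.card (Module.End R M)ˣ :=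
  Nat.card_congr (LinearMap.GeneralLinearGroup.generalLinearEquiv R M).symm.toEquiv

theorem card_linearEquiv_fun (F : Type*) [Field F] (d : ℕ) :
    Nat.card ((Fin d → F) ≃ₗ[F] (Fin d → F)) = glCard F d := by
  rw [card_linearEquiv_self]
  exact Nat.card_congr (Units.mapEquiv (LinearMap.toMatrixAlgEquiv' (R := F) (n := Fin d))).toEquiv

theorem card_linearEquiv_fun_of_finrank {F : Type*} [Field F] {M : Type*} [AddCommGroup M]
    [Module F M] [Module.Finite F M] {d : ℕ} (h : Module.finrank F M = d) :
    Nat.card ((Fin d → F) ≃ₗ[F] M) = glCard F d := by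
  have e : M ≃ₗ[F] (Fin d → F) := LinearEquiv.ofFinrankEq _ _ (by simp [h])
  rw [← card_linearEquiv_fun]
  exact Nat.card_congr
    { toFun := fun f => f.trans e
      invFun := fun f => f.trans e.symm
      left_inv := fun f => by ext; simp
      right_inv := fun f => by ext; simp }

/-! ### Module structures on `F ^ d`, counted by orbits -/

section RepSpace

variable {F : Type u} {A : Type v} [Field F] [Ring A] [Algebra F A] {d : ℕ}

/-- The `A`-module on `F ^ d` given by an algebra homomorphism. -/
def RepSpace (_ρ : A →ₐ[F] Module.End F (Fin d → F)) : Type u := Fin d → F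

variable (ρ : A →ₐ[F] Module.End F (Fin d → F))

instance : AddCommGroup (RepSpace ρ) := inferInstanceAs (AddCommGroup (Fin d → F))

instance : Module F (RepSpace ρ) := inferInstanceAs (Module F (Fin d → F))

instance : Module.Finite F (RepSpace ρ) := inferInstanceAs (Module.Finite F (Fin d → F))

instance [Finite F] : Finite (RepSpace ρ) := inferInstanceAs (Finite (Fin d → F))

instance : Module A (RepSpace ρ) := Module.compHom (Fin d → F) ρ.toRingHom

theorem RepSpace.smul_def (a : A) (x : RepSpace ρ) : a • x = (ρ a (x : Fin d → F) : Fin d → F) :=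
  rfl

instance : IsScalarTower F A (RepSpace ρ) :=
  ⟨fun c a x => by
    rw [RepSpace.smul_def, RepSpace.smul_def, map_smul]
    rfl⟩

@[simp]
theorem RepSpace.finrank_eq : Module.finrank F (RepSpace ρ) = d :=
  Module.finrank_fin_fun F

/-- Transport of an `A`-module structure to `F ^ d`. -/
def transport {M : Type*} [AddCommGroup M] [Module F M] [Module A M] [IsScalarTower F A M]
    (e : (Fin d → F) ≃ₗ[F] M) : A →ₐ[F] Module.End F (Fin d → F) :=
  (e.symm.conjAlgEquiv F : _ →ₐ[F] _).comp (Algebra.lsmul F F M)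

theorem transport_apply {M : Type*} [AddCommGroup M] [Module F M] [Module A M]
    [IsScalarTower F A M] (e : (Fin d → F) ≃ₗ[F] M) (a : A) (x : Fin d → F) :
    transport e a x = e.symm (a • e x) := rfl

/-- The isomorphism that defines the transported structure. -/
def transportEquiv {M : Type*} [AddCommGroup M] [Module F M] [Module A M] [IsScalarTower F A M]
    (e : (Fin d → F) ≃ₗ[F] M) : RepSpace (transport (A := A) e) ≃ₗ[A] M :=
  { e with
    map_smul' := fun a x => by
      change e (transport e a x) = a • e x
      exact LinearEquiv.apply_symm_apply e _ }

/-- Orbit counting: a linear isomorphism from `F ^ d` to `M` is the same as a structure `ρ` on `F ^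
d`, obtained by transport, with an `A`-isomorphism from it to `M`. For a given `ρ` these
isomorphisms form a torsor under `Aut M`. -/
theorem card_iso_mul_card_aut {M : Type*} [AddCommGroup M] [Module F M] [Module A M]
    [IsScalarTower F A M] [Finite (A →ₐ[F] Module.End F (Fin d → F))] [Finite M] [Finite F]
    (hM : Module.finrank F M = d) :
    Nat.card {ρ : A →ₐ[F] Module.End F (Fin d → F) // Nonempty (RepSpace ρ ≃ₗ[A] M)} *
      Nat.card (M ≃ₗ[A] M) = glCard F d := by
  have := Fintype.ofFinite {ρ : A →ₐ[F] Module.End F (Fin d → F) // Nonempty (RepSpace ρ ≃ₗ[A] M)}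
  have : Module.Finite F M := Module.Finite.of_finite
  rw [← card_linearEquiv_fun_of_finrank hM]
  have h1 : Nat.card (Σ ρ : {ρ : A →ₐ[F] Module.End F (Fin d → F) //
      Nonempty (RepSpace ρ ≃ₗ[A] M)}, (RepSpace ρ.1 ≃ₗ[A] M)) =
      Nat.card {ρ : A →ₐ[F] Module.End F (Fin d → F) // Nonempty (RepSpace ρ ≃ₗ[A] M)} *
      Nat.card (M ≃ₗ[A] M) := by
    rw [Nat.card_sigma, Nat.card_eq_fintype_card, Finset.sum_congr rfl (g := fun _ =>
      Nat.card (M ≃ₗ[A] M)), Finset.sum_const, smul_eq_mul, Finset.card_univ]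
    rintro ⟨ρ, ⟨e⟩⟩ -
    exact Nat.card_congr
      { toFun := fun f => e.symm.trans f
        invFun := fun f => e.trans f
        left_inv := fun f => by ext; simp
        right_inv := fun f => by ext; simp }
  rw [← h1]
  refine Nat.card_congr (Equiv.symm (Equiv.ofBijective (fun e : (Fin d → F) ≃ₗ[F] M =>
    ⟨⟨transport e, ⟨transportEquiv e⟩⟩, transportEquiv e⟩) ⟨fun e e' h => ?_, ?_⟩))
  · have h2 : ∀ (s t : Σ ρ : {ρ : A →ₐ[F] Module.End F (Fin d → F) //
        Nonempty (RepSpace ρ ≃ₗ[A] M)}, (RepSpace ρ.1 ≃ₗ[A] M)), s = t →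
        ∀ x : Fin d → F, s.2 x = t.2 x := by
      rintro s t rfl x; rfl
    exact LinearEquiv.ext fun x => h2 _ _ h x
  · rintro ⟨⟨ρ, hρ⟩, e⟩
    let e' : (Fin d → F) ≃ₗ[F] M := (e.restrictScalars F : RepSpace ρ ≃ₗ[F] M)
    refine ⟨e', ?_⟩
    have h3 : transport e' = ρ := by
      ext1 a
      refine LinearMap.ext fun x => ?_
      rw [transport_apply, LinearEquiv.symm_apply_eq]
      exact (e.map_smul a x).symm
    have h4 : ∀ (σ : A →ₐ[F] Module.End F (Fin d → F)) (hσ : σ = ρ) (f : RepSpace σ ≃ₗ[A] M),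
        (∀ x : Fin d → F, f x = e x) →
        (⟨⟨σ, ⟨f⟩⟩, f⟩ : Σ ρ : {ρ : A →ₐ[F] Module.End F (Fin d → F) //
          Nonempty (RepSpace ρ ≃ₗ[A] M)}, (RepSpace ρ.1 ≃ₗ[A] M)) = ⟨⟨ρ, hρ⟩, e⟩ := by
      rintro σ rfl f hf
      obtain rfl : f = e := LinearEquiv.ext hf
      rfl
    exact h4 _ h3 _ fun x => rfl

end RepSpace

/-- The multiplicity functions of total weight `d`. -/
def multSet {ι : Type} [Fintype ι] [DecidableEq ι] (w : ι → ℕ) (d : ℕ) : Finset (ι → ℕ) :=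
  (Fintype.piFinset fun _ => Finset.range (d + 1)).filter fun n => ∑ i, n i * w i = d

theorem mem_multSet {ι : Type} [Fintype ι] [DecidableEq ι] {w : ι → ℕ} (hw : ∀ i, 0 < w i)
    {d : ℕ} {n : ι → ℕ} : n ∈ multSet w d ↔ ∑ i, n i * w i = d := by
  simp only [multSet, Finset.mem_filter, Fintype.mem_piFinset, Finset.mem_range, and_iff_right_iff_imp]
  rintro h i
  have h1 : n i * w i ≤ d := h ▸ Finset.single_le_sum (f := fun i => n i * w i)
    (fun _ _ => Nat.zero_le _) (Finset.mem_univ i)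
  have := hw i
  nlinarith [Nat.le_mul_of_pos_right (n i) this]

namespace IndecFamily

variable {F : Type u} {A : Type v} [Field F] [Ring A] [Algebra F A] {ι : Type} [Fintype ι]
  [DecidableEq ι] (B : IndecFamily F A ι)

/-- The dimension of `I i`. -/
def dim (i : ι) : ℕ := Module.finrank F (B.I i)

omit [Fintype ι] [DecidableEq ι] in
theorem dim_pos (i : ι) : 0 < B.dim i := by
  have := B.triv i |>.1
  have : Nontrivial (B.I i) := by
    by_contra h
    rw [not_nontrivial_iff_subsingleton] at h
    exact one_ne_zero (α := Module.End A (B.I i)) (Subsingleton.elim _ _)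
  have : Module.Finite F (B.I i) := Module.Finite.of_finite
  exact Module.finrank_pos

omit [DecidableEq ι] in
theorem finrank_obj (n : ι → ℕ) : Module.finrank F (B.obj n) = ∑ i, n i * B.dim i := by
  have : ∀ i, Module.Finite F (B.I i) := fun i => Module.Finite.of_finite
  rw [Module.finrank_pi_fintype, Fintype.sum_sigma]
  refine Finset.sum_congr rfl fun i _ => ?_
  change ∑ _y : Fin (n i), B.dim i = _
  rw [Finset.sum_const, Finset.card_univ, Fintype.card_fin, smul_eq_mul]

/-- The sum of an isomorphism invariant over all module structures on `F ^ d`. -/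
theorem sum_rep [Finite F] {d : ℕ} [Fintype (A →ₐ[F] Module.End F (Fin d → F))]
    (h : (A →ₐ[F] Module.End F (Fin d → F)) → ℚ) (H : (ι → ℕ) → ℚ)
    (hB : ∀ ρ, h ρ ≠ 0 → ∃ n, Nonempty (RepSpace ρ ≃ₗ[A] B.obj n))
    (hH : ∀ ρ n, Nonempty (RepSpace ρ ≃ₗ[A] B.obj n) → h ρ = H n) :
    (∑ ρ, h ρ) / glCard F d =
      ∑ n ∈ multSet B.dim d, H n / Nat.card (Module.End A (B.obj n))ˣ := by
  classical
  have hdim : ∀ (ρ : A →ₐ[F] Module.End F (Fin d → F)) n,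
      Nonempty (RepSpace ρ ≃ₗ[A] B.obj n) → n ∈ multSet B.dim d := by
    rintro ρ n ⟨e⟩
    rw [mem_multSet B.dim_pos, ← finrank_obj, ← (e.restrictScalars F).finrank_eq,
      RepSpace.finrank_eq]
  -- By Krull–Schmidt at most one `n` contributes, and if there is none then `h ρ = 0` by `hB`.
  have h1 : ∀ ρ, h ρ = ∑ n ∈ multSet B.dim d,
      if Nonempty (RepSpace ρ ≃ₗ[A] B.obj n) then H n else 0 := by
    intro ρ
    by_cases hex : ∃ n, Nonempty (RepSpace ρ ≃ₗ[A] B.obj n)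
    · obtain ⟨n, hn⟩ := hex
      rw [Finset.sum_eq_single n, if_pos hn, hH ρ n hn]
      · intro n' _ hne
        rw [if_neg]
        rintro ⟨e'⟩
        obtain ⟨e⟩ := hn
        exact hne (B.eq_of_equiv (e'.symm.trans e))
      · exact fun h' => absurd (hdim ρ n hn) h'
    · rw [Finset.sum_eq_zero]
      · exact by_contra fun h0 => hex (hB ρ h0)
      · intro n _
        rw [if_neg fun h' => hex ⟨n, h'⟩]
  rw [Finset.sum_congr rfl fun ρ _ => h1 ρ, Finset.sum_comm, Finset.sum_div]
  refine Finset.sum_congr rfl fun n hn => ?_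
  rw [← Finset.sum_filter, Finset.sum_const, nsmul_eq_mul]
  rw [mem_multSet B.dim_pos, ← finrank_obj] at hn
  have hc := card_iso_mul_card_aut (A := A) (M := B.obj n) hn
  rw [Nat.card_eq_fintype_card, Fintype.card_subtype] at hc
  have hpos : (Nat.card (B.obj n ≃ₗ[A] B.obj n) : ℚ) ≠ 0 := by exact_mod_cast Nat.card_pos.ne'
  have hgl : (glCard F d : ℚ) ≠ 0 := by exact_mod_cast (glCard_pos F d).ne'
  rw [← card_linearEquiv_self]
  field_simp
  rw [← hc]
  push_cast
  ring

end IndecFamily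

/-! ### Cyclic modules over `F[X]` -/

section Quotients

variable {F : Type u} [Field F]

theorem finrank_quotient_span (g : F[X]) (hg : g ≠ 0) :
    Module.finrank F (F[X] ⧸ Ideal.span {g}) = g.natDegree := by
  have := (AdjoinRoot.powerBasis hg).finrank
  rw [AdjoinRoot.powerBasis_dim] at this
  exact this

theorem finite_quotient_span [Finite F] (g : F[X]) (hg : g ≠ 0) :
    Finite (F[X] ⧸ Ideal.span {g}) := by
  have : Module.Finite F (F[X] ⧸ Ideal.span {g}) := (AdjoinRoot.powerBasis hg).finite
  exact Module.finite_of_finite F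

theorem card_quotient_span [Finite F] (g : F[X]) (hg : g ≠ 0) :
    Nat.card (F[X] ⧸ Ideal.span {g}) = Nat.card F ^ g.natDegree := by
  have : Module.Finite F (F[X] ⧸ Ideal.span {g}) := (AdjoinRoot.powerBasis hg).finite
  rw [← finrank_quotient_span g hg]
  exact Module.natCard_eq_pow_finrank

/-- Endomorphisms of a cyclic module over a commutative ring are multiplications. -/
def evalOne {R : Type*} [CommRing R] [Algebra F R] (J : Ideal R) :
    Module.End R (R ⧸ J) →ₐ[F] R ⧸ J :=
  AlgHom.ofLinearMap
    { toFun := fun φ => φ 1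
      map_add' := fun _ _ => rfl
      map_smul' := fun _ _ => rfl }
    rfl
    (fun φ ψ => by
      obtain ⟨r, hr⟩ := Ideal.Quotient.mk_surjective (ψ 1)
      have h1 : ψ 1 = r • (1 : R ⧸ J) := by rw [← hr, Algebra.smul_def, mul_one]; rfl
      change φ (ψ 1) = φ 1 * ψ 1
      rw [h1, map_smul, Algebra.smul_def, Algebra.smul_def, mul_one, mul_comm])

theorem evalOne_apply {R : Type*} [CommRing R] [Algebra F R] (J : Ideal R)
    (φ : Module.End R (R ⧸ J)) : evalOne (F := F) J φ = φ 1 := rfl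

theorem evalOne_bijective {R : Type*} [CommRing R] [Algebra F R] (J : Ideal R) :
    Function.Bijective (evalOne (F := F) J) := by
  refine ⟨fun φ ψ h => ?_, fun x => ?_⟩
  · refine LinearMap.ext fun y => ?_
    obtain ⟨r, rfl⟩ := Ideal.Quotient.mk_surjective y
    have h1 : Ideal.Quotient.mk J r = r • (1 : R ⧸ J) := by rw [Algebra.smul_def, mul_one]; rfl
    rw [h1, map_smul, map_smul]
    exact congrArg (r • ·) h
  · refine ⟨LinearMap.mulRight R x, ?_⟩
    rw [evalOne_apply, LinearMap.mulRight_apply, one_mul]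

theorem span_pow_le (p : F[X]) (e : ℕ) (he : e ≠ 0) : Ideal.span {p ^ e} ≤ Ideal.span {p} := by
  rw [Ideal.span_singleton_le_span_singleton]
  exact dvd_pow_self p he

theorem smul_one_quotient {R : Type*} [CommRing R] (J : Ideal R) (r : R) :
    r • (1 : R ⧸ J) = Ideal.Quotient.mk J r := by
  rw [Algebra.smul_def, mul_one]; rfl

/-- The endomorphism ring of `F[X] / p ^ e` maps to the residue field. -/
def residueHom (p : F[X]) (e : ℕ) (he : e ≠ 0) :
    Module.End F[X] (F[X] ⧸ Ideal.span {p ^ e}) →ₐ[F] AdjoinRoot p :=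
  (Ideal.Quotient.factorₐ F (span_pow_le p e he)).comp (evalOne _)

theorem residueHom_surjective (p : F[X]) (e : ℕ) (he : e ≠ 0) :
    Function.Surjective (residueHom p e he) :=
  (Ideal.Quotient.factor_surjective (span_pow_le p e he)).comp
    (evalOne_bijective (F := F) (Ideal.span {p ^ e})).2

/-- An endomorphism is multiplication by the class of some `r`. If `p ∤ r`, a Bézout relation with
`p ^ e` inverts it; if `p ∣ r`, it is nilpotent in a nonzero ring. -/
theorem residueHom_eq_zero_iff (p : F[X]) (hp : Irreducible p) (e : ℕ) (he : e ≠ 0)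
    (φ : Module.End F[X] (F[X] ⧸ Ideal.span {p ^ e})) :
    residueHom p e he φ = 0 ↔ ¬ IsUnit φ := by
  let E : Module.End F[X] (F[X] ⧸ Ideal.span {p ^ e}) ≃ₐ[F] _ :=
    AlgEquiv.ofBijective (evalOne (F := F) (Ideal.span {p ^ e})) (evalOne_bijective _)
  have hE : IsUnit φ ↔ IsUnit (evalOne (F := F) _ φ) := (MulEquiv.isUnit_map E).symm
  rw [hE]
  obtain ⟨r, hr⟩ := Ideal.Quotient.mk_surjective (evalOne (F := F) _ φ)
  have h1 : residueHom p e he φ = 0 ↔ p ∣ r := by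
    change Ideal.Quotient.factor (span_pow_le p e he) (evalOne (F := F) _ φ) = 0 ↔ _
    rw [← hr, Ideal.Quotient.factor_mk, Ideal.Quotient.eq_zero_iff_mem, Ideal.mem_span_singleton]
  rw [h1, ← hr, ← not_iff_not, not_not]
  constructor
  · intro h
    have hc : IsCoprime (p ^ e) r := ((hp.coprime_iff_not_dvd).mpr h).pow_left
    obtain ⟨a, b, hab⟩ := hc
    refine IsUnit.of_mul_eq_one (Ideal.Quotient.mk _ b) ?_
    rw [← map_mul, ← map_one (Ideal.Quotient.mk _), Ideal.Quotient.eq, Ideal.mem_span_singleton]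
    exact ⟨-a, by linear_combination hab⟩
  · rintro hu ⟨c, rfl⟩
    have hn : IsNilpotent (Ideal.Quotient.mk (Ideal.span {p ^ e}) (p * c)) := ⟨e, by
      rw [← map_pow, Ideal.Quotient.eq_zero_iff_mem, Ideal.mem_span_singleton, mul_pow]
      exact dvd_mul_right _ _⟩
    have : Nontrivial (F[X] ⧸ Ideal.span {p ^ e}) := by
      rw [Ideal.Quotient.nontrivial_iff, Ne, Ideal.span_singleton_eq_top]
      exact fun h => hp.not_isUnit ((isUnit_pow_iff he).mp h)
    exact hn.not_isUnit hu

theorem trivialIdempotents_of_residue {E K : Type*} [Ring E] [Field K] (π : E →+* K)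
    (hπ : ∀ x, π x = 0 ↔ ¬ IsUnit x) : TrivialIdempotents E := by
  refine ⟨π.domain_nontrivial, fun e he => ?_⟩
  have unit_idem : ∀ e : E, IsIdempotentElem e → IsUnit e → e = 1 := fun e he hu =>
    hu.mul_left_cancel (by rw [he.eq, mul_one])
  by_cases hu : IsUnit e
  · exact Or.inr (unit_idem e he hu)
  · left
    have h0 := (hπ e).mpr hu
    have h1 : IsUnit (1 - e) := by
      by_contra h
      have := (hπ _).mpr h
      rw [map_sub, h0, map_one, sub_zero] at this
      exact one_ne_zero this
    have := unit_idem _ he.one_sub h1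
    simpa using this

theorem indecModule_quotient (p : F[X]) (hp : Irreducible p) (e : ℕ) (he : e ≠ 0) :
    IndecModule F[X] (F[X] ⧸ Ideal.span {p ^ e}) := by
  have : Fact (Irreducible p) := ⟨hp⟩
  exact trivialIdempotents_of_residue (residueHom p e he).toRingHom
    (residueHom_eq_zero_iff p hp e he)

/-- The annihilator of the module determines the monic prime power. -/
theorem eq_of_quotient_equiv {p q : F[X]} (hpm : p.Monic) (hqm : q.Monic) (hp : Irreducible p)
    (hq : Irreducible q) {a b : ℕ} (ha : a ≠ 0)
    (h : (F[X] ⧸ Ideal.span {p ^ a}) ≃ₗ[F[X]] (F[X] ⧸ Ideal.span {q ^ b})) : p = q ∧ a = b := by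
  have h1 := h.annihilator_eq
  rw [Ideal.annihilator_quotient, Ideal.annihilator_quotient, Ideal.span_singleton_eq_span_singleton]
    at h1
  have h2 : p ^ a = q ^ b := eq_of_monic_of_associated (hpm.pow a) (hqm.pow b) h1
  have h3 : p ∣ q := hp.prime.dvd_of_dvd_pow (h2 ▸ dvd_pow_self p ha)
  have h4 : p = q := eq_of_monic_of_associated hpm hqm (hp.associated_of_dvd hq h3)
  refine ⟨h4, ?_⟩
  subst h4
  have := congrArg natDegree h2
  rw [natDegree_pow, natDegree_pow] at this
  exact Nat.eq_of_mul_eq_mul_right hp.natDegree_pos this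

/-- Homomorphisms from `F[X] / g` are the elements killed by `g`. On a finite module, the kernel and
the cokernel of multiplication by `g` have the same order, and here the cokernel is `F[X] / (g, h)`.
-/
theorem card_hom_quotient [Finite F] (g h : F[X]) (hg : g ≠ 0) (hh : h ≠ 0) :
    Nat.card ((F[X] ⧸ Ideal.span {g}) →ₗ[F[X]] (F[X] ⧸ Ideal.span {h})) =
      Nat.card (F[X] ⧸ (Ideal.span {g} ⊔ Ideal.span {h})) := by
  have := finite_quotient_span h hh
  let N := F[X] ⧸ Ideal.span {h}
  let μ : N →ₗ[F[X]] N := LinearMap.lsmul F[X] N g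
  have hker : Nat.card ((F[X] ⧸ Ideal.span {g}) →ₗ[F[X]] N) = Nat.card (LinearMap.ker μ) := by
    refine Nat.card_congr
      { toFun := fun φ => ⟨φ 1, ?_⟩
        invFun := fun x => (Ideal.span {g}).liftQ (LinearMap.toSpanSingleton F[X] N x.1) ?_
        left_inv := fun φ => ?_
        right_inv := fun x => ?_ }
    · have h1 : g • (1 : F[X] ⧸ Ideal.span {g}) = 0 := by
        rw [smul_one_quotient]
        exact Ideal.Quotient.eq_zero_iff_mem.mpr (Ideal.mem_span_singleton_self g)
      change g • φ 1 = 0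
      rw [← map_smul, h1, map_zero]
    · rw [Ideal.span, Submodule.span_le]
      rintro _ rfl
      exact x.2
    · refine LinearMap.ext fun y => ?_
      obtain ⟨r, rfl⟩ := Ideal.Quotient.mk_surjective y
      have h1 := (smul_one_quotient (Ideal.span {g}) r).symm
      rw [h1, map_smul φ, ← h1]
      rfl
    · ext1
      change (1 : F[X]) • x.1 = x.1
      exact one_smul _ _
  have hcoker : Nat.card (N ⧸ LinearMap.range μ) = Nat.card (LinearMap.ker μ) := by
    have h1 := Submodule.card_eq_card_quotient_mul_card (LinearMap.range μ)
    have h2 := Submodule.card_eq_card_quotient_mul_card (LinearMap.ker μ)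
    have h3 := Nat.card_congr μ.quotKerEquivRange.toEquiv
    rw [h3, mul_comm] at h2
    have : Nat.card (LinearMap.range μ) ≠ 0 := Nat.card_pos.ne'
    rw [h1] at h2
    exact Nat.eq_of_mul_eq_mul_left (Nat.pos_of_ne_zero this) h2
  rw [hker, ← hcoker]
  have hr : LinearMap.range μ = Submodule.restrictScalars F[X]
      ((Ideal.span {g}).map (Ideal.Quotient.mk (Ideal.span {h})) :
        Submodule (F[X] ⧸ Ideal.span {h}) (F[X] ⧸ Ideal.span {h})) := by
    rw [Ideal.map_span, Set.image_singleton]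
    ext x
    rw [LinearMap.mem_range, Submodule.restrictScalars_mem, Ideal.mem_span_singleton]
    constructor
    · rintro ⟨y, rfl⟩
      exact ⟨y, rfl⟩
    · rintro ⟨y, rfl⟩
      exact ⟨y, rfl⟩
  rw [hr, sup_comm]
  exact (Nat.card_congr (Submodule.Quotient.restrictScalarsEquiv F[X] _).toEquiv).trans
    (Nat.card_congr (DoubleQuot.quotQuotEquivQuotSup (Ideal.span {h}) (Ideal.span {g})).toEquiv)

theorem card_hom_quotient_self [Finite F] (p : F[X]) (hp : p ≠ 0) (a b : ℕ) :
    Nat.card ((F[X] ⧸ Ideal.span {p ^ a}) →ₗ[F[X]] (F[X] ⧸ Ideal.span {p ^ b})) =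
      (Nat.card F ^ p.natDegree) ^ min a b := by
  rw [card_hom_quotient _ _ (pow_ne_zero _ hp) (pow_ne_zero _ hp)]
  have : Ideal.span {p ^ a} ⊔ Ideal.span {p ^ b} = Ideal.span {p ^ min a b} := by
    rcases le_total a b with h | h
    · rw [min_eq_left h, sup_eq_left, Ideal.span_singleton_le_span_singleton]
      exact pow_dvd_pow p h
    · rw [min_eq_right h, sup_eq_right, Ideal.span_singleton_le_span_singleton]
      exact pow_dvd_pow p h
  rw [this, card_quotient_span _ (pow_ne_zero _ hp), natDegree_pow, ← pow_mul, mul_comm]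

theorem card_hom_quotient_of_ne [Finite F] {p q : F[X]} (hpm : p.Monic) (hqm : q.Monic)
    (hp : Irreducible p) (hq : Irreducible q) (hne : p ≠ q) (a b : ℕ) :
    Nat.card ((F[X] ⧸ Ideal.span {p ^ a}) →ₗ[F[X]] (F[X] ⧸ Ideal.span {q ^ b})) = 1 := by
  rw [card_hom_quotient _ _ (pow_ne_zero _ hp.ne_zero) (pow_ne_zero _ hq.ne_zero)]
  have hc : IsCoprime (p ^ a) (q ^ b) := by
    refine IsCoprime.pow ((hp.coprime_iff_not_dvd).mpr fun h => hne ?_)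
    exact eq_of_monic_of_associated hpm hqm (hp.associated_of_dvd hq h)
  have : Ideal.span {p ^ a} ⊔ Ideal.span {q ^ b} = ⊤ :=
    Ideal.isCoprime_iff_sup_eq.mp ((Ideal.isCoprime_span_singleton_iff _ _).mpr hc)
  rw [this, Nat.card_eq_one_iff_unique]
  exact ⟨Ideal.Quotient.subsingleton_iff.mpr rfl, ⟨0⟩⟩

/-- The cyclic modules `F[X] / p ^ e` for `p` in a finite set of monic irreducible polynomials
and `1 ≤ e ≤ D`. -/
def cyclicFamily [Finite F] {α : Type} (p : α → F[X]) (hm : ∀ a, (p a).Monic)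
    (hi : ∀ a, Irreducible (p a)) (hinj : Function.Injective p) (D : ℕ) :
    IndecFamily F F[X] (α × Fin D) where
  I i := F[X] ⧸ Ideal.span {p i.1 ^ (i.2.1 + 1)}
  acg i := inferInstance
  modF i := inferInstance
  modA i := inferInstance
  tower i := inferInstance
  finI i := finite_quotient_span _ (pow_ne_zero _ (hi i.1).ne_zero)
  K i := AdjoinRoot (p i.1)
  fieldK i := @AdjoinRoot.instField F _ (p i.1) ⟨hi i.1⟩
  algK i := inferInstance
  finK i := finite_quotient_span _ (hi i.1).ne_zero
  π i := residueHom (p i.1) (i.2.1 + 1) (Nat.succ_ne_zero _)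
  surj i := residueHom_surjective _ _ _
  ker i := residueHom_eq_zero_iff _ (hi i.1) _ _
  triv i := indecModule_quotient _ (hi i.1) _ (Nat.succ_ne_zero _)
  noniso i j := by
    rintro ⟨e⟩
    obtain ⟨h1, h2⟩ := eq_of_quotient_equiv (hm i.1) (hm j.1) (hi i.1) (hi j.1)
      (Nat.succ_ne_zero _) e
    exact Prod.ext (hinj h1) (Fin.ext (by omega))

end Quotients

/-! ### Torsion modules over `F[X]` as sums of cyclic modules -/

section Completeness

/-- The coordinate idempotents sum to `1`, so they are not all `0`, and one that is not `0` is `1`.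
-/
theorem IndecModule.exists_equiv_of_pi {R : Type*} [Ring R] {κ : Type*} [Fintype κ] [DecidableEq κ]
    (N : κ → Type*) [∀ k, AddCommGroup (N k)] [∀ k, Module R (N k)]
    (h : IndecModule R (∀ k, N k)) : ∃ k, Nonempty ((∀ k, N k) ≃ₗ[R] N k) := by
  let ε : κ → Module.End R (∀ k, N k) := fun k => LinearMap.single R N k ∘ₗ LinearMap.proj k
  have hid : ∀ k, IsIdempotentElem (ε k) := fun k => by
    refine LinearMap.ext fun x => ?_
    simp [ε, Module.End.mul_apply]
  have hex : ∃ k, ε k = 1 := by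
    by_contra hall
    push Not at hall
    have h0 : ∀ k, ε k = 0 := fun k => (h.2 _ (hid k)).resolve_right (hall k)
    have := h.1
    refine one_ne_zero (α := Module.End R (∀ k, N k)) (LinearMap.ext fun x => funext fun k => ?_)
    have h1 := congrFun (LinearMap.congr_fun (h0 k) x) k
    simpa [ε] using h1
  obtain ⟨k, hk⟩ := hex
  exact ⟨k, ⟨LinearEquiv.ofLinearMap (LinearMap.proj k) (LinearMap.single R N k)
    (LinearMap.ext fun x => by simp) hk⟩⟩

/-- The structure theorem over a principal ideal domain makes an indecomposable torsion module
cyclic of prime power order; the annihilator forces the prime to be one of the `p a`. -/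
theorem exists_equiv_quotient {F : Type u} [Field F] {α : Type} [Fintype α]
    (p : α → F[X]) (hi : ∀ a, Irreducible (p a)) {X : Type u} [AddCommGroup X] [Module F[X] X]
    [Finite X] (hX : IndecModule F[X] X) (N : ℕ) (hN : ∀ x : X, (∏ a, p a) ^ N • x = 0) :
    ∃ a e, e ≠ 0 ∧ Nonempty (X ≃ₗ[F[X]] (F[X] ⧸ Ideal.span {p a ^ e})) := by
  classical
  have hf0 : (∏ a, p a) ^ N ≠ 0 := pow_ne_zero _ (Finset.prod_ne_zero_iff.mpr fun a _ =>
    (hi a).ne_zero)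
  have ht : Module.IsTorsion F[X] X := fun {x} =>
    ⟨⟨_, mem_nonZeroDivisors_of_ne_zero hf0⟩, hN x⟩
  have : Module.Finite F[X] X := Module.Finite.of_finite
  obtain ⟨κ, _, q, hq, e, ⟨L⟩⟩ := Module.equiv_directSum_of_isTorsion ht
  let L' := L.trans (DirectSum.linearEquivFunOnFintype F[X] κ
    (fun i => F[X] ⧸ Submodule.span F[X] {q i ^ e i}))
  obtain ⟨k, ⟨ek⟩⟩ := (hX.of_equiv L').exists_equiv_of_pi
  let E : X ≃ₗ[F[X]] (F[X] ⧸ Ideal.span {q k ^ e k}) := L'.trans ek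
  have hann : (∏ a, p a) ^ N ∈ Module.annihilator F[X] X := Module.mem_annihilator.mpr hN
  rw [E.annihilator_eq, Ideal.annihilator_quotient, Ideal.mem_span_singleton] at hann
  have he : e k ≠ 0 := by
    intro h0
    have h1 := (hX.of_equiv E).1
    have : Subsingleton (F[X] ⧸ Ideal.span {q k ^ e k}) := by
      rw [h0, pow_zero, Ideal.span_singleton_one]
      exact Ideal.Quotient.subsingleton_iff.mpr rfl
    exact one_ne_zero (α := Module.End F[X] (F[X] ⧸ Ideal.span {q k ^ e k}))
      (Subsingleton.elim _ _)
  have h2 : q k ∣ ∏ a, p a := (hq k).prime.dvd_of_dvd_pow ((dvd_pow_self _ he).trans hann)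
  obtain ⟨a, -, ha⟩ := (hq k).prime.exists_mem_finset_dvd h2
  have h3 : Associated (q k) (p a) := (hq k).associated_of_dvd (hi a) ha
  have h4 : Ideal.span {q k ^ e k} = Ideal.span {p a ^ e k} :=
    Ideal.span_singleton_eq_span_singleton.mpr (h3.pow_pow)
  exact ⟨a, e k, he, ⟨E.trans (Submodule.quotEquivOfEq _ _ h4)⟩⟩

theorem cyclicFamily_complete {F : Type u} [Field F] [Finite F] {α : Type} [Fintype α]
    [DecidableEq α] (p : α → F[X])
    (hm : ∀ a, (p a).Monic) (hi : ∀ a, Irreducible (p a)) (hinj : Function.Injective p) (D : ℕ)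
    {M : Type u} [AddCommGroup M] [Module F M] [Module F[X] M] [IsScalarTower F F[X] M] [Finite M]
    (hM : Module.finrank F M ≤ D) (N : ℕ) (hN : ∀ x : M, (∏ a, p a) ^ N • x = 0) :
    ∃ n, Nonempty (M ≃ₗ[F[X]] (cyclicFamily p hm hi hinj D).obj n) := by
  refine IndecFamily.exists_equiv_obj _ fun X hX => ?_
  obtain ⟨a, e, he, ⟨E⟩⟩ := exists_equiv_quotient p hi hX N fun x => by
    ext1
    exact hN x
  have : Module.Finite F M := Module.Finite.of_finite
  have hle : e ≤ D := by
    have h1 : Module.finrank F X ≤ Module.finrank F M :=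
      Submodule.finrank_le (X.restrictScalars F)
    rw [(E.restrictScalars F).finrank_eq, finrank_quotient_span _ (pow_ne_zero _ (hi a).ne_zero),
      natDegree_pow] at h1
    have := (hi a).natDegree_pos
    nlinarith
  obtain ⟨e, rfl⟩ := Nat.exists_eq_succ_of_ne_zero he
  exact ⟨(a, ⟨e, hle⟩), ⟨E⟩⟩

end Completeness

/-! ### Orders of automorphism groups -/

section Cards

/-- `(1 - x) (1 - x ^ 2) ⋯ (1 - x ^ n)` in any field. -/
def poch {k : Type*} [Field k] (x : k) (n : ℕ) : k := ∏ i ∈ Finset.range n, (1 - x ^ (i + 1))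

/-- The number of automorphisms of a module over `k[t] / t ^ D` with multiplicities `n`, as a
function of the cardinality of the field. -/
def autNum {k : Type*} [Field k] (x : k) {D : ℕ} (n : Fin D → ℕ) : k :=
  x ^ (∑ i, ∑ j, n i * n j * min (i.1 + 1) (j.1 + 1)) * ∏ i, poch x⁻¹ (n i)

theorem glCard_eq (K : Type*) [Field K] [Finite K] (n : ℕ) :
    (glCard K n : ℚ) = (Nat.card K : ℚ) ^ (n * n) * poch (Nat.card K : ℚ)⁻¹ n := by
  have := Fintype.ofFinite K
  have hq : (Nat.card K : ℚ) ≠ 0 := by exact_mod_cast Nat.card_pos.ne'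
  have h1 : glCard K n = ∏ i : Fin n, (Nat.card K ^ n - Nat.card K ^ (i : ℕ)) := by
    have := Matrix.card_GL_field (𝔽 := K) n
    rw [Fintype.card_eq_nat_card] at this
    exact this
  rw [h1, Fin.prod_univ_eq_prod_range (fun i => Nat.card K ^ n - Nat.card K ^ i) n, pow_mul,
    poch, ← Finset.prod_range_reflect,
    show ((Nat.card K : ℚ) ^ n) ^ n = ∏ _i ∈ Finset.range n, (Nat.card K : ℚ) ^ n by simp,
    ← Finset.prod_mul_distrib]
  push_cast
  refine Finset.prod_congr rfl fun i hi => ?_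
  rw [Finset.mem_range] at hi
  rw [Nat.cast_sub (Nat.pow_le_pow_right Nat.card_pos (by omega)), mul_sub, mul_one, Nat.cast_pow,
    Nat.cast_pow, inv_pow, show n - 1 - i = n - (i + 1) by omega]
  congr 1
  rw [eq_mul_inv_iff_mul_eq₀ (pow_ne_zero _ hq), ← pow_add]
  congr 1
  omega

theorem poch_inv_pos {x : ℚ} (hx : 1 < x) (n : ℕ) : 0 < poch x⁻¹ n :=
  Finset.prod_pos fun i _ => sub_pos.mpr (pow_lt_one₀ (by positivity) (inv_lt_one_of_one_lt₀ hx)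
    (Nat.succ_ne_zero i))

theorem autNum_pos {x : ℚ} (hx : 1 < x) {D : ℕ} (n : Fin D → ℕ) : 0 < autNum x n :=
  mul_pos (by positivity) (Finset.prod_pos fun _ _ => poch_inv_pos hx _)

theorem nilCount_zero {F : Type*} [Field F] (R : Type*) [Ring R] [Algebra F R] :
    nilCount (0 : F[X]) R = Nat.card R := by
  refine Nat.card_congr (Equiv.subtypeUnivEquiv fun x => ?_)
  rw [map_zero]
  exact IsNilpotent.zero

theorem one_lt_card (K : Type*) [Field K] [Finite K] : (1 : ℚ) < Nat.card K := by
  exact_mod_cast Finite.one_lt_card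

theorem matMass_zero (F : Type*) [Field F] (K : Type*) [Field K] [Finite K] [Algebra F K] (n : ℕ) :
    matMass (0 : F[X]) K n = (poch (Nat.card K : ℚ)⁻¹ n)⁻¹ := by
  have hq : (Nat.card K : ℚ) ≠ 0 := by exact_mod_cast Nat.card_pos.ne'
  have h1 : Nat.card (Matrix (Fin n) (Fin n) K) = Nat.card K ^ (n * n) := by
    have := Fintype.ofFinite K
    rw [Matrix, Nat.card_fun, Nat.card_fun, ← pow_mul]
    simp
  have h2 := glCard_eq K n
  rw [matMass, nilCount_zero, h1]
  rw [glCard] at h2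
  rw [h2]
  have := (poch_inv_pos (one_lt_card K) n).ne'
  push_cast
  field_simp

theorem card_hom_pi {R : Type*} [CommRing R] {κ κ' : Type*} [Fintype κ] [DecidableEq κ] [Fintype κ']
    (M : κ → Type*) (N : κ' → Type*) [∀ k, AddCommGroup (M k)] [∀ k, Module R (M k)]
    [∀ k, AddCommGroup (N k)] [∀ k, Module R (N k)] :
    Nat.card ((∀ k, M k) →ₗ[R] (∀ k, N k)) = ∏ s, ∏ t, Nat.card (M s →ₗ[R] N t) := by
  have h1 : Nat.card ((∀ k, M k) →ₗ[R] (∀ k, N k)) = Nat.card (∀ s t, M s →ₗ[R] N t) := by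
    rw [← Nat.card_congr (LinearMap.lsum R M R (M := ∀ k, N k)).toEquiv]
    refine Nat.card_congr (Equiv.piCongrRight fun s => ?_)
    exact
      { toFun := fun f t => LinearMap.proj t ∘ₗ f
        invFun := fun g => LinearMap.pi g
        left_inv := fun f => rfl
        right_inv := fun g => rfl }
  rw [h1, Nat.card_pi]
  simp only [Nat.card_pi]

theorem card_end_cyclicFamily {F : Type u} [Field F] [Finite F] {α : Type} [Fintype α]
    [DecidableEq α] (p : α → F[X]) (hm : ∀ a, (p a).Monic) (hi : ∀ a, Irreducible (p a))
    (hinj : Function.Injective p) (D : ℕ) (n : α × Fin D → ℕ) :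
    Nat.card (Module.End F[X] ((cyclicFamily p hm hi hinj D).obj n)) =
      ∏ a, (Nat.card F ^ (p a).natDegree) ^
        (∑ i, ∑ j, n (a, i) * n (a, j) * min (i.1 + 1) (j.1 + 1)) := by
  set B := cyclicFamily p hm hi hinj D with hB
  have h1 : ∀ a b i j, Nat.card (B.I (a, i) →ₗ[F[X]] B.I (b, j)) =
      if a = b then (Nat.card F ^ (p a).natDegree) ^ min (i.1 + 1) (j.1 + 1) else 1 := by
    intro a b i j
    split_ifs with hab
    · subst hab
      exact card_hom_quotient_self _ (hi a).ne_zero _ _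
    · exact card_hom_quotient_of_ne (hm a) (hm b) (hi a) (hi b) (fun h => hab (hinj h)) _ _
  rw [card_hom_pi, Fintype.prod_sigma, Fintype.prod_prod_type]
  refine Finset.prod_congr rfl fun a _ => ?_
  simp only [Fintype.prod_sigma, Fintype.prod_prod_type, h1, Finset.prod_const, Finset.card_univ,
    Fintype.card_fin]
  rw [← Finset.prod_pow_eq_pow_sum]
  refine Finset.prod_congr rfl fun i _ => ?_
  rw [← Finset.prod_pow_eq_pow_sum, Finset.prod_eq_single a]
  · rw [← Finset.prod_pow]
    refine Finset.prod_congr rfl fun j _ => ?_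
    rw [if_pos rfl, ← pow_mul, ← pow_mul]
    congr 1
    ring
  · intro b _ hb
    simp [hb.symm]
  · simp

/-- For `f = 0` every endomorphism is counted by `nilCount`, so `nilCount_div_card_units` evaluates
`|End| / |Aut|`. The order of `Aut` then follows from that of `End`, known from the homomorphisms
between cyclic modules. -/
theorem card_aut_cyclicFamily {F : Type u} [Field F] [Finite F] {α : Type} [Fintype α]
    [DecidableEq α] (p : α → F[X]) (hm : ∀ a, (p a).Monic) (hi : ∀ a, Irreducible (p a))
    (hinj : Function.Injective p) (D : ℕ) (n : α × Fin D → ℕ) :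
    (Nat.card (Module.End F[X] ((cyclicFamily p hm hi hinj D).obj n))ˣ : ℚ) =
      ∏ a, autNum ((Nat.card F : ℚ) ^ (p a).natDegree) (fun i => n (a, i)) := by
  set B := cyclicFamily p hm hi hinj D with hB
  have h1 := B.nilCount_div_card_units 0 n
  have hK : ∀ i : α × Fin D, (Nat.card (B.K i) : ℚ) = (Nat.card F : ℚ) ^ (p i.1).natDegree := by
    intro i
    have := card_quotient_span (p i.1) (hi i.1).ne_zero
    exact_mod_cast this
  rw [nilCount_zero, card_end_cyclicFamily] at h1
  simp only [matMass_zero, hK, Finset.prod_inv_distrib] at h1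
  have hpos : (Nat.card (Module.End F[X] (B.obj n))ˣ : ℚ) ≠ 0 := by exact_mod_cast Nat.card_pos.ne'
  have hpos2 : ∏ x : α × Fin D, poch ((Nat.card F : ℚ) ^ (p x.1).natDegree)⁻¹ (n x) ≠ 0 :=
    Finset.prod_ne_zero_iff.mpr fun i _ =>
      (poch_inv_pos (one_lt_pow₀ (one_lt_card F) (hi i.1).natDegree_pos.ne') _).ne'
  rw [div_eq_iff hpos, eq_comm, inv_mul_eq_iff_eq_mul₀ hpos2] at h1
  rw [h1, Fintype.prod_prod_type]
  push_cast
  rw [mul_comm, ← Finset.prod_mul_distrib]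
  rfl

end Cards

open PowerSeries

/-! ### Products of generating series -/

section GeneratingFunctions

/-- The substitution `t ↦ t ^ c` for `c ≥ 1`. -/
def dilate {R : Type*} [Semiring R] (c : ℕ) (f : R⟦X⟧) : R⟦X⟧ :=
  PowerSeries.mk fun d => if c ∣ d then PowerSeries.coeff (d / c) f else 0

theorem coeff_prod_mk {R : Type*} [CommSemiring R] {α : Type} [Fintype α] [DecidableEq α]
    {T : α → Type} (wt : ∀ a, T a → ℕ) (S : ∀ a, ℕ → Finset (T a))
    (hS : ∀ a k t, t ∈ S a k ↔ wt a t = k) (d : ℕ) (Stot : Finset (∀ a, T a))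
    (hSt : ∀ n, n ∈ Stot ↔ ∑ a, wt a (n a) = d) (H : ∀ a, T a → R) :
    PowerSeries.coeff d (∏ a, PowerSeries.mk fun k => ∑ t ∈ S a k, H a t) =
      ∑ n ∈ Stot, ∏ a, H a (n a) := by
  classical
  rw [PowerSeries.coeff_prod]
  simp only [PowerSeries.coeff_mk, Finset.prod_univ_sum]
  rw [Finset.sum_sigma']
  refine Finset.sum_nbij' (fun x => x.2)
    (fun n => ⟨Finsupp.equivFunOnFinite.symm fun a => wt a (n a), n⟩) ?_ ?_ ?_ ?_ ?_
  · rintro ⟨l, n⟩ h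
    simp only [Finset.mem_sigma, Finset.mem_finsuppAntidiag, Fintype.mem_piFinset, hS] at h
    rw [hSt, ← h.1.1]
    exact Finset.sum_congr rfl fun a _ => h.2 a
  · intro n h
    rw [hSt] at h
    simp only [Finset.mem_sigma, Finset.mem_finsuppAntidiag, Fintype.mem_piFinset, hS]
    exact ⟨⟨h, Finset.subset_univ _⟩, fun a => rfl⟩
  · rintro ⟨l, n⟩ h
    simp only [Finset.mem_sigma, Finset.mem_finsuppAntidiag, Fintype.mem_piFinset, hS] at h
    have : (Finsupp.equivFunOnFinite.symm fun a => wt a (n a)) = l := by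
      ext a
      exact h.2 a
    simp only [this]
  · intro n _
    rfl
  · intro x _
    rfl

theorem coeff_prod_dilate_mk {R : Type*} [CommSemiring R] {ι : Type} [Fintype ι] [DecidableEq ι]
    (w : ι → ℕ) (hw : ∀ i, 0 < w i) (H : ι → ℕ → R) (d : ℕ) :
    PowerSeries.coeff d (∏ i, dilate (w i) (PowerSeries.mk (H i))) =
      ∑ n ∈ multSet w d, ∏ i, H i (n i) := by
  rw [← coeff_prod_mk (T := fun _ => ℕ) (fun i k => k * w i)
    (fun i k => if w i ∣ k then {k / w i} else ∅) _ d (multSet w d) (fun n => mem_multSet hw) H]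
  · congr 2
    funext i
    ext k
    simp only [dilate, PowerSeries.coeff_mk]
    split_ifs <;> simp
  · intro i k t
    split_ifs with h
    · rw [Finset.mem_singleton, Nat.eq_div_iff_mul_eq_left (hw i).ne' h, mul_comm]
      exact eq_comm
    · simp only [Finset.notMem_empty, false_iff]
      rintro rfl
      exact h (dvd_mul_left _ _)

/-- The masses of the `k[t]`-modules killed by a power of `t` and of Loewy length at most `D`. -/
def massSeries {k : Type*} [Field k] (D : ℕ) (x : k) (m : ℕ) : k⟦X⟧ :=
  PowerSeries.mk fun d => ∑ n ∈ multSet (fun j : Fin D => j.1 + 1) d, autNum x n ^ ((m : ℤ) - 1)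

theorem coeff_prod_dilate_massSeries {R : Type*} [Field R] {α : Type} [Fintype α]
    [DecidableEq α] (D : ℕ) (c : α → ℕ) (hc : ∀ a, 0 < c a) (x : α → R) (m d : ℕ) :
    PowerSeries.coeff d (∏ a, dilate (c a) (massSeries D (x a) m)) =
      ∑ n ∈ multSet (fun i : α × Fin D => (i.2.1 + 1) * c i.1) d,
        ∏ a, autNum (x a) (fun j => n (a, j)) ^ ((m : ℤ) - 1) := by
  classical
  have hw : ∀ i : α × Fin D, 0 < (i.2.1 + 1) * c i.1 := fun i =>
    Nat.mul_pos (Nat.succ_pos _) (hc i.1)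
  let e : (α × Fin D → ℕ) ≃ (α → Fin D → ℕ) := Equiv.curry _ _ _
  have h1 := coeff_prod_mk (R := R) (T := fun _ : α => Fin D → ℕ)
    (fun a t => ∑ j, t j * (j.1 + 1) * c a)
    (fun a k => if c a ∣ k then multSet (fun j : Fin D => j.1 + 1) (k / c a) else ∅) ?_ d
    ((multSet (fun i : α × Fin D => (i.2.1 + 1) * c i.1) d).map e.toEmbedding) ?_
    (fun a t => autNum (x a) t ^ ((m : ℤ) - 1))
  · rw [Finset.sum_map] at h1
    refine Eq.trans ?_ h1
    congr 2
    funext a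
    ext k
    simp only [dilate, massSeries, PowerSeries.coeff_mk]
    split_ifs <;> simp
  · intro a k t
    rw [← Finset.sum_mul]
    split_ifs with h
    · rw [mem_multSet (fun j => Nat.succ_pos _), Nat.eq_div_iff_mul_eq_left (hc a).ne' h, mul_comm]
      exact eq_comm
    · simp only [Finset.notMem_empty, false_iff]
      rintro rfl
      exact h (dvd_mul_left _ _)
  · intro n
    rw [Finset.mem_map_equiv, mem_multSet hw, Fintype.sum_prod_type]
    simp only [← mul_assoc]
    rfl

end GeneratingFunctions

/-! ### Masses of `F[X]`-modules -/

section PolynomialModules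

variable {F : Type u} [Field F]

/-- The order of the automorphism group of the module attached to `ρ`. -/
def autCard {A : Type*} [Ring A] [Algebra F A] {d : ℕ}
    (ρ : A →ₐ[F] Module.End F (Fin d → F)) : ℕ :=
  Nat.card (Module.End A (RepSpace ρ))ˣ

instance [Finite F] (d : ℕ) : Finite (Module.End F (Fin d → F)) :=
  inferInstanceAs (Finite ((Fin d → F) →ₗ[F] (Fin d → F)))

instance [Finite F] (d : ℕ) : Finite (F[X] →ₐ[F] Module.End F (Fin d → F)) :=
  Finite.of_injective (fun ρ => ρ Polynomial.X) fun _ _ h => Polynomial.algHom_ext h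

theorem card_units_end_congr {A : Type*} [Ring A] {M N : Type*} [AddCommGroup M] [Module A M]
    [AddCommGroup N] [Module A N] (e : M ≃ₗ[A] N) :
    Nat.card (Module.End A M)ˣ = Nat.card (Module.End A N)ˣ :=
  Nat.card_congr (Units.mapEquiv (e.conjRingEquiv : _ ≃* _)).toEquiv

/-- Nilpotency of `∏ p a` selects the modules supported at the `p a`. An isomorphism class has
`|GL_d| / |Aut|` members, so it contributes `|Aut| ^ (m - 1)`, which is a product over the `p a`.
This is the source of the exponent `m - 1`. -/
theorem sum_autCard_pow [Finite F] {α : Type} [Fintype α] [DecidableEq α] (p : α → F[X])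
    (hm : ∀ a, (p a).Monic) (hi : ∀ a, Irreducible (p a)) (hinj : Function.Injective p) {d D : ℕ}
    (hd : d ≤ D) (m : ℕ) [Fintype (F[X] →ₐ[F] Module.End F (Fin d → F))]
    [∀ ρ : F[X] →ₐ[F] Module.End F (Fin d → F), Decidable (IsNilpotent (ρ (∏ a, p a)))] :
    (∑ ρ : F[X] →ₐ[F] Module.End F (Fin d → F),
      if IsNilpotent (ρ (∏ a, p a)) then (autCard ρ : ℚ) ^ m else 0) / glCard F d =
      PowerSeries.coeff d (∏ a, dilate (p a).natDegree
        (massSeries D ((Nat.card F : ℚ) ^ (p a).natDegree) m)) := by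
  set B := cyclicFamily p hm hi hinj D with hB
  have hdim : B.dim = fun i : α × Fin D => (i.2.1 + 1) * (p i.1).natDegree := by
    funext i
    rw [← natDegree_pow, ← finrank_quotient_span _ (pow_ne_zero _ (hi i.1).ne_zero)]
    rfl
  rw [B.sum_rep _ (fun n => (Nat.card (Module.End F[X] (B.obj n))ˣ : ℚ) ^ m),
    coeff_prod_dilate_massSeries D _ (fun a => (hi a).natDegree_pos), hdim]
  · refine Finset.sum_congr rfl fun n _ => ?_
    rw [card_aut_cyclicFamily, Finset.prod_zpow]
    have h0 : ∏ a, autNum ((Nat.card F : ℚ) ^ (p a).natDegree) (fun i => n (a, i)) ≠ 0 :=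
      Finset.prod_ne_zero_iff.mpr fun a _ =>
        (autNum_pos (one_lt_pow₀ (one_lt_card F) (hi a).natDegree_pos.ne') _).ne'
    rw [zpow_sub_one₀ h0, zpow_natCast, div_eq_mul_inv]
  · intro ρ hρ
    obtain ⟨N, hN⟩ : IsNilpotent (ρ (∏ a, p a)) := by
      by_contra h
      exact hρ (if_neg h)
    refine cyclicFamily_complete p hm hi hinj D (by rw [RepSpace.finrank_eq]; exact hd) N
      fun x => ?_
    rw [RepSpace.smul_def, map_pow, hN]
    rfl
  · rintro ρ n ⟨e⟩
    have hn : IsNilpotent (ρ (∏ a, p a)) := by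
      -- The exponent `D` suffices because every cyclic module in the family is killed by the `D`-th
      -- power of its prime.
      refine ⟨D, ?_⟩
      rw [← map_pow]
      suffices h : ∀ x : RepSpace ρ, (∏ a, p a) ^ D • x = 0 from LinearMap.ext fun x => h x
      intro x
      have hx : (∏ a, p a) ^ D • e x = 0 := by
        funext s
        obtain ⟨y, hy⟩ := Ideal.Quotient.mk_surjective (e x s)
        rw [Pi.smul_apply, ← hy]
        change Ideal.Quotient.mk _ ((∏ a, p a) ^ D * y) = 0
        rw [Ideal.Quotient.eq_zero_iff_mem, Ideal.mem_span_singleton]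
        refine Dvd.dvd.mul_right ?_ _
        exact (pow_dvd_pow_of_dvd (Finset.dvd_prod_of_mem p (Finset.mem_univ s.1.1)) _).trans
          (pow_dvd_pow _ s.1.2.2)
      rw [← map_smul] at hx
      exact e.map_eq_zero_iff.mp hx
    rw [if_pos hn, autCard, card_units_end_congr e]

end PolynomialModules

theorem nilCount_congr {F : Type*} [Field F] (f : F[X]) {R S : Type*} [Ring R] [Ring S]
    [Algebra F R] [Algebra F S] (e : R ≃ₐ[F] S) : nilCount f R = nilCount f S := by
  refine Nat.card_congr (e.toEquiv.subtypeEquiv fun x => ?_)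
  change _ ↔ IsNilpotent (aeval (e x) f)
  have h2 : aeval (e x) f = e (aeval x f) := Polynomial.aeval_algHom_apply (e : R →ₐ[F] S) x f
  rw [h2]
  exact (IsNilpotent.map_iff e.injective).symm

/-- The Krull–Schmidt factorisation of the mass generating function. -/
theorem sum_nilCount {F : Type u} {A : Type v} [Field F] [Ring A] [Algebra F A] {ι : Type}
    [Fintype ι] [DecidableEq ι] (B : IndecFamily F A ι) [Finite F] {d : ℕ}
    [Fintype (A →ₐ[F] Module.End F (Fin d → F))]
    (hB : ∀ ρ : A →ₐ[F] Module.End F (Fin d → F), ∃ n, Nonempty (RepSpace ρ ≃ₗ[A] B.obj n))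
    (f : F[X]) :
    (∑ ρ : A →ₐ[F] Module.End F (Fin d → F), (nilCount f (Module.End A (RepSpace ρ)) : ℚ)) /
      glCard F d =
      PowerSeries.coeff d (∏ i, dilate (B.dim i) (PowerSeries.mk (matMass f (B.K i)))) := by
  rw [B.sum_rep _ (fun n => (nilCount f (Module.End A (B.obj n)) : ℚ)) (fun ρ _ => hB ρ),
    coeff_prod_dilate_mk _ B.dim_pos]
  · exact Finset.sum_congr rfl fun n _ => B.nilCount_div_card_units f n
  · rintro ρ n ⟨e⟩
    rw [nilCount_congr f (e.conjAlgEquiv F)]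

/-! ### Double counting of commuting tuples -/

section Swap

variable {F : Type u} [Field F] {d : ℕ}

/-- Endomorphisms of the module attached to `ρ` as endomorphisms of `F ^ d`. -/
def toEnd {A : Type v} [Ring A] [Algebra F A] (ρ : A →ₐ[F] Module.End F (Fin d → F)) :
    Module.End A (RepSpace ρ) →ₐ[F] Module.End F (Fin d → F) :=
  AlgHom.ofLinearMap
    { toFun := fun φ => (φ.restrictScalars F : RepSpace ρ →ₗ[F] RepSpace ρ)
      map_add' := fun _ _ => rfl
      map_smul' := fun _ _ => rfl }
    rfl (fun _ _ => rfl)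

theorem toEnd_injective {A : Type v} [Ring A] [Algebra F A]
    (ρ : A →ₐ[F] Module.End F (Fin d → F)) : Function.Injective (toEnd ρ) := fun _ _ h =>
  LinearMap.ext fun x => LinearMap.congr_fun h x

theorem mem_range_toEnd {A : Type v} [Ring A] [Algebra F A]
    (ρ : A →ₐ[F] Module.End F (Fin d → F)) (θ : Module.End F (Fin d → F)) :
    (∃ φ, toEnd ρ φ = θ) ↔ ∀ a, Commute (ρ a) θ := by
  constructor
  · rintro ⟨φ, rfl⟩ a
    exact LinearMap.ext fun x => (φ.map_smul a x).symm
  · intro h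
    exact ⟨{ toFun := θ
             map_add' := θ.map_add
             map_smul' := fun a x => (LinearMap.congr_fun (h a) x).symm }, rfl⟩

theorem nilCount_end {A : Type v} [Ring A] [Algebra F A] (f : F[X])
    (ρ : A →ₐ[F] Module.End F (Fin d → F)) :
    nilCount f (Module.End A (RepSpace ρ)) =
      Nat.card {θ : Module.End F (Fin d → F) //
        (∀ a, Commute (ρ a) θ) ∧ IsNilpotent (aeval θ f)} := by
  have key : ∀ φ, aeval (toEnd ρ φ) f = toEnd ρ (aeval φ f) := fun φ =>
    Polynomial.aeval_algHom_apply (toEnd ρ) φ f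
  refine Nat.card_congr (Equiv.ofBijective (fun φ => ⟨toEnd ρ φ.1,
    (mem_range_toEnd ρ _).mp ⟨φ.1, rfl⟩, by rw [key]; exact φ.2.map _⟩) ⟨fun φ ψ h => ?_, ?_⟩)
  · exact Subtype.ext (toEnd_injective ρ (congrArg Subtype.val h))
  · rintro ⟨θ, hθ, hn⟩
    obtain ⟨φ, rfl⟩ := (mem_range_toEnd ρ θ).mpr hθ
    refine ⟨⟨φ, ?_⟩, rfl⟩
    rw [key] at hn
    exact (IsNilpotent.map_iff (toEnd_injective ρ)).mp hn

theorem autCard_eq {A : Type v} [Ring A] [Algebra F A]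
    (ρ : A →ₐ[F] Module.End F (Fin d → F)) :
    autCard ρ = Nat.card {u : (Module.End F (Fin d → F))ˣ // ∀ a, Commute (ρ a) ↑u} := by
  refine Nat.card_congr (Equiv.ofBijective (fun φ => ⟨Units.map (toEnd ρ : _ →* _) φ,
    (mem_range_toEnd ρ _).mp ⟨φ.1, rfl⟩⟩) ⟨fun φ ψ h => ?_, ?_⟩)
  · exact Units.ext (toEnd_injective ρ (congrArg (fun u => (u.1 : Module.End F (Fin d → F))) h))
  · rintro ⟨u, hu⟩
    obtain ⟨φ, hφ⟩ := (mem_range_toEnd ρ _).mpr hu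
    -- The inverse of a unit in the commutant is again in the commutant, so the preimage of `u` is a
    -- unit.
    obtain ⟨ψ, hψ⟩ := (mem_range_toEnd ρ ↑u⁻¹).mpr fun a => (hu a).units_inv_right
    refine ⟨⟨φ, ψ, toEnd_injective ρ ?_, toEnd_injective ρ ?_⟩, Subtype.ext (Units.ext hφ)⟩
    · rw [map_mul, hφ, hψ, map_one, Units.mul_inv]
    · rw [map_mul, hφ, hψ, map_one, Units.inv_mul]

/-- A representation of a free group is a tuple of automorphisms. -/
def freeRepEquiv (F : Type u) [Field F] (m d : ℕ) :
    (MonoidAlgebra F (FreeGroup (Fin m)) →ₐ[F] Module.End F (Fin d → F)) ≃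
      (Fin m → (Module.End F (Fin d → F))ˣ) :=
  (MonoidAlgebra.lift F _ (FreeGroup (Fin m))).symm.trans
    ({ toFun := fun f => f.toHomUnits
       invFun := fun f => (Units.coeHom _).comp f
       left_inv := fun f => by ext; rfl
       right_inv := fun f => by ext; rfl :
      (FreeGroup (Fin m) →* Module.End F (Fin d → F)) ≃
        (FreeGroup (Fin m) →* (Module.End F (Fin d → F))ˣ) }.trans FreeGroup.lift.symm)

theorem freeRepEquiv_apply (m : ℕ)
    (ρ : MonoidAlgebra F (FreeGroup (Fin m)) →ₐ[F] Module.End F (Fin d → F)) (i : Fin m) :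
    ((freeRepEquiv F m d ρ i : (Module.End F (Fin d → F))ˣ) : Module.End F (Fin d → F)) =
      ρ (MonoidAlgebra.of F _ (FreeGroup.of i)) := rfl

theorem forall_commute_iff (m : ℕ)
    (ρ : MonoidAlgebra F (FreeGroup (Fin m)) →ₐ[F] Module.End F (Fin d → F))
    (θ : Module.End F (Fin d → F)) :
    (∀ a, Commute (ρ a) θ) ↔ ∀ i, Commute (freeRepEquiv F m d ρ i : Module.End F (Fin d → F)) θ := by
  refine ⟨fun h i => h _, fun h => ?_⟩
  have hG : ∀ g : FreeGroup (Fin m), Commute (ρ (MonoidAlgebra.of F _ g)) θ := by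
    intro g
    induction g using FreeGroup.induction_on with
    | C1 => rw [map_one, map_one]; exact Commute.one_left θ
    | of i => exact h i
    | inv_of i _ =>
      have h1 : ρ (MonoidAlgebra.of F _ (FreeGroup.of i)⁻¹) =
          ((freeRepEquiv F m d ρ i)⁻¹ : (Module.End F (Fin d → F))ˣ) := by
        refine (Units.inv_eq_of_mul_eq_one_right ?_).symm
        rw [freeRepEquiv_apply, ← map_mul, ← map_mul, mul_inv_cancel, map_one, map_one]
      rw [h1]
      exact (h i).units_inv_left
    | mul x y hx hy => rw [map_mul, map_mul]; exact hx.mul_left hy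
  intro a
  induction a using MonoidAlgebra.induction_on with
  | of g => exact hG g
  | add x y hx hy => rw [map_add]; exact hx.add_left hy
  | smul r x hx => rw [map_smul]; exact hx.smul_left r

theorem forall_commute_polynomial_iff (ρ : F[X] →ₐ[F] Module.End F (Fin d → F))
    (θ : Module.End F (Fin d → F)) : (∀ a, Commute (ρ a) θ) ↔ Commute (ρ Polynomial.X) θ := by
  refine ⟨fun h => h _, fun h a => ?_⟩
  induction a using Polynomial.induction_on' with
  | add p q hp hq => rw [map_add]; exact hp.add_left hq
  | monomial n c =>
    rw [← Polynomial.smul_X_eq_monomial, map_smul, map_pow]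
    exact (h.pow_left n).smul_left c

instance [Finite F] (m d : ℕ) :
    Finite (MonoidAlgebra F (FreeGroup (Fin m)) →ₐ[F] Module.End F (Fin d → F)) :=
  Finite.of_equiv _ (freeRepEquiv F m d).symm

/-- Polynomial actions are single endomorphisms. -/
def polyRepEquiv (F : Type u) [Field F] (d : ℕ) :
    (F[X] →ₐ[F] Module.End F (Fin d → F)) ≃ Module.End F (Fin d → F) where
  toFun ρ := ρ Polynomial.X
  invFun θ := aeval θ
  left_inv ρ := Polynomial.algHom_ext (by simp)
  right_inv θ := by simp

/-- Both sides count the pairs of an `m`-tuple `g` of automorphisms and an endomorphism `θ`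
commuting with every `g i`, with `f(θ)` nilpotent. For fixed `θ`, each `g i` is chosen independently
in the centraliser of `θ`, which gives the `m`-th power. -/
theorem sum_nilCount_eq_sum_autCard_pow [Finite F] (m : ℕ) (f : F[X])
    [Fintype (MonoidAlgebra F (FreeGroup (Fin m)) →ₐ[F] Module.End F (Fin d → F))]
    [Fintype (F[X] →ₐ[F] Module.End F (Fin d → F))]
    [∀ ρ : F[X] →ₐ[F] Module.End F (Fin d → F), Decidable (IsNilpotent (ρ f))] :
    (∑ ρ : MonoidAlgebra F (FreeGroup (Fin m)) →ₐ[F] Module.End F (Fin d → F),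
      (nilCount f (Module.End (MonoidAlgebra F (FreeGroup (Fin m))) (RepSpace ρ)) : ℚ)) =
    ∑ ρ : F[X] →ₐ[F] Module.End F (Fin d → F),
      if IsNilpotent (ρ f) then (autCard ρ : ℚ) ^ m else 0 := by
  classical
  let E := Module.End F (Fin d → F)
  have : Fintype E := Fintype.ofFinite E
  rw [← (freeRepEquiv F m d).symm.sum_comp, ← (polyRepEquiv F d).symm.sum_comp]
  have h1 : ∀ g : Fin m → Eˣ, (nilCount f (Module.End (MonoidAlgebra F (FreeGroup (Fin m)))
      (RepSpace ((freeRepEquiv F m d).symm g))) : ℚ) =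
      ∑ θ : E, if (∀ i, Commute (g i : E) θ) ∧ IsNilpotent (aeval θ f) then 1 else 0 := by
    intro g
    rw [nilCount_end]
    simp only [forall_commute_iff, Equiv.apply_symm_apply]
    rw [Nat.card_eq_fintype_card, Fintype.card_subtype, Finset.card_filter]
    push_cast
    rfl
  have h2 : ∀ θ : E, (if IsNilpotent ((polyRepEquiv F d).symm θ f) then
      (autCard ((polyRepEquiv F d).symm θ) : ℚ) ^ m else 0) =
      ∑ g : Fin m → Eˣ, if (∀ i, Commute (g i : E) θ) ∧ IsNilpotent (aeval θ f) then 1 else 0 := by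
    intro θ
    change (if IsNilpotent (aeval θ f) then _ else _) = _
    split_ifs with hn
    · simp only [hn, and_true]
      rw [autCard_eq]
      simp only [forall_commute_polynomial_iff]
      rw [← Finset.natCast_card_filter, ← Fintype.card_subtype, ← Nat.card_eq_fintype_card]
      have h3 : Nat.card {g : Fin m → Eˣ // ∀ i, Commute (g i : E) θ} =
          Nat.card (Fin m → {u : Eˣ // Commute (u : E) θ}) :=
        Nat.card_congr (Equiv.subtypePiEquivPi (p := fun _ (u : Eˣ) => Commute (u : E) θ))
      rw [h3, Nat.card_fun]
      simp only [Nat.card_eq_fintype_card, Fintype.card_fin, Nat.cast_pow]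
      congr 2
      refine Fintype.card_congr (Equiv.subtypeEquivRight fun u => ?_)
      change Commute (aeval θ (Polynomial.X : F[X])) _ ↔ _
      rw [aeval_X]
      exact Commute.symm_iff
    · simp [hn]
  rw [Fintype.sum_congr _ _ h1, Fintype.sum_congr _ _ h2, Finset.sum_comm]

/-- A sum with exponent `0` is a plain count of endomorphisms, in the shape to which
`sum_autCard_pow` with `m = 0` applies over the residue field `K`. -/
theorem matMass_eq {K : Type w} [Field K] [Finite K] [Algebra F K] (f : F[X]) (n : ℕ)
    [Fintype (K[X] →ₐ[K] Module.End K (Fin n → K))]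
    [∀ ρ : K[X] →ₐ[K] Module.End K (Fin n → K),
      Decidable (IsNilpotent (ρ (f.map (algebraMap F K))))] :
    matMass f K n = (∑ ρ : K[X] →ₐ[K] Module.End K (Fin n → K),
      if IsNilpotent (ρ (f.map (algebraMap F K))) then (autCard ρ : ℚ) ^ 0 else 0) / glCard K n := by
  classical
  rw [matMass, glCard]
  congr 1
  have e : Matrix (Fin n) (Fin n) K ≃ₐ[F] Module.End K (Fin n → K) :=
    (Matrix.toLinAlgEquiv' (R := K) (n := Fin n)).restrictScalars F
  rw [nilCount_congr f e, nilCount]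
  simp only [pow_zero]
  rw [← Finset.natCast_card_filter, ← Fintype.card_subtype, ← Nat.card_eq_fintype_card]
  congr 1
  refine Nat.card_congr ((polyRepEquiv K n).symm.subtypeEquiv fun θ => ?_)
  change _ ↔ IsNilpotent (aeval θ (f.map (algebraMap F K)))
  rw [aeval_map_algebraMap]

end Swap

/-! ### Factorisation of an irreducible polynomial over a finite extension -/

section FiniteFieldFactors

theorem exists_monic_irreducible_natDegree (F : Type*) [Field F] [Finite F] (n : ℕ) (hn : n ≠ 0) :
    ∃ f : F[X], f.Monic ∧ Irreducible f ∧ f.natDegree = n := by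
  obtain ⟨p, _⟩ := CharP.exists F
  have : Fact p.Prime := ⟨CharP.char_is_prime F p⟩
  have : NeZero n := ⟨hn⟩
  let E := FiniteField.Extension F p n
  obtain ⟨α, hα⟩ := Field.exists_primitive_element F E
  have hint : IsIntegral F α := Algebra.IsIntegral.isIntegral α
  refine ⟨minpoly F α, minpoly.monic hint, minpoly.irreducible hint, ?_⟩
  rw [Field.primitive_element_iff_minpoly_natDegree_eq] at hα
  rw [hα, FiniteField.finrank_extension]

/-- An irreducible polynomial divides `X ^ (q ^ j) - X` exactly when its degree divides `j`. Since
`|K| ^ j = |F| ^ (r j)`, the degree of `h` divides `j` if and only if `n ∣ r j`; the least such `j`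
is `n / gcd(n, r)`. -/
theorem natDegree_of_dvd_map {F K : Type*} [Field F] [Finite F] [Field K] [Finite K] [Algebra F K]
    {f : F[X]} (hf : Irreducible f) {h : K[X]} (hh : Irreducible h)
    (hd : h ∣ f.map (algebraMap F K)) :
    h.natDegree = f.natDegree / f.natDegree.gcd (Module.finrank F K) := by
  set n := f.natDegree with hn
  set r := Module.finrank F K with hr
  have hcard : Nat.card K = Nat.card F ^ r := Module.natCard_eq_pow_finrank
  have hmap : ∀ j, (Polynomial.X ^ Nat.card K ^ j - Polynomial.X : K[X]) =
      (Polynomial.X ^ Nat.card F ^ (r * j) - Polynomial.X : F[X]).map (algebraMap F K) := fun j => by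
    rw [hcard, ← pow_mul]
    simp
  have hr0 : 0 < r := Module.finrank_pos
  have hg : 0 < n.gcd r := Nat.gcd_pos_of_pos_right _ hr0
  refine Nat.dvd_antisymm ?_ ?_
  · refine (hh.natDegree_dvd_iff_dvd_X_pow_card_pow_sub_X).mpr (hd.trans ?_)
    rw [hmap]
    refine Polynomial.map_dvd _ ((hf.natDegree_dvd_iff_dvd_X_pow_card_pow_sub_X).mp ?_)
    rw [← Nat.mul_div_assoc _ (Nat.gcd_dvd_left n r), mul_comm,
      Nat.mul_div_assoc _ (Nat.gcd_dvd_right n r)]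
    exact dvd_mul_right _ _
  · have h1 : h ∣ (Polynomial.X ^ Nat.card K ^ h.natDegree - Polynomial.X : K[X]) :=
      (hh.natDegree_dvd_iff_dvd_X_pow_card_pow_sub_X).mp dvd_rfl
    rw [hmap] at h1
    -- Otherwise the two polynomials would be coprime over `F`, hence over `K`, where they share the
    -- factor `h`.
    have h2 : f ∣ (Polynomial.X ^ Nat.card F ^ (r * h.natDegree) - Polynomial.X : F[X]) := by
      by_contra hnd
      have hc := (hf.coprime_iff_not_dvd).mpr hnd
      have hc' := hc.map (Polynomial.mapRingHom (algebraMap F K))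
      exact hh.not_isUnit (hc'.isUnit_of_dvd' hd h1)
    have h3 : n ∣ r * h.natDegree := (hf.natDegree_dvd_iff_dvd_X_pow_card_pow_sub_X).mpr h2
    refine (Nat.coprime_div_gcd_div_gcd hg).dvd_of_dvd_mul_left (m := r / n.gcd r) ?_
    refine Nat.dvd_of_mul_dvd_mul_left hg ?_
    rwa [Nat.mul_div_cancel' (Nat.gcd_dvd_left n r), ← mul_assoc,
      Nat.mul_div_cancel' (Nat.gcd_dvd_right n r)]

theorem exists_factorization_map {F K : Type*} [Field F] [Finite F] [Field K] [Finite K]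
    [Algebra F K] {f : F[X]} (hm : f.Monic) (hf : Irreducible f) :
    ∃ p : Fin (f.natDegree.gcd (Module.finrank F K)) → K[X], (∀ a, (p a).Monic) ∧
      (∀ a, Irreducible (p a)) ∧ Function.Injective p ∧ ∏ a, p a = f.map (algebraMap F K) ∧
      ∀ a, (p a).natDegree = f.natDegree / f.natDegree.gcd (Module.finrank F K) := by
  classical
  set g := f.map (algebraMap F K) with hg
  have hgm : g.Monic := hm.map _
  have hsep : g.Separable := (PerfectField.separable_of_irreducible hf).map
  let s := UniqueFactorizationMonoid.normalizedFactors g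
  have hs : ∀ x ∈ s, Irreducible x ∧ x.Monic ∧ x ∣ g := fun x hx =>
    ⟨UniqueFactorizationMonoid.irreducible_of_normalized_factor x hx,
      (UniqueFactorizationMonoid.normalize_normalized_factor x hx) ▸
        Polynomial.monic_normalize (UniqueFactorizationMonoid.irreducible_of_normalized_factor x hx).ne_zero,
      UniqueFactorizationMonoid.dvd_of_mem_normalizedFactors hx⟩
  -- Finite fields are perfect, so the factors are distinct; their number then follows by comparing
  -- degrees.
  have hnodup : s.Nodup :=
    (UniqueFactorizationMonoid.squarefree_iff_nodup_normalizedFactors hgm.ne_zero).mp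
      hsep.squarefree
  have hprod : ∏ x ∈ s.toFinset, x = g := by
    have h1 : s.prod = g := by
      refine eq_of_monic_of_associated ?_ hgm
        (UniqueFactorizationMonoid.prod_normalizedFactors hgm.ne_zero)
      have h2 := monic_multiset_prod_of_monic s id (fun x hx => (hs x hx).2.1)
      rwa [Multiset.map_id] at h2
    conv_rhs => rw [← h1]
    rw [Finset.prod, Multiset.toFinset_val, hnodup.dedup, Multiset.map_id']
  have hdeg : ∀ x ∈ s.toFinset, x.natDegree =
      f.natDegree / f.natDegree.gcd (Module.finrank F K) := fun x hx => by
    rw [Multiset.mem_toFinset] at hx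
    exact natDegree_of_dvd_map hf (hs x hx).1 (hs x hx).2.2
  have hn : 0 < f.natDegree := hf.natDegree_pos
  have hgd := Nat.gcd_dvd_left f.natDegree (Module.finrank F K)
  have hcard : s.toFinset.card = f.natDegree.gcd (Module.finrank F K) := by
    have h1 : g.natDegree = ∑ x ∈ s.toFinset, x.natDegree := by
      rw [← hprod]
      exact natDegree_prod_of_monic _ _ fun x hx => (hs x (Multiset.mem_toFinset.mp hx)).2.1
    rw [Finset.sum_congr rfl hdeg, Finset.sum_const, smul_eq_mul, hg, natDegree_map] at h1
    have h2 := Nat.mul_div_cancel' hgd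
    have h3 : 0 < f.natDegree / f.natDegree.gcd (Module.finrank F K) :=
      Nat.div_pos (Nat.le_of_dvd hn hgd) (Nat.pos_of_dvd_of_pos hgd hn)
    exact Nat.eq_of_mul_eq_mul_right h3 (h1.symm.trans h2.symm)
  let e := (s.toFinset.equivFinOfCardEq hcard).symm
  refine ⟨fun a => e a, fun a => (hs _ (Multiset.mem_toFinset.mp (e a).2)).2.1,
    fun a => (hs _ (Multiset.mem_toFinset.mp (e a).2)).1,
    Subtype.val_injective.comp e.injective, ?_, fun a => hdeg _ (e a).2⟩
  rw [e.prod_comp (fun x : s.toFinset => (x : K[X])), ← hprod]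
  exact Finset.prod_coe_sort s.toFinset (fun x => x)

end FiniteFieldFactors

/-! ### Factorisation of the mass series over the indecomposables -/

section Factorisation

theorem coeff_congr_prod {R : Type*} [CommSemiring R] {ι : Type*} (s : Finset ι)
    (f g : ι → R⟦X⟧) (D : ℕ)
    (h : ∀ i ∈ s, ∀ d ≤ D, PowerSeries.coeff d (f i) = PowerSeries.coeff d (g i)) :
    ∀ d ≤ D, PowerSeries.coeff d (∏ i ∈ s, f i) = PowerSeries.coeff d (∏ i ∈ s, g i) := by
  classical
  intro d hd
  rw [PowerSeries.coeff_prod, PowerSeries.coeff_prod]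
  refine Finset.sum_congr rfl fun l hl => Finset.prod_congr rfl fun i hi => h i hi _ ?_
  rw [Finset.mem_finsuppAntidiag] at hl
  exact (Finset.single_le_sum (fun _ _ => Nat.zero_le _) hi).trans (hl.1.le.trans hd)

/-- The masses of matrices over `K` on which `f` is nilpotent. -/
theorem coeff_matMass {F : Type u} {K : Type w} [Field F] [Finite F] [Field K] [Finite K]
    [Algebra F K] {f : F[X]} (hm : f.Monic) (hf : Irreducible f) {D d : ℕ} (hd : d ≤ D) :
    matMass f K d = PowerSeries.coeff d
      (dilate (f.natDegree / f.natDegree.gcd (Module.finrank F K))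
        (massSeries D ((Nat.card K : ℚ) ^
          (f.natDegree / f.natDegree.gcd (Module.finrank F K))) 0) ^
        f.natDegree.gcd (Module.finrank F K)) := by
  classical
  obtain ⟨p, hpm, hpi, hinj, hprod, hdeg⟩ := exists_factorization_map (K := K) hm hf
  have := Fintype.ofFinite (K[X] →ₐ[K] Module.End K (Fin d → K))
  have h1 := sum_autCard_pow p hpm hpi hinj hd 0
  rw [matMass_eq, ← hprod, h1]
  simp only [hdeg, Finset.prod_const, Finset.card_univ, Fintype.card_fin]

/-- The main factorisation: masses of polynomial modules against residue fields. -/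
theorem coeff_massSeries_eq {F : Type u} [Field F] [Finite F] (m : ℕ) {ι : Type} [Fintype ι]
    [DecidableEq ι] (B : IndecFamily F (MonoidAlgebra F (FreeGroup (Fin m))) ι) {D : ℕ}
    (hB : ∀ d ≤ D, ∀ ρ : MonoidAlgebra F (FreeGroup (Fin m)) →ₐ[F] Module.End F (Fin d → F),
      ∃ n, Nonempty (RepSpace ρ ≃ₗ[MonoidAlgebra F (FreeGroup (Fin m))] B.obj n))
    (n : ℕ) (hn : n ≠ 0) {d : ℕ} (hd : d ≤ D) :
    PowerSeries.coeff d (dilate n (massSeries D ((Nat.card F : ℚ) ^ n) m)) =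
      PowerSeries.coeff d (∏ i, dilate (B.dim i)
        (dilate (n / n.gcd (Module.finrank F (B.K i)))
          (massSeries D ((Nat.card (B.K i) : ℚ) ^ (n / n.gcd (Module.finrank F (B.K i)))) 0) ^
        n.gcd (Module.finrank F (B.K i)))) := by
  classical
  -- Any irreducible `f` of degree `n` serves: both sides depend only on its degree.
  obtain ⟨f, hm, hf, rfl⟩ := exists_monic_irreducible_natDegree F n hn
  have := Fintype.ofFinite (F[X] →ₐ[F] Module.End F (Fin d → F))
  have := Fintype.ofFinite
    (MonoidAlgebra F (FreeGroup (Fin m)) →ₐ[F] Module.End F (Fin d → F))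
  have h1 := sum_autCard_pow (fun _ : Unit => f) (fun _ => hm) (fun _ => hf)
    (fun _ _ _ => rfl) hd m
  simp only [Finset.univ_unique, Finset.prod_singleton] at h1
  rw [← h1, ← sum_nilCount_eq_sum_autCard_pow, sum_nilCount B (hB d hd) f]
  refine coeff_congr_prod _ _ _ D (fun i _ k hk => ?_) d hd
  simp only [dilate, PowerSeries.coeff_mk]
  split_ifs with h
  · exact coeff_matMass hm hf ((Nat.div_le_self _ _).trans hk)
  · rfl

end Factorisation

/-! ### Logarithms of power series -/

section Log

variable {k : Type*} [Field k] [Algebra ℚ k]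

omit [Algebra ℚ k] in
theorem hasSubst_sub_one {f : k⟦X⟧} (hf : PowerSeries.constantCoeff f = 1) :
    PowerSeries.HasSubst (f - 1) :=
  PowerSeries.HasSubst.of_constantCoeff_zero' (by rw [map_sub, hf, map_one, sub_self])

theorem derivative_logOf {f : k⟦X⟧} (hf : PowerSeries.constantCoeff f = 1) :
    d⁄dX k (PowerSeries.logOf f) * f = d⁄dX k f := by
  have hs := hasSubst_sub_one hf
  have h1 : d⁄dX k (PowerSeries.log k) * (1 + PowerSeries.X) = 1 := by
    rw [PowerSeries.deriv_log, mul_add, mul_one]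
    ext n
    rcases n with _ | n
    · simp
    · rw [map_add, PowerSeries.coeff_succ_mul_X, PowerSeries.coeff_mk, PowerSeries.coeff_mk,
        PowerSeries.coeff_one, if_neg (Nat.succ_ne_zero n), pow_succ, map_mul]
      simp
  have h2 := congrArg (PowerSeries.subst (f - 1)) h1
  rw [PowerSeries.subst_mul hs, PowerSeries.subst_add hs, PowerSeries.subst_X hs,
    ← PowerSeries.coe_substAlgHom hs, map_one, PowerSeries.coe_substAlgHom hs,
    add_sub_cancel] at h2
  rw [PowerSeries.logOf_eq, PowerSeries.derivative_subst hs, map_sub]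
  simp only [Derivation.map_one_eq_zero, sub_zero]
  rw [mul_right_comm, h2, one_mul]

omit [Algebra ℚ k] in
theorem ne_zero_of_constantCoeff_eq_one {f : k⟦X⟧} (hf : PowerSeries.constantCoeff f = 1) :
    f ≠ 0 := by
  rintro rfl
  simp at hf

/-- In characteristic zero the logarithmic derivative and the zero constant coefficient determine
the logarithm. The rules for products, powers and rescaling all come from this. -/
theorem eq_logOf {f L : k⟦X⟧} (hf : PowerSeries.constantCoeff f = 1)
    (hL : PowerSeries.constantCoeff L = 0) (h : d⁄dX k L * f = d⁄dX k f) :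
    L = PowerSeries.logOf f := by
  have : CharZero k := algebraRat.charZero k
  refine PowerSeries.derivative.ext ?_ ?_
  · exact mul_right_cancel₀ (ne_zero_of_constantCoeff_eq_one hf)
      (h.trans (derivative_logOf hf).symm)
  · rw [hL, PowerSeries.constantCoeff_logOf hf]

theorem logOf_mul {f g : k⟦X⟧} (hf : PowerSeries.constantCoeff f = 1)
    (hg : PowerSeries.constantCoeff g = 1) :
    PowerSeries.logOf (f * g) = PowerSeries.logOf f + PowerSeries.logOf g := by
  refine (eq_logOf (by rw [map_mul, hf, hg, one_mul]) ?_ ?_).symm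
  · rw [map_add, PowerSeries.constantCoeff_logOf hf, PowerSeries.constantCoeff_logOf hg, add_zero]
  · rw [map_add, Derivation.leibniz, smul_eq_mul, smul_eq_mul, ← derivative_logOf hf,
      ← derivative_logOf hg]
    ring

theorem logOf_one : PowerSeries.logOf (1 : k⟦X⟧) = 0 :=
  (eq_logOf (map_one _) (map_zero _) (by simp)).symm

omit [Algebra ℚ k] in
theorem constantCoeff_prod_eq_one {ι : Type*} (s : Finset ι) (f : ι → k⟦X⟧)
    (h : ∀ i ∈ s, PowerSeries.constantCoeff (f i) = 1) :
    PowerSeries.constantCoeff (∏ i ∈ s, f i) = 1 := by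
  rw [map_prod]
  exact Finset.prod_eq_one h

theorem logOf_prod {ι : Type*} (s : Finset ι) (f : ι → k⟦X⟧)
    (h : ∀ i ∈ s, PowerSeries.constantCoeff (f i) = 1) :
    PowerSeries.logOf (∏ i ∈ s, f i) = ∑ i ∈ s, PowerSeries.logOf (f i) := by
  classical
  induction s using Finset.induction_on with
  | empty => simp [logOf_one]
  | insert a s ha ih =>
    rw [Finset.prod_insert ha, Finset.sum_insert ha, logOf_mul (h a (Finset.mem_insert_self a s)),
      ih fun i hi => h i (Finset.mem_insert_of_mem hi)]
    exact constantCoeff_prod_eq_one _ _ fun i hi => h i (Finset.mem_insert_of_mem hi)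

theorem logOf_pow {f : k⟦X⟧} (hf : PowerSeries.constantCoeff f = 1) (n : ℕ) :
    PowerSeries.logOf (f ^ n) = n • PowerSeries.logOf f := by
  rw [← Finset.card_range n, ← Finset.prod_const, logOf_prod _ _ fun _ _ => hf, Finset.sum_const]

/-- With `L` the logarithms, `(L_f' - L_g') f = (f' - g') - L_g' (f - g)` is divisible by `t ^ D`,
and `f` is invertible. This permits working with the truncated families bounded by `D`. -/
theorem coeff_logOf_congr {f g : k⟦X⟧} (hf : PowerSeries.constantCoeff f = 1)
    (hg : PowerSeries.constantCoeff g = 1) (D : ℕ)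
    (h : ∀ d ≤ D, PowerSeries.coeff d f = PowerSeries.coeff d g) :
    ∀ d ≤ D, PowerSeries.coeff d (PowerSeries.logOf f) =
      PowerSeries.coeff d (PowerSeries.logOf g) := by
  have : CharZero k := algebraRat.charZero k
  set Lf := PowerSeries.logOf f
  set Lg := PowerSeries.logOf g
  have h1 : (PowerSeries.X : k⟦X⟧) ^ (D + 1) ∣ f - g := by
    rw [PowerSeries.X_pow_dvd_iff]
    intro d hd
    rw [map_sub, h d (by omega), sub_self]
  have h2 : (PowerSeries.X : k⟦X⟧) ^ D ∣ d⁄dX k f - d⁄dX k g := by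
    rw [PowerSeries.X_pow_dvd_iff]
    intro d hd
    rw [map_sub, PowerSeries.coeff_derivative, PowerSeries.coeff_derivative, h (d + 1) (by omega),
      sub_self]
  have h3 : (d⁄dX k Lf - d⁄dX k Lg) * f = (d⁄dX k f - d⁄dX k g) - d⁄dX k Lg * (f - g) := by
    rw [sub_mul, mul_sub, derivative_logOf hf, derivative_logOf hg]
    ring
  have h4 : (PowerSeries.X : k⟦X⟧) ^ D ∣ (d⁄dX k Lf - d⁄dX k Lg) * f := by
    rw [h3]
    exact dvd_sub h2 (((pow_dvd_pow _ (Nat.le_succ D)).trans h1).mul_left _)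
  have h5 : (PowerSeries.X : k⟦X⟧) ^ D ∣ d⁄dX k Lf - d⁄dX k Lg := by
    have h6 := h4.mul_right f⁻¹
    rwa [mul_assoc, PowerSeries.mul_inv_cancel f (by rw [hf]; exact one_ne_zero), mul_one] at h6
  intro d hd
  rcases d with _ | d
  · rw [PowerSeries.coeff_zero_eq_constantCoeff_apply, PowerSeries.coeff_zero_eq_constantCoeff_apply,
      PowerSeries.constantCoeff_logOf hf, PowerSeries.constantCoeff_logOf hg]
  · rw [PowerSeries.X_pow_dvd_iff] at h5
    have h7 := h5 d (by omega)
    rw [map_sub, PowerSeries.coeff_derivative, PowerSeries.coeff_derivative, ← sub_mul,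
      mul_eq_zero, sub_eq_zero] at h7
    exact h7.resolve_right (by exact_mod_cast Nat.succ_ne_zero d)

theorem logOf_rescale {f : k⟦X⟧} (hf : PowerSeries.constantCoeff f = 1) (a : k) :
    PowerSeries.logOf (PowerSeries.rescale a f) = PowerSeries.rescale a (PowerSeries.logOf f) := by
  have hd : ∀ g : k⟦X⟧, d⁄dX k (PowerSeries.rescale a g) =
      PowerSeries.C a * PowerSeries.rescale a (d⁄dX k g) := by
    intro g
    ext n
    simp only [PowerSeries.coeff_derivative, PowerSeries.coeff_rescale, PowerSeries.coeff_C_mul]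
    ring
  have h0 : ∀ g : k⟦X⟧, PowerSeries.constantCoeff (PowerSeries.rescale a g) =
      PowerSeries.constantCoeff g := fun g => by
    rw [← PowerSeries.coeff_zero_eq_constantCoeff_apply, PowerSeries.coeff_rescale]
    simp
  refine (eq_logOf (by rw [h0, hf]) (by rw [h0, PowerSeries.constantCoeff_logOf hf]) ?_).symm
  rw [hd, hd, mul_assoc, ← map_mul, derivative_logOf hf]

theorem dilate_eq_expand {R : Type*} [CommRing R] (c : ℕ) (hc : c ≠ 0) (f : R⟦X⟧) :
    dilate c f = PowerSeries.expand c hc f := by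
  ext d
  rw [PowerSeries.coeff_expand, dilate, PowerSeries.coeff_mk]

theorem constantCoeff_dilate {R : Type*} [CommRing R] (c : ℕ) (f : R⟦X⟧) :
    PowerSeries.constantCoeff (dilate c f) = PowerSeries.constantCoeff f := by
  rw [← PowerSeries.coeff_zero_eq_constantCoeff_apply, dilate, PowerSeries.coeff_mk,
    if_pos (dvd_zero c), Nat.zero_div, PowerSeries.coeff_zero_eq_constantCoeff_apply]

theorem logOf_dilate {f : k⟦X⟧} (hf : PowerSeries.constantCoeff f = 1) (c : ℕ) (hc : c ≠ 0) :
    PowerSeries.logOf (dilate c f) = dilate c (PowerSeries.logOf f) := by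
  rw [dilate_eq_expand c hc, dilate_eq_expand c hc, PowerSeries.logOf_eq, PowerSeries.logOf_eq]
  have h := PowerSeries.expand_subst c hc (hasSubst_sub_one hf) (PowerSeries.log k)
  have h1 : PowerSeries.expand c hc (f - 1) = PowerSeries.expand c hc f - 1 := by
    rw [map_sub, map_one]
  rw [← h1]
  exact h.symm

end Log

/-! ### The series of nilpotent matrices -/

section NilpotentMass

variable {K : Type u} [Field K]

theorem dvd_pow_of_forall_irreducible {g P : K[X]} (hg : g ≠ 0)
    (h : ∀ q : K[X], q.Monic → Irreducible q → q ∣ g → q ∣ P) : ∃ N, g ∣ P ^ N := by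
  classical
  have h1 : ∀ s : Multiset K[X], (∀ q ∈ s, q ∣ P) → s.prod ∣ P ^ s.card := by
    intro s
    induction s using Multiset.induction_on with
    | empty => intro _; simp
    | cons a s ih =>
      intro hs
      rw [Multiset.prod_cons, Multiset.card_cons, pow_succ']
      exact mul_dvd_mul (hs a (Multiset.mem_cons_self a s))
        (ih fun q hq => hs q (Multiset.mem_cons_of_mem hq))
  refine ⟨_, (UniqueFactorizationMonoid.prod_normalizedFactors hg).symm.dvd.trans
    (h1 _ fun q hq => ?_)⟩
  have hi := UniqueFactorizationMonoid.irreducible_of_normalized_factor q hq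
  exact h q ((UniqueFactorizationMonoid.normalize_normalized_factor q hq) ▸
    Polynomial.monic_normalize hi.ne_zero) hi (UniqueFactorizationMonoid.dvd_of_mem_normalizedFactors hq)

/-- By Cayley–Hamilton it is enough that the characteristic polynomial divides a power of `P`. -/
theorem isNilpotent_of_forall_dvd {d : ℕ} (ρ : K[X] →ₐ[K] Module.End K (Fin d → K)) {P : K[X]}
    (h : ∀ q : K[X], q.Monic → Irreducible q → q ∣ (ρ Polynomial.X).charpoly → q ∣ P) :
    IsNilpotent (ρ P) := by
  obtain ⟨N, hN⟩ := dvd_pow_of_forall_irreducible (ρ Polynomial.X).charpoly_monic.ne_zero h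
  refine ⟨N, ?_⟩
  rw [← map_pow]
  obtain ⟨c, hc⟩ := hN
  have h1 : ρ (ρ Polynomial.X).charpoly = 0 := by
    have h2 := (ρ Polynomial.X).aeval_self_charpoly
    rw [Polynomial.aeval_algHom_apply, aeval_X_left_apply] at h2
    exact h2
  rw [hc, map_mul, h1, zero_mul]

theorem finite_monic_irreducible [Finite K] (D : ℕ) :
    {p : K[X] | p.Monic ∧ Irreducible p ∧ p.natDegree ≤ D}.Finite := by
  have : Finite (Polynomial.degreeLT K (D + 1)) :=
    Finite.of_equiv _ (Polynomial.degreeLTEquiv K (D + 1)).symm.toEquiv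
  refine Set.Finite.subset (Set.toFinite (Polynomial.degreeLT K (D + 1) : Set K[X])) ?_
  rintro p ⟨_, _, h⟩
  rw [SetLike.mem_coe, Polynomial.mem_degreeLT]
  exact lt_of_le_of_lt Polynomial.degree_le_natDegree (by exact_mod_cast Nat.lt_succ_of_le h)

theorem isUnit_iff_not_X_dvd_charpoly {d : ℕ} (θ : Module.End K (Fin d → K)) :
    IsUnit θ ↔ ¬ Polynomial.X ∣ θ.charpoly := by
  rw [LinearMap.isUnit_iff_isUnit_det, isUnit_iff_ne_zero, Polynomial.X_dvd_iff,
    LinearMap.det_eq_sign_charpoly_coeff]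
  simp

/-- The prime `X` is set apart as `none`: it carries the nilpotent part of a matrix, and the other
primes carry the invertible part. -/
theorem exists_enumeration [Finite K] (D : ℕ) :
    ∃ (k : ℕ) (p : Option (Fin k) → K[X]), p none = Polynomial.X ∧ (∀ a, (p a).Monic) ∧
      (∀ a, Irreducible (p a)) ∧ Function.Injective p ∧
      ∀ q : K[X], q.Monic → Irreducible q → q.natDegree ≤ D → q ≠ Polynomial.X →
        ∃ a, p (some a) = q := by
  classical
  let s := (finite_monic_irreducible (K := K) D).toFinset.erase Polynomial.X
  have hs : ∀ q, q ∈ s ↔ q ≠ Polynomial.X ∧ q.Monic ∧ Irreducible q ∧ q.natDegree ≤ D := by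
    intro q
    simp [s]
  let e := s.equivFin.symm
  refine ⟨s.card, fun o => o.elim Polynomial.X fun a => e a, rfl, ?_, ?_, ?_, ?_⟩
  · rintro (_ | a)
    · exact Polynomial.monic_X
    · exact ((hs _).mp (e a).2).2.1
  · rintro (_ | a)
    · exact Polynomial.irreducible_X
    · exact ((hs _).mp (e a).2).2.2.1
  · rintro (_ | a) (_ | b) h
    · rfl
    · exact absurd h.symm ((hs _).mp (e b).2).1
    · exact absurd h ((hs _).mp (e a).2).1
    · exact congrArg some (e.injective (Subtype.ext h))
  · intro q hm hi hd hX
    obtain ⟨a, ha⟩ := e.surjective ⟨q, (hs q).mpr ⟨hX, hm, hi, hd⟩⟩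
    exact ⟨a, congrArg Subtype.val ha⟩

theorem poch_succ {k : Type*} [Field k] (x : k) (n : ℕ) :
    poch x (n + 1) = poch x n * (1 - x ^ (n + 1)) := Finset.prod_range_succ _ _

/-- Summing the masses of nilpotent matrices. -/
theorem sum_coeff_massSeries [Finite K] {D d : ℕ} (hd : d ≤ D) :
    ∑ i ∈ Finset.range (d + 1), PowerSeries.coeff i (massSeries D (Nat.card K : ℚ) 0) =
      (poch (Nat.card K : ℚ)⁻¹ d)⁻¹ := by
  classical
  obtain ⟨k, p, hX, hm, hi, hinj, hp⟩ := exists_enumeration (K := K) D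
  have hdeg : ∀ {e : ℕ} (ρ : K[X] →ₐ[K] Module.End K (Fin e → K)) (q : K[X]),
      q ∣ (ρ Polynomial.X).charpoly → q.natDegree ≤ e := fun ρ q hq => by
    have := Polynomial.natDegree_le_of_dvd hq (ρ Polynomial.X).charpoly_monic.ne_zero
    rwa [LinearMap.charpoly_natDegree, Module.finrank_fin_fun] at this
  -- all matrices
  have hall : PowerSeries.coeff d (∏ a, dilate (p a).natDegree
      (massSeries D ((Nat.card K : ℚ) ^ (p a).natDegree) 0)) = (poch (Nat.card K : ℚ)⁻¹ d)⁻¹ := by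
    have := Fintype.ofFinite (K[X] →ₐ[K] Module.End K (Fin d → K))
    rw [← sum_autCard_pow p hm hi hinj hd 0, ← matMass_zero K K d, matMass, nilCount_zero, glCard]
    congr 1
    rw [Finset.sum_congr rfl (g := fun _ => (1 : ℚ))]
    · rw [Finset.sum_const, nsmul_eq_mul, mul_one, Finset.card_univ, Fintype.card_eq_nat_card]
      exact_mod_cast Nat.card_congr ((polyRepEquiv K d).trans
        (LinearMap.toMatrixAlgEquiv' (R := K) (n := Fin d)).toEquiv)
    · intro ρ _
      rw [if_pos, pow_zero]
      refine isNilpotent_of_forall_dvd ρ fun q hqm hqi hq => ?_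
      by_cases hqX : q = Polynomial.X
      · rw [hqX, ← hX]
        exact Finset.dvd_prod_of_mem p (Finset.mem_univ _)
      · obtain ⟨a, rfl⟩ := hp q hqm hqi ((hdeg ρ q hq).trans hd) hqX
        exact Finset.dvd_prod_of_mem p (Finset.mem_univ _)
  -- invertible matrices
  have hinv : ∀ e ≤ D, PowerSeries.coeff e (∏ a : Fin k, dilate (p (some a)).natDegree
      (massSeries D ((Nat.card K : ℚ) ^ (p (some a)).natDegree) 0)) = 1 := by
    intro e he
    have := Fintype.ofFinite (K[X] →ₐ[K] Module.End K (Fin e → K))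
    rw [← sum_autCard_pow (fun a => p (some a)) (fun a => hm _) (fun a => hi _)
      (hinj.comp (Option.some_injective _)) he 0, div_eq_one_iff_eq
      (by exact_mod_cast (glCard_pos K e).ne')]
    simp only [pow_zero]
    rw [← Finset.natCast_card_filter, ← Fintype.card_subtype, ← Nat.card_eq_fintype_card]
    have h1 : glCard K e = Nat.card {θ : Module.End K (Fin e → K) // IsUnit θ} := by
      rw [← card_units_eq_card_isUnit, ← card_linearEquiv_self, card_linearEquiv_fun]
    rw [h1]
    congr 1
    refine Nat.card_congr ((polyRepEquiv K e).subtypeEquiv fun ρ => ?_)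
    change _ ↔ IsUnit (ρ Polynomial.X)
    constructor
    · rintro ⟨N, hN⟩
      have hc : IsCoprime (Polynomial.X : K[X]) ((∏ a, p (some a)) ^ N) := by
        refine IsCoprime.pow_right (IsCoprime.prod_right fun a _ => ?_)
        refine (Polynomial.irreducible_X.coprime_iff_not_dvd).mpr fun h => ?_
        have h2 := eq_of_monic_of_associated Polynomial.monic_X (hm (some a))
          (Polynomial.irreducible_X.associated_of_dvd (hi (some a)) h)
        rw [← hX] at h2
        exact Option.some_ne_none a (hinj h2).symm
      obtain ⟨u, v, huv⟩ := hc
      have h3 := congrArg ρ huv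
      rw [map_add, map_mul, map_mul, map_pow, hN, mul_zero, add_zero, map_one] at h3
      exact IsUnit.of_mul_eq_one_right _ h3
    · intro hu
      rw [isUnit_iff_not_X_dvd_charpoly] at hu
      refine isNilpotent_of_forall_dvd ρ fun q hqm hqi hq => ?_
      obtain ⟨a, rfl⟩ := hp q hqm hqi ((hdeg ρ q hq).trans he) (fun h => hu (h ▸ hq))
      exact Finset.dvd_prod_of_mem (fun a => p (some a)) (Finset.mem_univ _)
  -- Fitting decomposition: the series of all matrices is the nilpotent series at `X` times the
  -- invertible series. The coefficients of the latter are `|GL_e| / |GL_e| = 1`, so the product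
  -- forms partial sums.
  rw [← hall, Fintype.prod_option, hX, Polynomial.natDegree_X, pow_one, PowerSeries.coeff_mul,
    Finset.Nat.sum_antidiagonal_eq_sum_range_succ_mk]
  refine Finset.sum_congr rfl fun i hi => ?_
  rw [hinv _ ((Nat.sub_le _ _).trans hd), mul_one, dilate, PowerSeries.coeff_mk, if_pos (one_dvd _),
    Nat.div_one]

/-- `∑ t ^ n x ^ n / (x)_n`. -/
def nilSeries (x : ℚ) : ℚ⟦X⟧ := PowerSeries.mk fun n => x ^ n / poch x n

/-- Subtracting consecutive partial sums gives `1 / (x)_d - 1 / (x)_{d-1} = x ^ d / (x)_d` with `x =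
|K|⁻¹`. -/
theorem coeff_massSeries_zero [Finite K] {D d : ℕ} (hd : d ≤ D) :
    PowerSeries.coeff d (massSeries D (Nat.card K : ℚ) 0) =
      PowerSeries.coeff d (nilSeries (Nat.card K : ℚ)⁻¹) := by
  have h1 := sum_coeff_massSeries (K := K) hd
  rw [nilSeries, PowerSeries.coeff_mk]
  rcases d with _ | d
  · rw [zero_add, Finset.sum_range_one] at h1
    rw [h1]
    simp
  · have h2 := sum_coeff_massSeries (K := K) ((Nat.le_succ d).trans hd)
    rw [Finset.sum_range_succ, h2] at h1
    have h3 := (poch_inv_pos (one_lt_card K) d).ne'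
    have h4 := (poch_inv_pos (one_lt_card K) (d + 1)).ne'
    rw [poch_succ] at h1 h4 ⊢
    have h5 := right_ne_zero_of_mul h4
    rw [eq_sub_of_add_eq' h1]
    generalize (Nat.card K : ℚ)⁻¹ = x at *
    field_simp
    ring

theorem constantCoeff_nilSeries (x : ℚ) : PowerSeries.constantCoeff (nilSeries x) = 1 := by
  rw [← PowerSeries.coeff_zero_eq_constantCoeff_apply, nilSeries, PowerSeries.coeff_mk]
  simp [poch]

theorem coeff_logOf_one_sub (x : ℚ) (j : ℕ) (hj : j ≠ 0) :
    PowerSeries.coeff j (PowerSeries.logOf (1 - PowerSeries.C x * PowerSeries.X : ℚ⟦X⟧)) =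
      -(x ^ j / j) := by
  have h1 : (1 - PowerSeries.C x * PowerSeries.X : ℚ⟦X⟧) =
      PowerSeries.rescale (-x) (1 + PowerSeries.X) := by
    rw [map_add, map_one, PowerSeries.rescale_X, map_neg]
    ring
  rw [h1, logOf_rescale (by simp), PowerSeries.coeff_rescale, PowerSeries.logOf_one_add_X,
    PowerSeries.coeff_log, if_neg hj, neg_pow, eq_ratCast, Rat.cast_id, pow_succ]
  have : ((-1 : ℚ) ^ j) * (-1) ^ j = 1 := by rw [← mul_pow]; simp
  linear_combination (-(x ^ j / j)) * this

/-- The series satisfies `N(x t) = (1 - x t) N(t)` with `x = Q⁻¹`. Taking logarithms, its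
coefficient `c` satisfies `x ^ j c = c - x ^ j / j`, which is solved for `c`; no infinite product is
needed. -/
theorem coeff_logOf_nilSeries {Q : ℚ} (hQ : 1 < Q) (j : ℕ) (hj : j ≠ 0) :
    PowerSeries.coeff j (PowerSeries.logOf (nilSeries Q⁻¹)) = 1 / (j * (Q ^ j - 1)) := by
  set x := Q⁻¹ with hx
  have hfe : PowerSeries.rescale x (nilSeries x) =
      (1 - PowerSeries.C x * PowerSeries.X) * nilSeries x := by
    ext n
    rw [sub_mul, one_mul, map_sub, PowerSeries.coeff_rescale, mul_assoc, PowerSeries.coeff_C_mul]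
    rcases n with _ | n
    · simp
    · rw [PowerSeries.coeff_succ_X_mul]
      simp only [nilSeries, PowerSeries.coeff_mk]
      have h3 := (poch_inv_pos hQ n).ne'
      have h4 := (poch_inv_pos hQ (n + 1)).ne'
      rw [← hx] at h3 h4
      rw [poch_succ] at h4 ⊢
      have h5 := right_ne_zero_of_mul h4
      field_simp
      ring
  have h1 := congrArg (fun f => PowerSeries.coeff j (PowerSeries.logOf f)) hfe
  rw [logOf_rescale (constantCoeff_nilSeries x), logOf_mul (by simp) (constantCoeff_nilSeries x),
    map_add, PowerSeries.coeff_rescale, coeff_logOf_one_sub x j hj] at h1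
  generalize PowerSeries.coeff j (PowerSeries.logOf (nilSeries x)) = c at h1 ⊢
  have hj' : (j : ℚ) ≠ 0 := by exact_mod_cast hj
  have hQj : Q ^ j - 1 ≠ 0 := (sub_pos.mpr (one_lt_pow₀ hQ hj)).ne'
  have hQ0 : Q ^ j ≠ 0 := by positivity
  rw [hx, inv_pow] at h1
  field_simp at h1 ⊢
  linarith

end NilpotentMass

/-! ### Möbius inversion over the indecomposables -/

section Counting

theorem constantCoeff_massSeries {k : Type*} [Field k] (D : ℕ) (x : k) (m : ℕ) :
    PowerSeries.constantCoeff (massSeries D x m) = 1 := by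
  rw [← PowerSeries.coeff_zero_eq_constantCoeff_apply, massSeries, PowerSeries.coeff_mk,
    Finset.sum_eq_single 0]
  · simp [autNum, poch]
  · intro n hn hne
    rw [mem_multSet fun j => Nat.succ_pos _, Finset.sum_eq_zero_iff] at hn
    refine absurd (funext fun j => ?_) hne
    have := hn j (Finset.mem_univ j)
    simpa using this
  · intro h
    rw [mem_multSet fun j => Nat.succ_pos _] at h
    simp at h

/-- The count of nilpotent matrices is applied over the extension of `K` of degree `e`. -/
theorem coeff_massSeries_pow_zero (K : Type u) [Field K] [Finite K] {D d : ℕ} (hd : d ≤ D) (e : ℕ)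
    (he : e ≠ 0) :
    PowerSeries.coeff d (massSeries D ((Nat.card K : ℚ) ^ e) 0) =
      PowerSeries.coeff d (nilSeries ((Nat.card K : ℚ) ^ e)⁻¹) := by
  obtain ⟨p, _⟩ := CharP.exists K
  have : Fact p.Prime := ⟨CharP.char_is_prime K p⟩
  have : NeZero e := ⟨he⟩
  have h := coeff_massSeries_zero (K := FiniteField.Extension K p e) hd
  rw [FiniteField.natCard_extension] at h
  exact_mod_cast h

theorem coeff_logOf_massSeries_pow (K : Type u) [Field K] [Finite K] {D j : ℕ} (hj : j ≤ D)
    (hj0 : j ≠ 0) (e : ℕ) (he : e ≠ 0) :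
    PowerSeries.coeff j (PowerSeries.logOf (massSeries D ((Nat.card K : ℚ) ^ e) 0)) =
      1 / (j * ((Nat.card K : ℚ) ^ (e * j) - 1)) := by
  rw [coeff_logOf_congr (constantCoeff_massSeries _ _ _) (constantCoeff_nilSeries _) D
    (fun d hd => coeff_massSeries_pow_zero K hd e he) j hj,
    coeff_logOf_nilSeries (one_lt_pow₀ (one_lt_card K) he) j hj0, pow_mul]

theorem div_gcd_dvd_iff {n r l : ℕ} (hn : n ≠ 0) : n / n.gcd r ∣ l ↔ n ∣ r * l := by
  have hg : 0 < n.gcd r := Nat.gcd_pos_of_pos_left _ (Nat.pos_of_ne_zero hn)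
  constructor
  · intro h
    have h1 := mul_dvd_mul (Nat.gcd_dvd_right n r) h
    rwa [Nat.mul_div_cancel' (Nat.gcd_dvd_left n r)] at h1
  · intro h
    refine (Nat.coprime_div_gcd_div_gcd hg).dvd_of_dvd_mul_left (m := r / n.gcd r) ?_
    refine Nat.dvd_of_mul_dvd_mul_left hg ?_
    rwa [Nat.mul_div_cancel' (Nat.gcd_dvd_left n r), ← mul_assoc,
      Nat.mul_div_cancel' (Nat.gcd_dvd_right n r)]

theorem sum_divisors_moebius (n : ℕ) :
    ∑ i ∈ n.divisors, (ArithmeticFunction.moebius i : ℚ) = if n = 1 then 1 else 0 := by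
  have h := congrArg (fun f => f n) ArithmeticFunction.moebius_mul_coe_zeta
  rw [ArithmeticFunction.coe_mul_zeta_apply, ArithmeticFunction.one_apply] at h
  exact_mod_cast h

variable {F : Type u} [Field F] [Finite F] (m : ℕ) {ι : Type} [Fintype ι] [DecidableEq ι]
  (B : IndecFamily F (MonoidAlgebra F (FreeGroup (Fin m))) ι) {D : ℕ}

/-- Take logarithms in `coeff_massSeries_eq`. With `g = gcd(n, r)` and `l = d / dim i = (n / g) j`,
the `i`-th factor gives `g / (j (q ^ (r l) - 1))`, and `g / j = n / l`. -/
theorem coeff_logOf_dilate_massSeries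
    (hB : ∀ d ≤ D, ∀ ρ : MonoidAlgebra F (FreeGroup (Fin m)) →ₐ[F] Module.End F (Fin d → F),
      ∃ n, Nonempty (RepSpace ρ ≃ₗ[MonoidAlgebra F (FreeGroup (Fin m))] B.obj n))
    (n : ℕ) (hn : n ≠ 0) {d : ℕ} (hd : d ≤ D) (hd0 : d ≠ 0) :
    PowerSeries.coeff d (dilate n (PowerSeries.logOf (massSeries D ((Nat.card F : ℚ) ^ n) m))) =
      ∑ i, if B.dim i ∣ d ∧ n ∣ Module.finrank F (B.K i) * (d / B.dim i) then
        (n : ℚ) * (1 / ((d / B.dim i : ℕ) *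
          ((Nat.card F : ℚ) ^ (Module.finrank F (B.K i) * (d / B.dim i)) - 1))) else 0 := by
  rw [← logOf_dilate (constantCoeff_massSeries _ _ _) n hn]
  have hc : ∀ i, PowerSeries.constantCoeff (dilate (B.dim i)
        (dilate (n / n.gcd (Module.finrank F (B.K i)))
          (massSeries D ((Nat.card (B.K i) : ℚ) ^ (n / n.gcd (Module.finrank F (B.K i)))) 0) ^
        n.gcd (Module.finrank F (B.K i)))) = 1 := fun i => by
    rw [constantCoeff_dilate, map_pow, constantCoeff_dilate, constantCoeff_massSeries, one_pow]
  rw [coeff_logOf_congr (by rw [constantCoeff_dilate, constantCoeff_massSeries])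
    (constantCoeff_prod_eq_one _ _ fun i _ => hc i) D
    (fun k hk => coeff_massSeries_eq m B hB n hn hk) d hd, logOf_prod _ _ fun i _ => hc i, map_sum]
  refine Finset.sum_congr rfl fun i _ => ?_
  set r := Module.finrank F (B.K i) with hr
  set g := n.gcd r with hg
  have hg0 : 0 < g := Nat.gcd_pos_of_pos_left _ (Nat.pos_of_ne_zero hn)
  have hng : n / g ≠ 0 := (Nat.div_pos (Nat.le_of_dvd (Nat.pos_of_ne_zero hn)
    (Nat.gcd_dvd_left n r)) hg0).ne'
  have hcm : PowerSeries.constantCoeff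
      (dilate (n / g) (massSeries D ((Nat.card (B.K i) : ℚ) ^ (n / g)) 0)) = 1 := by
    rw [constantCoeff_dilate, constantCoeff_massSeries]
  rw [logOf_dilate (by rw [map_pow, hcm, one_pow]) _ (B.dim_pos i).ne', logOf_pow hcm,
    logOf_dilate (constantCoeff_massSeries _ _ _) _ hng, dilate, PowerSeries.coeff_mk]
  by_cases h1 : B.dim i ∣ d
  · obtain ⟨l, rfl⟩ := h1
    have hl0 : l ≠ 0 := right_ne_zero_of_mul hd0
    rw [if_pos (dvd_mul_right _ _), Nat.mul_div_cancel_left _ (B.dim_pos i)]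
    simp only [dvd_mul_right, true_and]
    rw [map_nsmul, dilate, PowerSeries.coeff_mk]
    by_cases h2 : n / g ∣ l
    · rw [if_pos h2, if_pos ((div_gcd_dvd_iff hn).mp h2)]
      obtain ⟨j, rfl⟩ := h2
      have hj0 : j ≠ 0 := right_ne_zero_of_mul hl0
      rw [Nat.mul_div_cancel_left _ (Nat.pos_of_ne_zero hng), coeff_logOf_massSeries_pow _ _ hj0 _ hng]
      · have hcard : (Nat.card (B.K i) : ℚ) = (Nat.card F : ℚ) ^ r := by
          have := Module.natCard_eq_pow_finrank (K := F) (V := B.K i)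
          exact_mod_cast this
        rw [hcard, ← pow_mul, nsmul_eq_mul]
        have h3 : (n : ℚ) = g * (n / g : ℕ) := by
          exact_mod_cast (Nat.mul_div_cancel' (Nat.gcd_dvd_left n r)).symm
        have h4 : ((n / g : ℕ) : ℚ) ≠ 0 := by exact_mod_cast hng
        rw [Nat.cast_mul]
        simp only [mul_assoc]
        rw [h3]
        generalize ((n / g : ℕ) : ℚ) = y at h4 ⊢
        rw [one_div, one_div, mul_inv y, ← mul_assoc (g * y : ℚ), mul_assoc (g : ℚ),
          mul_inv_cancel₀ h4, mul_one]
      · refine (Nat.le_of_dvd (Nat.pos_of_ne_zero hd0) ?_).trans hd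
        exact (dvd_mul_left j (n / g)).mul_left _
    · rw [if_neg h2, if_neg fun h => h2 ((div_gcd_dvd_iff hn).mpr h), smul_zero]
  · rw [if_neg h1, if_neg fun h => h1 h.1]

/-- The numerical form of the main formula over a fixed finite field. -/
theorem card_indec_eq
    (hB : ∀ d ≤ D, ∀ ρ : MonoidAlgebra F (FreeGroup (Fin m)) →ₐ[F] Module.End F (Fin d → F),
      ∃ n, Nonempty (RepSpace ρ ≃ₗ[MonoidAlgebra F (FreeGroup (Fin m))] B.obj n))
    {d : ℕ} (hd : d ≤ D) (hd0 : d ≠ 0) :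
    ((Nat.card F : ℚ) - 1) * ∑ n ∈ d.divisors, (ArithmeticFunction.moebius n : ℚ) / n *
      PowerSeries.coeff (d / n) (PowerSeries.logOf (massSeries D ((Nat.card F : ℚ) ^ n) m)) =
      Nat.card {i // B.dim i = d ∧ Module.finrank F (B.K i) = 1} := by
  classical
  set q : ℚ := (Nat.card F : ℚ) with hq
  have hq1 : 1 < q := one_lt_card F
  let r := fun i => Module.finrank F (B.K i)
  -- The bound `N` exceeds every divisor of `d` and every divisor of each `r i * (d / B.dim i)` that
  -- occurs.
  let N := d + ∑ i, r i * (d / B.dim i)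
  have hr0 : ∀ i, r i ≠ 0 := fun i => Module.finrank_pos.ne'
  -- Terms with `n ∤ d` vanish by dilation. They are added because the contribution of a single
  -- indecomposable need not vanish for them, and only the full range gives a complete Möbius sum.
  have h1 : ∑ n ∈ d.divisors, (ArithmeticFunction.moebius n : ℚ) / n *
      PowerSeries.coeff (d / n) (PowerSeries.logOf (massSeries D (q ^ n) m)) =
      ∑ n ∈ Finset.Icc 1 N, (ArithmeticFunction.moebius n : ℚ) / n *
      PowerSeries.coeff d (dilate n (PowerSeries.logOf (massSeries D (q ^ n) m))) := by
    have hsub : d.divisors ⊆ Finset.Icc 1 N := fun n hn => by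
      rw [Finset.mem_Icc]
      exact ⟨Nat.pos_of_mem_divisors hn, (Nat.divisor_le hn).trans (Nat.le_add_right _ _)⟩
    rw [← Finset.sum_subset hsub]
    · refine Finset.sum_congr rfl fun n hn => ?_
      rw [dilate, PowerSeries.coeff_mk, if_pos (Nat.dvd_of_mem_divisors hn)]
    · intro n _ hn
      rw [dilate, PowerSeries.coeff_mk, if_neg fun h => hn (Nat.mem_divisors.mpr ⟨h, hd0⟩), mul_zero]
  -- The factor `n` cancels `1 / n`, so `μ` is summed over all divisors of `r i * l`, which gives
  -- zero unless `r i * l = 1`.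
  have h2 : ∀ i, (∑ n ∈ Finset.Icc 1 N, (ArithmeticFunction.moebius n : ℚ) / n *
      if B.dim i ∣ d ∧ n ∣ r i * (d / B.dim i) then
        (n : ℚ) * (1 / ((d / B.dim i : ℕ) * (q ^ (r i * (d / B.dim i)) - 1))) else 0) =
      if B.dim i = d ∧ r i = 1 then 1 / (q - 1) else 0 := by
    intro i
    by_cases hdi : B.dim i ∣ d
    · obtain ⟨l, hl⟩ := hdi
      have hl0 : l ≠ 0 := right_ne_zero_of_mul (hl ▸ hd0)
      have hdl : d / B.dim i = l := by rw [hl, Nat.mul_div_cancel_left _ (B.dim_pos i)]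
      have hle : r i * l ≤ N := by
        rw [← hdl]
        exact (Finset.single_le_sum (f := fun i => r i * (d / B.dim i))
          (fun _ _ => Nat.zero_le _) (Finset.mem_univ i)).trans (Nat.le_add_left _ _)
      have hrl : r i * l ≠ 0 := mul_ne_zero (hr0 i) hl0
      have hdv : B.dim i ∣ d := ⟨l, hl⟩
      rw [hdl]
      simp only [hdv, true_and, mul_ite, mul_zero]
      rw [← Finset.sum_filter]
      have hfil : (Finset.Icc 1 N).filter (fun n => n ∣ r i * l) = (r i * l).divisors := by
        ext n
        rw [Finset.mem_filter, Finset.mem_Icc, Nat.mem_divisors]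
        constructor
        · rintro ⟨_, h⟩
          exact ⟨h, hrl⟩
        · rintro ⟨h, _⟩
          exact ⟨⟨Nat.pos_of_dvd_of_pos h (Nat.pos_of_ne_zero hrl),
            (Nat.le_of_dvd (Nat.pos_of_ne_zero hrl) h).trans hle⟩, h⟩
      rw [hfil, Finset.sum_congr rfl (g := fun n => (ArithmeticFunction.moebius n : ℚ) *
        (1 / ((l : ℕ) * (q ^ (r i * l) - 1)))), ← Finset.sum_mul, sum_divisors_moebius]
      · have hiff : r i * l = 1 ↔ B.dim i = d ∧ r i = 1 := by
          rw [mul_eq_one]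
          constructor
          · rintro ⟨ha, hb⟩
            exact ⟨by rw [hl, hb, mul_one], ha⟩
          · rintro ⟨ha, hb⟩
            refine ⟨hb, ?_⟩
            rw [ha] at hl
            exact Nat.eq_of_mul_eq_mul_left (Nat.pos_of_ne_zero hd0) (by rw [mul_one]; exact hl.symm)
        by_cases h : r i * l = 1
        · rw [if_pos h, if_pos (hiff.mp h), h, (mul_eq_one.mp h).2]
          simp
        · rw [if_neg h, if_neg fun h' => h (hiff.mpr h'), zero_mul]
      · intro n hn
        have : (n : ℚ) ≠ 0 := by exact_mod_cast (Nat.pos_of_mem_divisors hn).ne'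
        field_simp
    · rw [if_neg fun h => hdi (by rw [h.1])]
      exact Finset.sum_eq_zero fun n _ => by rw [if_neg fun h => hdi h.1, mul_zero]
  rw [h1, Finset.sum_congr rfl fun n hn => by
    rw [coeff_logOf_dilate_massSeries m B hB n (by
      rw [Finset.mem_Icc] at hn; omega) hd hd0, Finset.mul_sum], Finset.sum_comm,
    Finset.sum_congr rfl fun i _ => h2 i, ← Finset.sum_filter, Finset.sum_const, nsmul_eq_mul,
    Nat.card_eq_fintype_card, Fintype.card_subtype]
  have : q - 1 ≠ 0 := (sub_pos.mpr hq1).ne'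
  field_simp
  rfl

end Counting

/-! ### Partitions and multiplicities -/

section Partitions

theorem sum_range_ite_le {D i : ℕ} (hi : i < D) (c : ℕ) :
    (∑ k ∈ Finset.range D, if k ≤ i then c else 0) = (i + 1) * c := by
  rw [← Finset.sum_filter, Finset.sum_const, smul_eq_mul]
  congr 1
  rw [show (Finset.range D).filter (· ≤ i) = Finset.range (i + 1) by
    ext k
    rw [Finset.mem_filter, Finset.mem_range, Finset.mem_range]
    omega, Finset.card_range]

/-- A finitely supported decreasing sequence is recovered from its differences. -/
theorem eq_sum_differences {f : ℕ → ℕ} (hf : Antitone f) {D : ℕ} (hD : f D = 0) {k : ℕ}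
    (hk : k ≤ D) : f k = ∑ i ∈ Finset.range D, if k ≤ i then f i - f (i + 1) else 0 := by
  induction hk using Nat.decreasingInduction with
  | self =>
    rw [hD]
    exact (Finset.sum_eq_zero fun i hi => if_neg (by rw [Finset.mem_range] at hi; omega)).symm
  | of_succ k hk ih =>
    rw [← Finset.add_sum_erase _ _ (Finset.mem_range.mpr hk), if_pos le_rfl]
    rw [← Finset.add_sum_erase _ _ (Finset.mem_range.mpr hk), if_neg (by omega), zero_add] at ih
    have h1 : (∑ i ∈ (Finset.range D).erase k, if k ≤ i then f i - f (i + 1) else 0) = f (k + 1) := by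
      rw [ih]
      refine Finset.sum_congr rfl fun i hi => ?_
      have := Finset.ne_of_mem_erase hi
      by_cases h : k ≤ i
      · rw [if_pos h, if_pos (by omega)]
      · rw [if_neg h, if_neg (by omega)]
    rw [h1]
    have := hf (Nat.le_succ k)
    simp only [Nat.succ_eq_add_one] at this
    omega

theorem sum_eq_sum_differences {f : ℕ → ℕ} (hf : Antitone f) {D : ℕ} (hD : f D = 0) :
    ∑ k ∈ Finset.range D, f k = ∑ i : Fin D, (f i - f (i + 1)) * (i.1 + 1) := by
  rw [Finset.sum_congr rfl fun k hk => eq_sum_differences hf hD (Finset.mem_range.mp hk).le,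
    Finset.sum_comm, Finset.sum_range]
  exact Finset.sum_congr rfl fun i _ => by rw [sum_range_ite_le i.2, mul_comm]

/-- Expand each `f k` as the sum of the differences from `k` on. A pair `(i, j)` of differences then
occurs once for every `k ≤ min i j`, that is, `min (i + 1) (j + 1)` times. -/
theorem sum_sq_eq_sum_differences {f : ℕ → ℕ} (hf : Antitone f) {D : ℕ} (hD : f D = 0) :
    ∑ k ∈ Finset.range D, f k ^ 2 = ∑ i : Fin D, ∑ j : Fin D,
      (f i - f (i + 1)) * (f j - f (j + 1)) * min (i.1 + 1) (j.1 + 1) := by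
  have h : ∀ k ∈ Finset.range D, f k ^ 2 = ∑ i ∈ Finset.range D, ∑ j ∈ Finset.range D,
      if k ≤ min i j then (f i - f (i + 1)) * (f j - f (j + 1)) else 0 := fun k hk => by
    have h1 := eq_sum_differences hf hD (Finset.mem_range.mp hk).le
    rw [sq, h1, Finset.sum_mul_sum]
    refine Finset.sum_congr rfl fun i _ => Finset.sum_congr rfl fun j _ => ?_
    by_cases hi : k ≤ i <;> by_cases hj : k ≤ j <;> simp [hi, hj]
  rw [Finset.sum_congr rfl h, Finset.sum_comm, Finset.sum_range]
  refine Finset.sum_congr rfl fun i _ => ?_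
  rw [Finset.sum_comm, Finset.sum_range]
  refine Finset.sum_congr rfl fun j _ => ?_
  rw [sum_range_ite_le (lt_of_le_of_lt (min_le_left _ _) i.2), mul_comm]
  congr 1
  omega

variable {d : ℕ}

theorem part_eq_getElem (l : Nat.Partition d) {n : ℕ} (hn : n < (l.parts.sort (· ≥ ·)).length) :
    part l n = (l.parts.sort (· ≥ ·))[n] := List.getD_eq_getElem _ _ hn

theorem part_eq_zero_iff (l : Nat.Partition d) (n : ℕ) :
    part l n = 0 ↔ (l.parts.sort (· ≥ ·)).length ≤ n := by
  constructor
  · intro h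
    by_contra hn
    rw [part_eq_getElem l (not_le.mp hn)] at h
    have := l.parts_pos ((Multiset.mem_sort (r := (· ≥ ·))).mp (List.getElem_mem (not_le.mp hn)))
    omega
  · exact List.getD_eq_default _ _

theorem part_antitone (l : Nat.Partition d) : Antitone (part l) := by
  intro a b hab
  by_cases hb : (l.parts.sort (· ≥ ·)).length ≤ b
  · rw [(part_eq_zero_iff l b).mpr hb]
    exact Nat.zero_le _
  · rw [part_eq_getElem l (not_le.mp hb), part_eq_getElem l (lt_of_le_of_lt hab (not_le.mp hb))]
    rcases hab.eq_or_lt with rfl | h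
    · exact le_rfl
    · exact List.pairwise_iff_getElem.mp (Multiset.pairwise_sort l.parts (· ≥ ·)) _ _ _ _ h

theorem sum_part_length (l : Nat.Partition d) :
    ∑ i ∈ Finset.range (l.parts.sort (· ≥ ·)).length, part l i = d := by
  have h : (l.parts.sort (· ≥ ·)).sum = d := by
    rw [← Multiset.sum_coe, Multiset.sort_eq, l.parts_sum]
  refine Eq.trans ?_ h
  rw [Finset.sum_range]
  conv_rhs => rw [← List.ofFn_getElem (xs := l.parts.sort (· ≥ ·)), List.sum_ofFn]
  exact Finset.sum_congr rfl fun i _ => part_eq_getElem l i.2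

theorem part_eq_zero (l : Nat.Partition d) {n : ℕ} (hn : d ≤ n) : part l n = 0 := by
  rw [part_eq_zero_iff]
  refine le_trans ?_ hn
  conv_rhs => rw [← sum_part_length l]
  conv_lhs => rw [← Finset.card_range (l.parts.sort (· ≥ ·)).length]
  rw [Finset.card_eq_sum_ones]
  refine Finset.sum_le_sum fun i hi => Nat.one_le_iff_ne_zero.mpr fun h => ?_
  rw [part_eq_zero_iff] at h
  rw [Finset.mem_range] at hi
  omega

theorem sum_part (l : Nat.Partition d) {D : ℕ} (hD : d ≤ D) :
    ∑ i ∈ Finset.range D, part l i = d := by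
  conv_rhs => rw [← sum_part_length l]
  refine (Finset.sum_subset (Finset.range_subset_range.mpr ?_) fun i _ hi => ?_).symm
  · rw [← part_eq_zero_iff, part_eq_zero l hD]
  · rw [part_eq_zero_iff]
    simpa using hi

theorem part_injective {l l' : Nat.Partition d} (h : part l = part l') : l = l' := by
  have hs : l.parts.sort (· ≥ ·) = l'.parts.sort (· ≥ ·) := by
    have hlen : (l.parts.sort (· ≥ ·)).length = (l'.parts.sort (· ≥ ·)).length := by
      refine le_antisymm ?_ ?_
      · rw [← part_eq_zero_iff, h, part_eq_zero_iff]
      · rw [← part_eq_zero_iff, ← h, part_eq_zero_iff]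
    refine List.ext_getElem hlen fun i h1 h2 => ?_
    rw [← part_eq_getElem l h1, ← part_eq_getElem l' h2, h]
  ext1
  rw [← Multiset.sort_eq l.parts (· ≥ ·), hs, Multiset.sort_eq]

theorem exists_part_eq {f : ℕ → ℕ} (hf : Antitone f) {D : ℕ} (hD : f D = 0)
    (hd : ∑ i ∈ Finset.range D, f i = d) : ∃ l : Nat.Partition d, part l = f := by
  classical
  have hex : ∃ n, f n = 0 := ⟨D, hD⟩
  set s := Nat.find hex
  have hs : f s = 0 := Nat.find_spec hex
  have hpos : ∀ i < s, 0 < f i := fun i hi => Nat.pos_of_ne_zero (Nat.find_min hex hi)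
  have hzero : ∀ i, s ≤ i → f i = 0 := fun i hi => Nat.eq_zero_of_le_zero (hs ▸ hf hi)
  have hsum : ((List.range s).map f).sum = d := by
    rw [← hd, ← Finset.sum_subset (Finset.range_subset_range.mpr (Nat.find_min' hex hD))
      fun i _ hi => hzero i (not_lt.mp fun h => hi (Finset.mem_range.mpr h))]
    rfl
  refine ⟨⟨((List.range s).map f : List ℕ), ?_, ?_⟩, ?_⟩
  · intro i hi
    rw [Multiset.mem_coe, List.mem_map] at hi
    obtain ⟨a, ha, rfl⟩ := hi
    exact hpos a (List.mem_range.mp ha)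
  · rw [Multiset.sum_coe, hsum]
  · funext n
    have hsort : (((List.range s).map f : List ℕ) : Multiset ℕ).sort (· ≥ ·) =
        (List.range s).map f := by
      rw [Multiset.coe_sort]
      refine List.mergeSort_eq_self _ (List.pairwise_map.mpr ?_)
      exact (List.pairwise_lt_range (n := s)).imp fun h => hf h.le
    rw [part, hsort]
    by_cases hn : n < s
    · rw [List.getD_eq_getElem _ _ (by simpa using hn)]
      simp
    · rw [List.getD_eq_default _ _ (by simpa using hn), hzero n (not_lt.mp hn)]

/-- Let blocks of size `n` have multiplicity `λ_n - λ_{n+1}`, so that the block sizes form the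
conjugate partition. Then `∑ λ_n ^ 2` is the exponent of the order of the endomorphism ring, and
`r_λ` is the order of the automorphism group. -/
theorem rFactor_eq_autNum (l : Nat.Partition d) {D : ℕ} (hD : d ≤ D) :
    rFactor l = autNum (RatFunc.X : RatFunc ℚ) fun j : Fin D => part l j - part l (j + 1) := by
  have h : rFactor l = ∏ n ∈ Finset.range D,
      RatFunc.X ^ (part l n ^ 2) * qPoch (RatFunc.X)⁻¹ (part l n - part l (n + 1)) := by
    refine Finset.prod_subset (Finset.range_subset_range.mpr hD) fun n _ hn => ?_
    rw [part_eq_zero l (by simpa using hn)]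
    simp [qPoch]
  rw [h, Finset.prod_mul_distrib, Finset.prod_pow_eq_pow_sum,
    sum_sq_eq_sum_differences (part_antitone l) (part_eq_zero l hD), Finset.prod_range]
  rfl

theorem coeff_partitionSeries (m : ℕ) {D : ℕ} (hD : d ≤ D) :
    PowerSeries.coeff d (partitionSeries m) =
      PowerSeries.coeff d (massSeries D (RatFunc.X : RatFunc ℚ) m) := by
  rw [partitionSeries, PowerSeries.coeff_mk, massSeries, PowerSeries.coeff_mk]
  refine Finset.sum_bij (fun l _ j => part l j.1 - part l (j.1 + 1)) (fun l _ => ?_)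
    (fun l _ l' _ h => ?_) (fun n hn => ?_) fun l _ => by rw [rFactor_eq_autNum l hD]
  · rw [mem_multSet fun j => Nat.succ_pos _,
      ← sum_eq_sum_differences (part_antitone l) (part_eq_zero l hD), sum_part l hD]
  · refine part_injective (funext fun k => ?_)
    rcases le_or_gt k D with hk | hk
    · rw [eq_sum_differences (part_antitone l) (part_eq_zero l hD) hk,
        eq_sum_differences (part_antitone l') (part_eq_zero l' hD) hk]
      refine Finset.sum_congr rfl fun i hi => ?_
      rw [show part l i - part l (i + 1) = part l' i - part l' (i + 1) from
        congrFun h ⟨i, Finset.mem_range.mp hi⟩]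
    · rw [part_eq_zero l (hD.trans hk.le), part_eq_zero l' (hD.trans hk.le)]
  · rw [mem_multSet fun j => Nat.succ_pos _] at hn
    -- The inverse map: `f k` is the number of blocks of size greater than `k`, since index `i`
    -- stands for size `i + 1`.
    let f : ℕ → ℕ := fun k => ∑ i : Fin D, if k ≤ i.1 then n i else 0
    have hf : Antitone f := fun a b hab => Finset.sum_le_sum fun i _ => by
      split_ifs <;> omega
    have hfD : f D = 0 := Finset.sum_eq_zero fun i _ => if_neg (by omega)
    have hdiff : ∀ j : Fin D, f j - f (j + 1) = n j := fun j => by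
      have h1 : f j = f (j + 1) + n j := by
        simp only [f]
        rw [← Finset.add_sum_erase _ _ (Finset.mem_univ j), if_pos le_rfl,
          ← Finset.add_sum_erase (f := fun i : Fin D => if j.1 + 1 ≤ i.1 then n i else 0) _
            (Finset.mem_univ j), if_neg (by omega), zero_add, add_comm]
        congr 1
        refine Finset.sum_congr rfl fun i hi => ?_
        have hij : i.1 ≠ j.1 := fun h => Finset.ne_of_mem_erase hi (Fin.ext h)
        by_cases h : j.1 ≤ i.1
        · have h' : j.1 + 1 ≤ i.1 := by omega
          rw [if_pos h, if_pos h']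
        · rw [if_neg h, if_neg (by omega)]
      omega
    obtain ⟨l, hl⟩ := exists_part_eq (d := d) hf hfD (by
      rw [sum_eq_sum_differences hf hfD, Finset.sum_congr rfl fun i _ => by rw [hdiff i]]
      exact hn)
    refine ⟨l, Finset.mem_univ _, funext fun j => ?_⟩
    rw [hl, hdiff]

end Partitions

/-! ### Idempotents under extension of scalars -/

section ScalarExtension

open scoped Pointwise

/-- The kernel is the only maximal left ideal, hence lies in the Jacobson radical of an artinian
ring. Nilpotency of the ideal, rather than of its elements, is what survives passage to linear spans
over a larger field. -/
theorem isNilpotent_ker {E K : Type*} [Ring E] [Finite E] [Field K] (π : E →+* K)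
    (hπ : ∀ x, π x = 0 ↔ ¬ IsUnit x) : IsNilpotent (RingHom.ker π) := by
  have : Nontrivial E := π.domain_nontrivial
  have hle : RingHom.ker π ≤ Ideal.jacobson (⊥ : Ideal E) := by
    refine le_sInf fun J ⟨_, hJ⟩ => ?_
    refine (hJ.eq_of_le (RingHom.ker_ne_top π) fun x hx => ?_).ge
    rw [RingHom.mem_ker, hπ]
    exact fun hu => hJ.ne_top (J.eq_top_of_isUnit_mem hx hu)
  obtain ⟨n, hn⟩ := IsArtinianRing.isNilpotent_jacobson_bot (R := E)
  exact ⟨n, le_bot_iff.mp ((Ideal.pow_right_mono hle n).trans hn.le)⟩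

variable {F : Type*} [Field F] {E K : Type*} [Ring E] [Algebra F E] [Finite E] [Field K]
  [Algebra F K] (π : E →ₐ[F] K)

theorem isNilpotent_of_mem_span_ker (hπ : ∀ x, π x = 0 ↔ ¬ IsUnit x) {L R : Type*} [Field L] [Ring R] [Algebra L R] (β : E →+* R)
    {y : R} (hy : y ∈ Submodule.span L (β '' (RingHom.ker (π : E →+* K) : Set E))) :
    IsNilpotent y := by
  obtain ⟨k, hk⟩ := isNilpotent_ker (π : E →+* K) hπ
  refine ⟨k, ?_⟩
  have h1 := Submodule.pow_mem_pow _ hy k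
  have h2 : ∀ n : ℕ, ∀ z ∈ (β '' (RingHom.ker (π : E →+* K) : Set E)) ^ n,
      ∃ x ∈ RingHom.ker (π : E →+* K) ^ n, β x = z := by
    intro n
    induction n with
    | zero =>
      intro z hz
      rw [pow_zero, Set.mem_one] at hz
      exact ⟨1, by rw [Submodule.pow_zero, Ideal.one_eq_top]; trivial, by rw [map_one, hz]⟩
    | succ n ih =>
      intro z hz
      rw [pow_succ, Set.mem_mul] at hz
      obtain ⟨a, ha, b, ⟨b', hb', rfl⟩, rfl⟩ := hz
      obtain ⟨a', ha', rfl⟩ := ih a ha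
      exact ⟨a' * b', by rw [Submodule.pow_succ]; exact Ideal.mul_mem_mul ha' hb', map_mul _ _ _⟩
  rw [Submodule.span_pow] at h1
  rw [← Submodule.mem_bot L]
  refine Submodule.span_le.mpr (fun z hz => ?_) h1
  obtain ⟨x, hx, rfl⟩ := h2 k z hz
  rw [hk] at hx
  rw [(Submodule.mem_bot E).mp hx, map_zero]
  exact zero_mem _

/-- If the residue field of a local algebra is the base field, then extension of scalars creates no
idempotents. -/
theorem eq_zero_or_one_of_mem_span (hπ : ∀ x, π x = 0 ↔ ¬ IsUnit x) {L R : Type*} [Field L] [Algebra F L] [Ring R] [Algebra L R]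
    (β : E →+* R) (hβ : ∀ c : F, β (algebraMap F E c) = algebraMap L R (algebraMap F L c))
    (hK : Function.Surjective (algebraMap F K)) {e : R} (he : e ∈ Submodule.span L (Set.range β))
    (hi : IsIdempotentElem e) : e = 0 ∨ e = 1 := by
  -- Every element of the span is a scalar plus an element of the span of the radical, because each
  -- residue comes from `F`.
  have h1 : ∃ l : L, e - algebraMap L R l ∈
      Submodule.span L (β '' (RingHom.ker (π : E →+* K) : Set E)) := by
    clear hi
    induction he using Submodule.span_induction with
    | mem y hy =>
      obtain ⟨x, rfl⟩ := hy
      obtain ⟨c, hc⟩ := hK (π x)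
      refine ⟨algebraMap F L c, Submodule.subset_span ⟨x - algebraMap F E c, ?_, ?_⟩⟩
      · rw [SetLike.mem_coe, RingHom.mem_ker, map_sub, sub_eq_zero]
        change π x = π (algebraMap F E c)
        rw [AlgHom.commutes, hc]
      · rw [map_sub, hβ]
    | zero => exact ⟨0, by rw [map_zero, sub_zero]; exact zero_mem _⟩
    | add y z _ _ hy hz =>
      obtain ⟨a, ha⟩ := hy
      obtain ⟨b, hb⟩ := hz
      exact ⟨a + b, by rw [map_add, add_sub_add_comm]; exact add_mem ha hb⟩
    | smul a y _ hy =>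
      obtain ⟨b, hb⟩ := hy
      refine ⟨a * b, ?_⟩
      rw [map_mul, ← Algebra.smul_def, ← smul_sub]
      exact Submodule.smul_mem _ _ hb
  obtain ⟨l, hl⟩ := h1
  have hn := isNilpotent_of_mem_span_ker π hπ β hl
  have hpow : ∀ n : ℕ, e ^ (n + 1) = e := fun n => hi.pow_succ_eq n
  by_cases h0 : l = 0
  · left
    rw [h0, map_zero, sub_zero] at hn
    obtain ⟨n, hn⟩ := hn
    rw [← hpow n, pow_succ, hn, zero_mul]
  · right
    have hu : IsUnit e := by
      have := hn.isUnit_add_left_of_commute ((IsUnit.mk0 l h0).map (algebraMap L R))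
        (Algebra.commutes l _).symm
      rwa [add_sub_cancel] at this
    exact hu.mul_left_cancel (by rw [mul_one]; exact hi)

/-- If extension of scalars to the residue field creates no idempotents, then every element of the
residue field lifts to an element that becomes a scalar. -/
theorem exists_lift_scalar (hπ : ∀ x, π x = 0 ↔ ¬ IsUnit x) [Finite F] [Finite K] (hE : TrivialIdempotents E)
    (hsurj : Function.Surjective π) {R : Type*} [Ring R] [Nontrivial R] [Algebra K R]
    (β : E →+* R) (hR : ∀ e ∈ Algebra.adjoin K (Set.range β), IsIdempotentElem e → e = 0 ∨ e = 1)
    (x : K) : ∃ θ : E, π θ = x ∧ ∃ a : K, β θ = algebraMap K R a := by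
  classical
  have := Fintype.ofFinite K
  have := hE.1
  obtain ⟨p, _⟩ := CharP.exists K
  obtain ⟨f, hp, hf⟩ := FiniteField.card K p
  have : Fact p.Prime := ⟨hp⟩
  have : CharP F p := (algebraMap F K).charP (algebraMap F K).injective p
  have : CharP E p := charP_of_injective_algebraMap (algebraMap F E).injective p
  have : CharP R p := charP_of_injective_algebraMap (algebraMap K R).injective p
  set Q := Fintype.card K with hQ
  have hQ1 : 1 < Q := Fintype.one_lt_card
  obtain ⟨θ₀, hθ₀⟩ := hsurj x
  have hnil : IsNilpotent (θ₀ ^ Q - θ₀) := by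
    refine hE.isNilpotent_of_not_isUnit ((hπ _).mp ?_)
    rw [map_sub, map_pow, hθ₀, FiniteField.pow_card, sub_self]
  obtain ⟨n, hn⟩ := hnil
  have hn' : (θ₀ ^ Q - θ₀) ^ Q ^ n = 0 :=
    pow_eq_zero_of_le (Nat.lt_pow_self hQ1).le hn
  -- A Teichmüller-type lift: it has the same residue as `θ₀` and satisfies `θ ^ Q = θ` exactly.
  set θ := θ₀ ^ Q ^ n with hθ
  have hθQ : θ ^ Q = θ := by
    rw [hf, ← pow_mul, sub_pow_char_pow_of_commute (p := p) (h := Commute.pow_left (Commute.refl _) _),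
      pow_mul, ← hf, ← pow_mul, mul_comm, pow_mul, sub_eq_zero] at hn'
    exact hn'
  refine ⟨θ, by rw [hθ, map_pow, hθ₀, FiniteField.pow_card_pow], ?_⟩
  have hy : ∀ a : K, (β θ - algebraMap K R a) ^ Q = β θ - algebraMap K R a := fun a => by
    have h1 : (β θ - algebraMap K R a) ^ p ^ (f : ℕ) =
        β θ ^ p ^ (f : ℕ) - algebraMap K R a ^ p ^ (f : ℕ) :=
      sub_pow_char_pow_of_commute _ _ (h := (Algebra.commutes a _).symm)
    rw [← hf, ← map_pow, ← map_pow, hθQ, FiniteField.pow_card] at h1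
    exact h1
  obtain ⟨s, hs⟩ : ∃ s, Q = s + 2 := ⟨Q - 2, by omega⟩
  -- The element `y = β θ - a` also satisfies `y ^ Q = y`, so `y ^ (Q - 1)` is idempotent, with `Q -
  -- 1 = s + 1`.
  have hidem : ∀ a : K, (β θ - algebraMap K R a) ^ (s + 1) = 0 ∨
      (β θ - algebraMap K R a) ^ (s + 1) = 1 := fun a => by
    refine hR _ (pow_mem (sub_mem (Algebra.subset_adjoin (Set.mem_range_self θ)) (Subalgebra.algebraMap_mem _ _))
      _) ?_
    have h1 := hy a
    rw [hs] at h1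
    rw [IsIdempotentElem, ← pow_add, show s + 1 + (s + 1) = s + (s + 2) by ring, pow_add, h1,
      ← pow_succ]
  by_contra hne
  push Not at hne
  -- If no `β θ - a` vanishes, all are units; but their product over `a : K` is `(β θ) ^ Q - β θ =
  -- 0`.
  have hunit : ∀ a : K, IsUnit (β θ - algebraMap K R a) := fun a => by
    rcases hidem a with h | h
    · refine absurd ?_ (hne a)
      rw [← sub_eq_zero, ← hy a, hs, pow_succ, h, zero_mul]
    · exact IsUnit.of_pow_eq_one h (Nat.succ_ne_zero s)
  have hprod : (∏ a : K, (Polynomial.X - Polynomial.C a)) = Polynomial.X ^ Q - Polynomial.X := by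
    have hroots := FiniteField.roots_X_pow_card_sub_X K
    have h1 := Polynomial.prod_multiset_X_sub_C_of_monic_of_roots_card_eq
      (p := (Polynomial.X ^ Q - Polynomial.X : K[X]))
      (Polynomial.monic_X_pow_sub (by rw [Polynomial.degree_X]; exact_mod_cast hQ1))
      (by rw [hroots, FiniteField.X_pow_card_sub_X_natDegree_eq K hQ1]; rfl)
    rw [hroots] at h1
    exact h1
  have hun : ∀ S : Finset K,
      IsUnit (Polynomial.aeval (β θ) (∏ a ∈ S, (Polynomial.X - Polynomial.C a))) := fun S => by
    induction S using Finset.induction_on with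
    | empty => simp
    | insert a S ha ih =>
      rw [Finset.prod_insert ha, map_mul]
      refine IsUnit.mul ?_ ih
      rw [map_sub, Polynomial.aeval_X, Polynomial.aeval_C]
      exact hunit a
  have h0 := hun Finset.univ
  rw [hprod, map_sub, map_pow, Polynomial.aeval_X, ← map_pow, hθQ, sub_self] at h0
  exact not_isUnit_zero h0

end ScalarExtension

/-! ### Indecomposability through idempotents of the commutant -/

section Indecomposable

variable {F : Type u} [Field F] {G : Type v} [Monoid G]

theorem isIndecomposable_iff {V : Type w} [AddCommGroup V] [Module F V]
    (σ : Representation F G V) :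
    IsIndecomposable σ ↔ Nontrivial V ∧ ∀ e : Module.End F V, (∀ g, Commute (σ g) e) →
      IsIdempotentElem e → e = 0 ∨ e = 1 := by
  have hbot : ∀ U : Subrepresentation σ, U = ⊥ ↔ U.toSubmodule = ⊥ := fun U =>
    ⟨fun h => by rw [h]; rfl, fun h => Subrepresentation.toSubmodule_injective h⟩
  have hcompl : ∀ U W : Subrepresentation σ, IsCompl U W ↔ IsCompl U.toSubmodule W.toSubmodule :=
    fun U W => by
    rw [isCompl_iff, isCompl_iff, disjoint_iff, disjoint_iff, codisjoint_iff, codisjoint_iff,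
      ← Subrepresentation.toSubmodule_injective.eq_iff,
      ← Subrepresentation.toSubmodule_injective.eq_iff, Subrepresentation.toSubmodule_inf,
      Subrepresentation.toSubmodule_sup]
    rfl
  refine and_congr_right fun hV => ⟨fun h e he hi => ?_, fun h U W hUW => ?_⟩
  · have hc : ∀ g v, σ g (e v) = e (σ g v) := fun g v => LinearMap.congr_fun (he g) v
    let U : Subrepresentation σ := ⟨LinearMap.range e, fun g v ⟨w, hw⟩ => ⟨σ g w, by
      rw [← hc, hw]⟩⟩
    let W : Subrepresentation σ := ⟨LinearMap.ker e, fun g v hv => by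
      rw [LinearMap.mem_ker] at hv ⊢
      rw [← hc, hv, map_zero]⟩
    rcases h U W ((hcompl U W).mpr (LinearMap.IsIdempotentElem.isCompl hi)) with h1 | h1
    · left
      exact LinearMap.range_eq_bot.mp ((hbot U).mp h1)
    · right
      have h2 := LinearMap.ker_eq_bot.mp ((hbot W).mp h1)
      refine LinearMap.ext fun v => h2 ?_
      exact LinearMap.congr_fun hi v
  · have hUW' := (hcompl U W).mp hUW
    set e := U.toSubmodule.projection W.toSubmodule hUW' with he
    have hcomm : ∀ g, Commute (σ g) e := fun g => LinearMap.ext fun v => by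
      change σ g (e v) = e (σ g v)
      have h1 : e (σ g (v - e v)) = 0 := (Submodule.projection_apply_eq_zero_iff hUW').mpr
        (W.apply_mem_toSubmodule g (Submodule.sub_projection_mem hUW' v))
      rw [map_sub, map_sub, sub_eq_zero] at h1
      rw [h1]
      exact ((Submodule.projection_eq_self_iff hUW' _).mpr
        (U.apply_mem_toSubmodule g (Submodule.projection_apply_mem hUW' v))).symm
    rcases h e hcomm (Submodule.isIdempotentElem_projection hUW') with h1 | h1
    · left
      rw [hbot, ← Submodule.range_projection hUW', ← he, h1, LinearMap.range_zero]
    · right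
      rw [hbot, ← Submodule.ker_projection hUW', ← he, h1]
      exact LinearMap.ker_id

end Indecomposable

open scoped TensorProduct

/-! ### Absolute indecomposability through the residue field -/

section AbsolutelyIndecomposable

variable {F : Type u} [Field F] {V : Type w} [AddCommGroup V] [Module F V]

/-- Take coordinates along an `F`-basis of `L`. The coordinate maps commute with base-changed
endomorphisms, so the commutant of a base change is spanned by the original commutant. -/
theorem exists_eq_sum_smul_baseChange (L : Type u) [Field L] [Algebra F L] [FiniteDimensional F L]
    (e : Module.End L (L ⊗[F] V)) :
    ∃ (x : Module.Free.ChooseBasisIndex F L → Module.End F V),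
      e = ∑ i, Module.Free.chooseBasis F L i • Module.End.baseChangeHom F L V (x i) ∧
      ∀ θ : Module.End F V, Commute (Module.End.baseChangeHom F L V θ) e →
        ∀ i, Commute θ (x i) := by
  let b := Module.Free.chooseBasis F L
  let p : Module.Free.ChooseBasisIndex F L → (L ⊗[F] V →ₗ[F] V) := fun i =>
    (TensorProduct.lid F V).toLinearMap ∘ₗ LinearMap.rTensor V (b.coord i)
  have hp : ∀ i l v, p i (l ⊗ₜ v) = b.coord i l • v := fun i l v => by
    simp [p]
  have hsum : ∀ y : L ⊗[F] V, y = ∑ i, b i ⊗ₜ[F] p i y := fun y => by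
    induction y using TensorProduct.induction_on with
    | zero => simp
    | tmul l v =>
      simp_rw [hp, ← TensorProduct.smul_tmul, ← TensorProduct.sum_tmul]
      congr 1
      exact (b.sum_repr l).symm
    | add y z hy hz =>
      conv_lhs => rw [hy, hz]
      simp_rw [map_add, TensorProduct.tmul_add, Finset.sum_add_distrib]
  have hcomm : ∀ (θ : Module.End F V) i y, p i (Module.End.baseChangeHom F L V θ y) = θ (p i y) :=
    fun θ i y => by
    induction y using TensorProduct.induction_on with
    | zero => simp
    | tmul l v =>
      change p i (l ⊗ₜ θ v) = _
      rw [hp, hp, map_smul]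
    | add y z hy hz => rw [map_add, map_add, hy, hz, map_add, map_add]
  refine ⟨fun i => p i ∘ₗ e.restrictScalars F ∘ₗ TensorProduct.mk F L V 1, ?_, ?_⟩
  · refine TensorProduct.AlgebraTensorModule.curry_injective ?_
    ext v
    change e (1 ⊗ₜ v) = (∑ i, b i • Module.End.baseChangeHom F L V _) (1 ⊗ₜ v)
    rw [LinearMap.sum_apply, hsum (e (1 ⊗ₜ v))]
    refine Finset.sum_congr rfl fun i _ => ?_
    change _ = b i • ((1 : L) ⊗ₜ[F] p i (e (1 ⊗ₜ v)))
    rw [TensorProduct.smul_tmul', smul_eq_mul, mul_one]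
  · intro θ hθ i
    refine LinearMap.ext fun v => ?_
    change θ (p i (e (1 ⊗ₜ v))) = p i (e (1 ⊗ₜ θ v))
    rw [← hcomm]
    exact congrArg (p i) (LinearMap.congr_fun hθ (1 ⊗ₜ v))

theorem nontrivial_baseChange_iff (L : Type u) [Field L] [Algebra F L] :
    Nontrivial (L ⊗[F] V) ↔ Nontrivial V := by
  constructor
  · intro h
    by_contra hV
    rw [not_nontrivial_iff_subsingleton] at hV
    have h0 : ∀ y : L ⊗[F] V, y = 0 := fun y => by
      induction y using TensorProduct.induction_on with
      | zero => rfl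
      | tmul l v => rw [Subsingleton.elim v 0, TensorProduct.tmul_zero]
      | add y z hy hz => rw [hy, hz, add_zero]
    obtain ⟨y, hy⟩ := exists_ne (0 : L ⊗[F] V)
    exact hy (h0 y)
  · intro h
    infer_instance

variable {G : Type v} [Monoid G] (σ : Representation F G V)

theorem IsAbsIndecomposable.isIndecomposable {σ : Representation F G V}
    (h : IsAbsIndecomposable σ) : IsIndecomposable σ := by
  have h1 := h F
  rw [isIndecomposable_iff, nontrivial_baseChange_iff] at h1
  rw [isIndecomposable_iff]
  refine ⟨h1.1, fun e he hi => ?_⟩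
  have hinj : Function.Injective (Module.End.baseChangeHom F F V) :=
    LinearMap.baseChangeHom_injective F V F
  rcases h1.2 (Module.End.baseChangeHom F F V e) 
      (fun g => (he g).map (Module.End.baseChangeHom F F V)) (hi.map _) with h2 | h2
  · exact Or.inl (hinj (h2.trans (map_zero _).symm))
  · exact Or.inr (hinj (h2.trans (map_one _).symm))

variable {E : Type*} {K : Type u} [Ring E] [Algebra F E] [Field K] [Algebra F K]
  {τ : E →ₐ[F] Module.End F V}

theorem isIndecomposable_iff_trivialIdempotents (hinj : Function.Injective τ)
    (hrange : ∀ θ, (∃ φ, τ φ = θ) ↔ ∀ g, Commute (σ g) θ) :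
    IsIndecomposable σ ↔ TrivialIdempotents E := by
  have hV : Nontrivial V ↔ Nontrivial E := by
    constructor
    · intro h
      exact τ.toRingHom.domain_nontrivial
    · intro h
      by_contra hV
      rw [not_nontrivial_iff_subsingleton] at hV
      exact zero_ne_one (hinj (Subsingleton.elim (τ 0) (τ 1)))
  rw [isIndecomposable_iff, TrivialIdempotents, hV]
  refine and_congr_right fun _ => ⟨fun h φ hφ => ?_, fun h e he hi => ?_⟩
  · rcases h (τ φ) ((hrange _).mp ⟨φ, rfl⟩) (hφ.map τ) with h1 | h1
    · exact Or.inl (hinj (h1.trans (map_zero _).symm))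
    · exact Or.inr (hinj (h1.trans (map_one _).symm))
  · obtain ⟨φ, rfl⟩ := (hrange e).mpr he
    rcases h φ (hinj (by rw [map_mul]; exact hi)) with h1 | h1
    · exact Or.inl (by rw [h1, map_zero])
    · exact Or.inr (by rw [h1, map_one])

theorem finrank_eq_one_iff_surjective {F K : Type*} [Field F] [Field K] [Algebra F K] :
    Module.finrank F K = 1 ↔ Function.Surjective (algebraMap F K) := by
  constructor
  · intro h
    exact Algebra.surjective_algebraMap_iff.mpr (Subalgebra.bot_eq_top_of_finrank_eq_one h).symm
  · intro h
    rw [← (LinearEquiv.ofBijective (Algebra.linearMap F K)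
      ⟨(algebraMap F K).injective, h⟩).finrank_eq, Module.finrank_self]

/-- An indecomposable representation over a finite field is absolutely indecomposable if and only if
the residue field of its endomorphism ring is the base field. -/
theorem isAbsIndecomposable_iff [Finite F] [Finite K] [Finite E] (hinj : Function.Injective τ)
    (hrange : ∀ θ, (∃ φ, τ φ = θ) ↔ ∀ g, Commute (σ g) θ) (hE : TrivialIdempotents E)
    (π : E →ₐ[F] K) (hsurj : Function.Surjective π) (hπ : ∀ x, π x = 0 ↔ ¬ IsUnit x) :
    IsAbsIndecomposable σ ↔ Module.finrank F K = 1 := by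
  have hV : Nontrivial V :=
    ((isIndecomposable_iff_trivialIdempotents σ hinj hrange).mpr hE).1
  rw [finrank_eq_one_iff_surjective]
  constructor
  · intro h x
    have h1 := h K
    rw [isIndecomposable_iff] at h1
    have := h1.1
    let β : E →+* Module.End K (K ⊗[F] V) :=
      ((Module.End.baseChangeHom F K V).comp τ : E →ₐ[F] _)
    -- Indecomposability is used over the residue field `K` itself. It yields a lift `θ` of `x` that
    -- becomes the scalar `a` there.
    obtain ⟨θ, hθ, a, ha⟩ := exists_lift_scalar π hπ hE hsurj β (fun e he hi =>
      h1.2 e (fun g => by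
        clear hi
        induction he using Algebra.adjoin_induction with
        | mem y hy =>
          obtain ⟨φ, rfl⟩ := hy
          exact ((hrange (τ φ)).mp ⟨φ, rfl⟩ g).map (Module.End.baseChangeHom F K V)
        | algebraMap r => exact (Algebra.commutes r _).symm
        | add y z _ _ hy hz => exact hy.add_right hz
        | mul y z _ _ hy hz => exact hy.mul_right hz) hi) x
    obtain ⟨v, hv⟩ := exists_ne (0 : V)
    obtain ⟨f, hf⟩ := Module.Projective.exists_dual_ne_zero F hv
    have key : ∀ w, (1 : K) ⊗ₜ[F] τ θ w = a ⊗ₜ[F] w := fun w => by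
      have := LinearMap.congr_fun ha (1 ⊗ₜ w)
      rw [Module.algebraMap_end_apply, TensorProduct.smul_tmul', smul_eq_mul, mul_one] at this
      exact this
    -- A functional with `f v ≠ 0` shows that the scalar `a` already lies in `F`. Hence `θ` is a
    -- scalar from `F`, and so is its residue `x`.
    have hfa : algebraMap F K (f (τ θ v)) = a * algebraMap F K (f v) := by
      have := congrArg (fun y => TensorProduct.rid F K (LinearMap.lTensor K f y)) (key v)
      simpa [Algebra.smul_def, mul_comm] using this
    have hac : a = algebraMap F K (f (τ θ v) / f v) := by
      rw [map_div₀, hfa, mul_div_cancel_right₀]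
      exact fun h => hf ((_root_.map_eq_zero _).mp h)
    have hθc : θ = algebraMap F E (f (τ θ v) / f v) := by
      refine hinj ?_
      have hb : Function.Injective (Module.End.baseChangeHom F K V) :=
        LinearMap.baseChangeHom_injective F V K
      refine hb ?_
      rw [AlgHom.commutes, AlgHom.commutes]
      refine Eq.trans ha ?_
      rw [hac]
      exact (IsScalarTower.algebraMap_apply F K (Module.End K (K ⊗[F] V)) _).symm
    exact ⟨f (τ θ v) / f v, by rw [← hθ, ← π.commutes, ← hθc]⟩
  · intro h L _ _ _
    rw [isIndecomposable_iff, nontrivial_baseChange_iff]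
    refine ⟨hV, fun e he hi => ?_⟩
    let β : E →+* Module.End L (L ⊗[F] V) :=
      ((Module.End.baseChangeHom F L V).comp τ : E →ₐ[F] _)
    refine eq_zero_or_one_of_mem_span π hπ β (fun c => ?_) h (L := L)
      (R := Module.End L (L ⊗[F] V)) (e := e) ?_ hi
    · change Module.End.baseChangeHom F L V (τ _) = _
      rw [AlgHom.commutes, AlgHom.commutes]
      exact IsScalarTower.algebraMap_apply F L (Module.End L (L ⊗[F] V)) _
    · obtain ⟨x, hx, hc⟩ := exists_eq_sum_smul_baseChange L e
      rw [hx]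
      refine Submodule.sum_mem _ fun i _ => Submodule.smul_mem _ _ (Submodule.subset_span ?_)
      obtain ⟨φ, hφ⟩ := (hrange (x i)).mpr fun g => hc _ (he g) i
      exact ⟨φ, by rw [← hφ]; rfl⟩

end AbsolutelyIndecomposable

/-! ### Isomorphism classes of representations of the free group -/

section Classes

variable {F : Type u} [Field F]

section Monoid

variable {G : Type v} [Monoid G] {d : ℕ}

/-- The representation of a monoid attached to a representation of its monoid algebra. -/
def toRep (ρ : MonoidAlgebra F G →ₐ[F] Module.End F (Fin d → F)) :
    Representation F G (Fin d → F) :=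
  (MonoidAlgebra.lift F _ G).symm ρ

theorem toRep_surjective (σ : Representation F G (Fin d → F)) : ∃ ρ, toRep ρ = σ :=
  ⟨MonoidAlgebra.lift F _ G σ, (MonoidAlgebra.lift F _ G).symm_apply_apply σ⟩

theorem forall_commute_toRep_iff (ρ : MonoidAlgebra F G →ₐ[F] Module.End F (Fin d → F))
    (θ : Module.End F (Fin d → F)) : (∀ a, Commute (ρ a) θ) ↔ ∀ g, Commute (toRep ρ g) θ := by
  refine ⟨fun h g => h _, fun h a => ?_⟩
  induction a using MonoidAlgebra.induction_on with
  | of g => exact h g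
  | add a b ha hb => rw [map_add]; exact ha.add_left hb
  | smul c a ha => rw [map_smul]; exact ha.smul_left c

theorem nonempty_equiv_iff (ρ ρ' : MonoidAlgebra F G →ₐ[F] Module.End F (Fin d → F)) :
    Nonempty (Representation.Equiv (toRep ρ) (toRep ρ')) ↔
      Nonempty (RepSpace ρ ≃ₗ[MonoidAlgebra F G] RepSpace ρ') := by
  constructor
  · rintro ⟨φ⟩
    let e : (Fin d → F) ≃ₗ[F] (Fin d → F) := φ.toLinearEquiv
    have he : ∀ g x, e (toRep ρ g x) = toRep ρ' g (e x) := fun g x =>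
      LinearMap.congr_fun (φ.isIntertwining' g) x
    have he' : ∀ a (x : Fin d → F), e (ρ a x) = ρ' a (e x) := fun a x => by
      induction a using MonoidAlgebra.induction_on with
      | of g => exact he g x
      | add a b ha hb =>
        rw [map_add, map_add, LinearMap.add_apply, LinearMap.add_apply, map_add, ha, hb]
      | smul c a ha =>
        rw [map_smul, map_smul, LinearMap.smul_apply, LinearMap.smul_apply, map_smul, ha]
    exact ⟨{ e with map_smul' := he' }⟩
  · rintro ⟨e⟩
    let e' : (Fin d → F) ≃ₗ[F] (Fin d → F) :=
      (e.restrictScalars F : RepSpace ρ ≃ₗ[F] RepSpace ρ')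
    exact ⟨Representation.Equiv.mk e' fun g => LinearMap.ext fun x =>
      e.map_smul (MonoidAlgebra.of F G g) x⟩

/-- The algebra isomorphism of endomorphism rings attached to an isomorphism of modules. -/
def endCongr {A : Type*} [Ring A] [Algebra F A] {M N : Type*} [AddCommGroup M] [Module F M]
    [Module A M] [IsScalarTower F A M] [AddCommGroup N] [Module F N] [Module A N]
    [IsScalarTower F A N] (e : M ≃ₗ[A] N) : Module.End A M ≃ₐ[F] Module.End A N :=
  AlgEquiv.ofRingEquiv (f := e.conjRingEquiv) fun c => LinearMap.ext fun x => by
    change e (c • e.symm x) = c • x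
    rw [← algebraMap_smul A c (e.symm x), map_smul, algebraMap_smul, LinearEquiv.apply_symm_apply]

theorem isIndecomposable_toRep_iff (ρ : MonoidAlgebra F G →ₐ[F] Module.End F (Fin d → F)) :
    IsIndecomposable (toRep ρ) ↔ IndecModule (MonoidAlgebra F G) (RepSpace ρ) :=
  isIndecomposable_iff_trivialIdempotents (τ := toEnd ρ) _ (toEnd_injective ρ) fun θ => by
    rw [mem_range_toEnd, forall_commute_toRep_iff]

theorem isAbsIndecomposable_toRep_iff [Finite F]
    (ρ : MonoidAlgebra F G →ₐ[F] Module.End F (Fin d → F)) {M : Type u} [AddCommGroup M]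
    [Module F M] [Module (MonoidAlgebra F G) M] [IsScalarTower F (MonoidAlgebra F G) M] [Finite M]
    (e : RepSpace ρ ≃ₗ[MonoidAlgebra F G] M) (hM : IndecModule (MonoidAlgebra F G) M) {K : Type u}
    [Field K] [Algebra F K] [Finite K] (π : Module.End (MonoidAlgebra F G) M →ₐ[F] K)
    (hsurj : Function.Surjective π) (hπ : ∀ x, π x = 0 ↔ ¬ IsUnit x) :
    IsAbsIndecomposable (toRep ρ) ↔ Module.finrank F K = 1 := by
  refine isAbsIndecomposable_iff (τ := (toEnd ρ).comp (endCongr (F := F) e.symm).toAlgHom) (toRep ρ)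
    ((toEnd_injective ρ).comp (endCongr (F := F) e.symm).injective) (fun θ => ?_) hM π hsurj hπ
  rw [← forall_commute_toRep_iff, ← mem_range_toEnd]
  constructor
  · rintro ⟨φ, hφ⟩
    exact ⟨_, hφ⟩
  · rintro ⟨φ, hφ⟩
    obtain ⟨ψ, rfl⟩ := (endCongr (F := F) e.symm).surjective φ
    exact ⟨ψ, hφ⟩

end Monoid

variable [Finite F] (m : ℕ)

/-- The indecomposable modules of bounded dimension. -/
theorem exists_indecFamily (D : ℕ) :
    ∃ (k : ℕ) (B : IndecFamily F (MonoidAlgebra F (FreeGroup (Fin m))) (Fin k)),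
      ∀ d ≤ D, ∀ ρ : MonoidAlgebra F (FreeGroup (Fin m)) →ₐ[F] Module.End F (Fin d → F),
        IndecModule (MonoidAlgebra F (FreeGroup (Fin m))) (RepSpace ρ) →
          ∃ i, Nonempty (RepSpace ρ ≃ₗ[MonoidAlgebra F (FreeGroup (Fin m))] B.I i) := by
  let A := MonoidAlgebra F (FreeGroup (Fin m))
  let S := Σ d : Fin (D + 1), {ρ : A →ₐ[F] Module.End F (Fin d → F) // IndecModule A (RepSpace ρ)}
  let st : Setoid S :=
    { r := fun s t => Nonempty (RepSpace s.2.1 ≃ₗ[A] RepSpace t.2.1)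
      iseqv := ⟨fun _ => ⟨.refl _ _⟩, fun ⟨e⟩ => ⟨e.symm⟩, fun ⟨e⟩ ⟨f⟩ => ⟨e.trans f⟩⟩ }
  let ε := Finite.equivFin (Quotient st)
  let c : Fin (Nat.card (Quotient st)) → S := fun i => (ε.symm i).out
  choose K fK aK nK π hs hk using fun i =>
    exists_residueField F (Module.End A (RepSpace (c i).2.1)) (c i).2.2
  refine ⟨Nat.card (Quotient st),
    { I := fun i => RepSpace (c i).2.1
      K := K
      π := π
      surj := hs
      ker := hk
      triv := fun i => (c i).2.2
      noniso := fun i j h => ?_ }, fun d hd ρ hρ => ?_⟩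
  · have h1 : (⟦c i⟧ : Quotient st) = ⟦c j⟧ := Quotient.sound h
    simp only [c, Quotient.out_eq] at h1
    exact ε.symm.injective h1
  · let s : S := ⟨⟨d, Nat.lt_succ_of_le hd⟩, ρ, hρ⟩
    refine ⟨ε ⟦s⟧, ?_⟩
    have h1 : (⟦s⟧ : Quotient st) = ⟦c (ε ⟦s⟧)⟧ := by
      simp only [c, Quotient.out_eq, Equiv.symm_apply_apply]
    exact Quotient.exact h1

variable {m}

theorem exists_equiv_obj_of_complete {k D : ℕ}
    (B : IndecFamily F (MonoidAlgebra F (FreeGroup (Fin m))) (Fin k))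
    (hB : ∀ d ≤ D, ∀ ρ : MonoidAlgebra F (FreeGroup (Fin m)) →ₐ[F] Module.End F (Fin d → F),
        IndecModule (MonoidAlgebra F (FreeGroup (Fin m))) (RepSpace ρ) →
          ∃ i, Nonempty (RepSpace ρ ≃ₗ[MonoidAlgebra F (FreeGroup (Fin m))] B.I i))
    {d : ℕ} (hd : d ≤ D)
    (ρ : MonoidAlgebra F (FreeGroup (Fin m)) →ₐ[F] Module.End F (Fin d → F)) :
    ∃ n, Nonempty (RepSpace ρ ≃ₗ[MonoidAlgebra F (FreeGroup (Fin m))] B.obj n) := by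
  refine B.exists_equiv_obj fun X hX => ?_
  have hX' : Module.finrank F X ≤ d := by
    have := Submodule.finrank_le (X.restrictScalars F)
    rwa [RepSpace.finrank_eq] at this
  have : Module.Finite F X := Module.Finite.of_finite
  -- The family is complete for structures on the spaces `F ^ d'`, so the submodule is transported
  -- to one of them.
  let e : (Fin (Module.finrank F X) → F) ≃ₗ[F] X := (Module.finBasis F X).equivFun.symm
  obtain ⟨i, ⟨f⟩⟩ := hB _ (hX'.trans hd) (transport e)
    (IndecModule.of_equiv (transportEquiv e).symm hX)
  exact ⟨i, ⟨(transportEquiv e).symm.trans f⟩⟩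

theorem card_absIndecClasses {k D : ℕ}
    (B : IndecFamily F (MonoidAlgebra F (FreeGroup (Fin m))) (Fin k))
    (hB : ∀ d ≤ D, ∀ ρ : MonoidAlgebra F (FreeGroup (Fin m)) →ₐ[F] Module.End F (Fin d → F),
        IndecModule (MonoidAlgebra F (FreeGroup (Fin m))) (RepSpace ρ) →
          ∃ i, Nonempty (RepSpace ρ ≃ₗ[MonoidAlgebra F (FreeGroup (Fin m))] B.I i))
    {d : ℕ} (hd : d ≤ D) :
    Nat.card (AbsIndecClasses F (FreeGroup (Fin m)) d) =
      Nat.card {i // B.dim i = d ∧ Module.finrank F (B.K i) = 1} := by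
  have hex : ∀ i : {i // B.dim i = d ∧ Module.finrank F (B.K i) = 1},
      Nonempty ((Fin d → F) ≃ₗ[F] B.I i.1) := fun i => by
    have : Module.Finite F (B.I i.1) := Module.Finite.of_finite
    exact ⟨LinearEquiv.ofFinrankEq _ _ (by rw [Module.finrank_fin_fun]; exact i.2.1.symm)⟩
  let e := fun i => (hex i).some
  have habs : ∀ i : {i // B.dim i = d ∧ Module.finrank F (B.K i) = 1},
      IsAbsIndecomposable (toRep (transport (A := MonoidAlgebra F (FreeGroup (Fin m))) (e i))) :=
    fun i => (isAbsIndecomposable_toRep_iff _ (transportEquiv (e i)) (B.triv i.1) (B.π i.1)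
      (B.surj i.1) (B.ker i.1)).mpr i.2.2
  symm
  refine Nat.card_congr (Equiv.ofBijective (fun i =>
    (Quotient.mk (absIndecSetoid F (FreeGroup (Fin m)) d) ⟨_, habs i⟩)) ⟨fun i j h => ?_, ?_⟩)
  · have h1 := Quotient.exact h
    obtain ⟨f⟩ := (nonempty_equiv_iff _ _).mp h1
    exact Subtype.ext (B.noniso i.1 j.1
      ⟨(transportEquiv (e i)).symm.trans (f.trans (transportEquiv (e j)))⟩)
  · intro x
    induction x using Quotient.inductionOn with
    | h s =>
      obtain ⟨σ, hσ⟩ := s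
      obtain ⟨ρ, rfl⟩ := toRep_surjective σ
      obtain ⟨i, ⟨f⟩⟩ := hB d hd ρ ((isIndecomposable_toRep_iff ρ).mp hσ.isIndecomposable)
      have hdim : B.dim i = d := by
        rw [← RepSpace.finrank_eq ρ]
        exact ((f.restrictScalars F).finrank_eq).symm
      have hK := (isAbsIndecomposable_toRep_iff ρ f (B.triv i) (B.π i) (B.surj i) (B.ker i)).mp hσ
      refine ⟨⟨i, hdim, hK⟩, Quotient.sound ?_⟩
      exact (nonempty_equiv_iff _ _).mpr ⟨(transportEquiv (e ⟨i, hdim, hK⟩)).trans f.symm⟩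

/-- The number of absolutely indecomposable representations over a finite field. -/
theorem card_absIndecClasses_eq (F : Type u) [Field F] [Finite F] (m : ℕ) {d : ℕ} (hd0 : d ≠ 0) :
    ((Nat.card F : ℚ) - 1) * ∑ n ∈ d.divisors, (ArithmeticFunction.moebius n : ℚ) / n *
      PowerSeries.coeff (d / n) (PowerSeries.logOf (massSeries d ((Nat.card F : ℚ) ^ n) m)) =
      Nat.card (AbsIndecClasses F (FreeGroup (Fin m)) d) := by
  obtain ⟨k, B, hB⟩ := exists_indecFamily (F := F) m d
  rw [card_absIndecClasses B hB le_rfl]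
  exact card_indec_eq m B (fun d' hd' ρ => exists_equiv_obj_of_complete B hB hd' ρ) le_rfl hd0

end Classes

/-! ### Evaluation of rational functions and of logarithms -/

section Log

theorem map_logOf {R S : Type*} [CommRing R] [CommRing S] [Algebra ℚ R] [Algebra ℚ S] (φ : R →+* S)
    {f : R⟦X⟧} (hf : PowerSeries.constantCoeff f = 1) :
    PowerSeries.map φ (PowerSeries.logOf f) = PowerSeries.logOf (PowerSeries.map φ f) := by
  have hs : PowerSeries.HasSubst (f - 1) :=
    PowerSeries.HasSubst.of_constantCoeff_zero' (by rw [map_sub, hf, map_one, sub_self])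
  rw [PowerSeries.logOf_eq, PowerSeries.logOf_eq]
  refine (PowerSeries.map_subst hs _).trans ?_
  rw [map_sub, map_one]
  congr 1
  ext n
  rw [PowerSeries.coeff_map, PowerSeries.coeff_log, PowerSeries.coeff_log]
  split_ifs
  · exact map_zero _
  · exact RingHom.map_rat_algebraMap φ _

end Log

section Evaluation

variable {L : Type} [Field L] [Algebra ℚ L]

/-- `RatFunc.eval` is defined by the reduced fraction and is meaningful only where its denominator
does not vanish. Any other fraction with nonvanishing denominator certifies this and gives the same
value. -/
theorem eval_eq_div {a : L} {f : RatFunc ℚ} {u v : ℚ[X]}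
    (h : f * algebraMap ℚ[X] (RatFunc ℚ) v = algebraMap ℚ[X] (RatFunc ℚ) u)
    (hv : Polynomial.aeval a v ≠ 0) :
    Polynomial.aeval a f.denom ≠ 0 ∧
      RatFunc.eval (algebraMap ℚ L) a f = Polynomial.aeval a u / Polynomial.aeval a v := by
  have hv0 : v ≠ 0 := by
    rintro rfl
    exact hv (map_zero _)
  have hv1 : algebraMap ℚ[X] (RatFunc ℚ) v ≠ 0 := RatFunc.algebraMap_ne_zero hv0
  have hf : f = algebraMap ℚ[X] (RatFunc ℚ) u / algebraMap ℚ[X] (RatFunc ℚ) v :=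
    eq_div_of_mul_eq hv1 h
  have hd : Polynomial.aeval a f.denom ≠ 0 := by
    obtain ⟨w, hw⟩ : f.denom ∣ v := hf ▸ RatFunc.denom_div_dvd u v
    intro h0
    rw [hw, map_mul, h0, zero_mul] at hv
    exact hv rfl
  refine ⟨hd, ?_⟩
  have h2 : f.num * v = u * f.denom := by
    refine RatFunc.algebraMap_injective ℚ ?_
    have hdn : algebraMap ℚ[X] (RatFunc ℚ) f.denom ≠ 0 :=
      RatFunc.algebraMap_ne_zero f.denom_ne_zero
    have h3 := RatFunc.num_div_denom f
    rw [div_eq_iff hdn] at h3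
    rw [map_mul, map_mul, h3, ← h]
    ring
  rw [RatFunc.eval, ← Polynomial.aeval_def, ← Polynomial.aeval_def, div_eq_div_iff hd hv,
    ← map_mul, h2, map_mul]

/-- The rational functions without a pole at `a`. -/
def regularAt (a : L) : Subring (RatFunc ℚ) where
  carrier := {f | Polynomial.aeval a f.denom ≠ 0}
  zero_mem' := by simp
  one_mem' := by simp
  add_mem' := fun {f g} hf hg h0 => by
    obtain ⟨w, hw⟩ := RatFunc.denom_add_dvd f g
    have := mul_ne_zero hf hg
    rw [← map_mul, hw, map_mul, h0, zero_mul] at this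
    exact this rfl
  mul_mem' := fun {f g} hf hg h0 => by
    obtain ⟨w, hw⟩ := RatFunc.denom_mul_dvd f g
    have := mul_ne_zero hf hg
    rw [← map_mul, hw, map_mul, h0, zero_mul] at this
    exact this rfl
  neg_mem' := fun {f} hf => by
    refine (eval_eq_div (a := a) (u := -f.num) (v := f.denom) ?_ hf).1
    have hdn : algebraMap ℚ[X] (RatFunc ℚ) f.denom ≠ 0 :=
      RatFunc.algebraMap_ne_zero f.denom_ne_zero
    have h3 := RatFunc.num_div_denom f
    rw [div_eq_iff hdn] at h3
    rw [map_neg, h3]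
    ring

theorem mem_regularAt {a : L} {f : RatFunc ℚ} :
    f ∈ regularAt a ↔ Polynomial.aeval a f.denom ≠ 0 := Iff.rfl

theorem algebraMap_mem_regularAt (a : L) (u : ℚ[X]) :
    algebraMap ℚ[X] (RatFunc ℚ) u ∈ regularAt a ∧
      RatFunc.eval (algebraMap ℚ L) a (algebraMap ℚ[X] (RatFunc ℚ) u) = Polynomial.aeval a u := by
  have h := eval_eq_div (a := a) (f := algebraMap ℚ[X] (RatFunc ℚ) u) (u := u) (v := 1)
    (by rw [map_one, mul_one]) (by rw [map_one]; exact one_ne_zero)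
  rw [map_one, div_one] at h
  exact h

instance (a : L) : Algebra ℚ (regularAt a) :=
  RingHom.toAlgebra ((algebraMap ℚ (RatFunc ℚ)).codRestrict (regularAt a) fun c => by
    rw [IsScalarTower.algebraMap_apply ℚ ℚ[X] (RatFunc ℚ)]
    exact (algebraMap_mem_regularAt a _).1)

/-- Evaluation at `a`. -/
def evalAt (a : L) : regularAt a →+* L where
  toFun f := RatFunc.eval (algebraMap ℚ L) a f
  map_zero' := RatFunc.eval_zero _ _
  map_one' := RatFunc.eval_one _ _
  map_add' f g := RatFunc.eval_add _ _ f.2 g.2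
  map_mul' f g := RatFunc.eval_mul _ _ f.2 g.2

theorem inv_mem_regularAt {a : L} {f : RatFunc ℚ} (hf : f ∈ regularAt a)
    (h0 : RatFunc.eval (algebraMap ℚ L) a f ≠ 0) : f⁻¹ ∈ regularAt a := by
  have h1 : Polynomial.aeval a f.num ≠ 0 := fun h => h0 (by
    rw [RatFunc.eval, ← Polynomial.aeval_def, h, zero_div])
  refine (eval_eq_div (a := a) (u := f.denom) (v := f.num) ?_ h1).1
  have hdn : algebraMap ℚ[X] (RatFunc ℚ) f.denom ≠ 0 :=
    RatFunc.algebraMap_ne_zero f.denom_ne_zero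
  have h3 := RatFunc.num_div_denom f
  rw [div_eq_iff hdn] at h3
  have hf0 : f ≠ 0 := by
    rintro rfl
    exact h0 (RatFunc.eval_zero _ _)
  rw [h3, inv_mul_cancel_left₀ hf0]

theorem isUnit_of_evalAt_ne_zero {a : L} (f : regularAt a) (h : evalAt a f ≠ 0) : IsUnit f := by
  have hf0 : (f : RatFunc ℚ) ≠ 0 := fun h0 => h (by
    rw [show f = 0 from Subtype.ext h0, map_zero])
  exact IsUnit.of_mul_eq_one ⟨_, inv_mem_regularAt f.2 h⟩ (Subtype.ext (mul_inv_cancel₀ hf0))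

theorem X_mem_regularAt (a : L) : (RatFunc.X : RatFunc ℚ) ∈ regularAt a ∧
    RatFunc.eval (algebraMap ℚ L) a RatFunc.X = a := by
  rw [← RatFunc.algebraMap_X]
  have := algebraMap_mem_regularAt a Polynomial.X
  rwa [Polynomial.aeval_X] at this

theorem poch_inv_ne_zero {k : Type*} [Field k] {x : k} (hx : ∀ i : ℕ, i ≠ 0 → x ^ i ≠ 1) (n : ℕ) :
    poch x⁻¹ n ≠ 0 := by
  rw [poch, Finset.prod_ne_zero_iff]
  intro i _ h
  rw [sub_eq_zero, inv_pow, eq_comm, inv_eq_one] at h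
  exact hx _ (Nat.succ_ne_zero i) h

theorem exists_autNum_lift {a : L} (ha : a ≠ 0) (hx : ∀ i : ℕ, i ≠ 0 → a ^ i ≠ 1) {D : ℕ}
    (n : Fin D → ℕ) (e : ℤ) : ∃ f : regularAt a,
      (f : RatFunc ℚ) = autNum (RatFunc.X : RatFunc ℚ) n ^ e ∧ evalAt a f = autNum a n ^ e := by
  have hX := X_mem_regularAt a
  let x : regularAt a := ⟨RatFunc.X, hX.1⟩
  have hxa : evalAt a x = a := hX.2
  have hu : IsUnit x := isUnit_of_evalAt_ne_zero x (by rw [hxa]; exact ha)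
  have hz : ∀ {R : Type} [Field R] (φ : regularAt a →+* R) (u : (regularAt a)ˣ) (e : ℤ),
      φ ↑(u ^ e) = (φ u) ^ e := fun φ u e => by
    have h := Units.val_zpow_eq_zpow_val (Units.map φ.toMonoidHom u) e
    rw [← map_zpow] at h
    exact h
  let g : regularAt a := x ^ (∑ i, ∑ j, n i * n j * min (i.1 + 1) (j.1 + 1)) *
    ∏ i, ∏ j ∈ Finset.range (n i), (1 - (↑(hu.unit ^ (-1 : ℤ)) : regularAt a) ^ (j + 1))
  have hg : ∀ {R : Type} [Field R] (φ : regularAt a →+* R), φ g = autNum (φ x) n := fun φ => by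
    simp only [g, autNum, poch, map_mul, map_prod, map_sub, map_one, map_pow, hz]
    simp only [zpow_neg_one]
    rfl
  have hga : evalAt a g = autNum a n := by rw [hg, hxa]
  have hgu : IsUnit g := isUnit_of_evalAt_ne_zero g (by
    rw [hga, autNum]
    exact mul_ne_zero (pow_ne_zero _ ha) (Finset.prod_ne_zero_iff.mpr fun i _ =>
      poch_inv_ne_zero hx _))
  refine ⟨↑(hgu.unit ^ e), ?_, ?_⟩
  · exact (hz (regularAt a).subtype hgu.unit e).trans (congrArg (· ^ e) (hg (regularAt a).subtype))
  · exact (hz (evalAt a) hgu.unit e).trans (congrArg (· ^ e) hga)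

theorem exists_massSeries_lift {a : L} (ha : a ≠ 0) (hx : ∀ i : ℕ, i ≠ 0 → a ^ i ≠ 1) (D m : ℕ) :
    ∃ f : (regularAt a)⟦X⟧, PowerSeries.map (regularAt a).subtype f =
        massSeries D (RatFunc.X : RatFunc ℚ) m ∧
      PowerSeries.map (evalAt a) f = massSeries D a m := by
  choose f hf using fun n : Fin D → ℕ => exists_autNum_lift ha hx n ((m : ℤ) - 1)
  refine ⟨PowerSeries.mk fun d => ∑ n ∈ multSet (fun j : Fin D => j.1 + 1) d, f n, ?_, ?_⟩
  · ext1 d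
    rw [PowerSeries.coeff_map, PowerSeries.coeff_mk, map_sum, massSeries, PowerSeries.coeff_mk]
    exact Finset.sum_congr rfl fun n _ => (hf n).1
  · ext1 d
    rw [PowerSeries.coeff_map, PowerSeries.coeff_mk, map_sum, massSeries, PowerSeries.coeff_mk]
    exact Finset.sum_congr rfl fun n _ => (hf n).2

/-- As `a` is neither zero nor a root of unity, the series lifts to the functions regular at `a`.
The logarithm commutes with both ring maps out of that ring, inclusion and evaluation. -/
theorem eval_coeff_logOf_massSeries {a : L} (ha : a ≠ 0) (hx : ∀ i : ℕ, i ≠ 0 → a ^ i ≠ 1)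
    (D m d : ℕ) :
    PowerSeries.coeff d (PowerSeries.logOf (massSeries D (RatFunc.X : RatFunc ℚ) m)) ∈ regularAt a ∧
      RatFunc.eval (algebraMap ℚ L) a
        (PowerSeries.coeff d (PowerSeries.logOf (massSeries D (RatFunc.X : RatFunc ℚ) m))) =
      PowerSeries.coeff d (PowerSeries.logOf (massSeries D a m)) := by
  obtain ⟨f, h1, h2⟩ := exists_massSeries_lift ha hx D m
  have hf : PowerSeries.constantCoeff f = 1 := by
    refine (regularAt a).subtype_injective ?_
    rw [← PowerSeries.coeff_zero_eq_constantCoeff_apply, ← PowerSeries.coeff_map, h1,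
      PowerSeries.coeff_zero_eq_constantCoeff_apply, constantCoeff_massSeries, map_one]
  have h3 := congrArg (PowerSeries.coeff d) (map_logOf (regularAt a).subtype hf)
  have h4 := congrArg (PowerSeries.coeff d) (map_logOf (evalAt a) hf)
  rw [PowerSeries.coeff_map, h1] at h3
  rw [PowerSeries.coeff_map, h2] at h4
  rw [← h3, ← h4]
  exact ⟨(PowerSeries.coeff d (PowerSeries.logOf f)).2, rfl⟩

theorem aeval_X_pow {u : ℚ[X]} (n : ℕ) : Polynomial.aeval ((RatFunc.X : RatFunc ℚ) ^ n) u =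
    algebraMap ℚ[X] (RatFunc ℚ) (Polynomial.expand ℚ n u) := by
  have h : (Polynomial.aeval (R := ℚ) ((RatFunc.X : RatFunc ℚ) ^ n)).toRingHom =
      (algebraMap ℚ[X] (RatFunc ℚ)).comp (Polynomial.expand ℚ n).toRingHom := by
    refine Polynomial.ringHom_ext' (RingHom.ext_rat _ _) ?_
    simp
  exact RingHom.congr_fun h u

/-- No nonzero polynomial vanishes at the transcendental `X ^ n`, so the substitution `q ↦ q ^ n` is
a ring homomorphism on all of `ℚ(q)`. -/
theorem mem_regularAt_X_pow {n : ℕ} (hn : n ≠ 0) (f : RatFunc ℚ) :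
    f ∈ regularAt ((RatFunc.X : RatFunc ℚ) ^ n) := by
  rw [mem_regularAt, aeval_X_pow]
  exact RatFunc.algebraMap_ne_zero
    ((Polynomial.expand_ne_zero (Nat.pos_of_ne_zero hn)).mpr f.denom_ne_zero)

/-- The substitution `q ↦ q ^ n`. -/
def substPow (n : ℕ) (hn : n ≠ 0) : RatFunc ℚ →+* RatFunc ℚ :=
  (evalAt ((RatFunc.X : RatFunc ℚ) ^ n)).comp
    ((RingHom.id (RatFunc ℚ)).codRestrict _ (mem_regularAt_X_pow hn))

theorem substPow_apply (n : ℕ) (hn : n ≠ 0) (f : RatFunc ℚ) :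
    substPow n hn f = RatFunc.eval (algebraMap ℚ (RatFunc ℚ)) (RatFunc.X ^ n) f := rfl

theorem eval_substPow {n : ℕ} (hn : n ≠ 0) {b : L} {f : RatFunc ℚ} (hf : f ∈ regularAt (b ^ n)) :
    substPow n hn f ∈ regularAt b ∧
      RatFunc.eval (algebraMap ℚ L) b (substPow n hn f) =
        RatFunc.eval (algebraMap ℚ L) (b ^ n) f := by
  have hb : ∀ u : ℚ[X], Polynomial.aeval b (Polynomial.expand ℚ n u) = Polynomial.aeval (b ^ n) u :=
    fun u => Polynomial.expand_aeval n u b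
  have h := eval_eq_div (a := b) (f := substPow n hn f) (u := Polynomial.expand ℚ n f.num)
    (v := Polynomial.expand ℚ n f.denom) ?_ (by rw [hb]; exact hf)
  · rw [hb, hb] at h
    exact h
  · rw [← aeval_X_pow, ← aeval_X_pow, substPow_apply, RatFunc.eval, ← Polynomial.aeval_def,
      ← Polynomial.aeval_def, div_mul_cancel₀]
    exact mem_regularAt_X_pow hn f

end Evaluation

section Evaluation

/-- `f` has no pole at `a` and takes there the value `y`. -/
def EvalsTo {L : Type} [Field L] [Algebra ℚ L] (a : L) (f : RatFunc ℚ) (y : L) : Prop :=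
  f ∈ regularAt a ∧ RatFunc.eval (algebraMap ℚ L) a f = y

variable {L : Type} [Field L] [Algebra ℚ L] {a : L} {f g : RatFunc ℚ} {y z : L}

theorem EvalsTo.add (hf : EvalsTo a f y) (hg : EvalsTo a g z) : EvalsTo a (f + g) (y + z) :=
  ⟨add_mem hf.1 hg.1, (RatFunc.eval_add (algebraMap ℚ L) a hf.1 hg.1).trans (by rw [hf.2, hg.2])⟩

theorem EvalsTo.mul (hf : EvalsTo a f y) (hg : EvalsTo a g z) : EvalsTo a (f * g) (y * z) :=
  ⟨mul_mem hf.1 hg.1, (RatFunc.eval_mul (algebraMap ℚ L) a hf.1 hg.1).trans (by rw [hf.2, hg.2])⟩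

theorem EvalsTo.sum {ι : Type*} (s : Finset ι) {f : ι → RatFunc ℚ} {y : ι → L}
    (h : ∀ i ∈ s, EvalsTo a (f i) (y i)) : EvalsTo a (∑ i ∈ s, f i) (∑ i ∈ s, y i) := by
  classical
  induction s using Finset.induction_on with
  | empty => exact ⟨zero_mem _, RatFunc.eval_zero _ _⟩
  | insert i s hi ih =>
    rw [Finset.sum_insert hi, Finset.sum_insert hi]
    exact (h i (Finset.mem_insert_self i s)).add
      (ih fun j hj => h j (Finset.mem_insert_of_mem hj))

theorem evalsTo_polynomial (u : ℚ[X]) :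
    EvalsTo a (algebraMap ℚ[X] (RatFunc ℚ) u) (Polynomial.aeval a u) :=
  algebraMap_mem_regularAt a u

theorem EvalsTo.rat_smul (c : ℚ) (hf : EvalsTo a f y) : EvalsTo a (c • f) (algebraMap ℚ L c * y) := by
  have h := (evalsTo_polynomial (a := a) (Polynomial.C c)).mul hf
  rwa [Polynomial.aeval_C, RatFunc.algebraMap_C, ← RatFunc.smul_eq_C_mul] at h

/-- The rational functions whose values count absolutely indecomposable representations. -/
def indecFun (m d : ℕ) : RatFunc ℚ :=
  (RatFunc.X - 1) * PowerSeries.coeff d (plethLog (partitionSeries m))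

theorem coeff_adams {n : ℕ} (hn : n ≠ 0) (s : (RatFunc ℚ)⟦X⟧) (d : ℕ) :
    PowerSeries.coeff d (adams n s) =
      if n ∣ d then substPow n hn (PowerSeries.coeff (d / n) s) else 0 := by
  rw [adams, PowerSeries.coeff_mk]
  rfl

theorem constantCoeff_partitionSeries (m : ℕ) :
    PowerSeries.constantCoeff (partitionSeries m) = 1 := by
  rw [← PowerSeries.coeff_zero_eq_constantCoeff_apply, coeff_partitionSeries m le_rfl,
    PowerSeries.coeff_zero_eq_constantCoeff_apply, constantCoeff_massSeries]

/-- The numerical identity of `card_absIndecClasses_eq` is the value at `q = |F|` of the plethystic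
formula, because substituting `q ↦ q ^ n` and evaluating at `|F|` is evaluation at `|F| ^ n`. -/
theorem evalsTo_indecFun (F : Type u) [Field F] [Finite F] (m : ℕ) {d : ℕ} (hd : d ≠ 0) :
    EvalsTo (Nat.card F : ℚ) (indecFun m d)
      (Nat.card (AbsIndecClasses F (FreeGroup (Fin m)) d) : ℚ) := by
  rw [← card_absIndecClasses_eq F m hd, indecFun, plethLog, PowerSeries.coeff_mk]
  have hq := one_lt_card F
  have hX : EvalsTo (Nat.card F : ℚ) (RatFunc.X - 1) ((Nat.card F : ℚ) - 1) := by
    have h := evalsTo_polynomial (a := (Nat.card F : ℚ)) (Polynomial.X - 1)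
    rwa [map_sub, RatFunc.algebraMap_X, map_one, map_sub, Polynomial.aeval_X, map_one] at h
  refine hX.mul (EvalsTo.sum _ fun n hn => ?_)
  have hn0 : n ≠ 0 := (Nat.pos_of_mem_divisors hn).ne'
  rw [coeff_adams hn0, if_pos (Nat.dvd_of_mem_divisors hn)]
  refine EvalsTo.rat_smul _ ?_
  have hcong := coeff_logOf_congr (constantCoeff_partitionSeries m)
    (constantCoeff_massSeries d (RatFunc.X : RatFunc ℚ) m) d
    (fun j hj => coeff_partitionSeries m hj) (d / n) (Nat.div_le_self d n)
  rw [hcong]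
  have hqn : ∀ i : ℕ, i ≠ 0 → ((Nat.card F : ℚ) ^ n) ^ i ≠ 1 := fun i hi =>
    (one_lt_pow₀ (one_lt_pow₀ hq hn0) hi).ne'
  have h1 := eval_coeff_logOf_massSeries (a := (Nat.card F : ℚ) ^ n)
    (pow_ne_zero _ (zero_lt_one.trans hq).ne') hqn d m (d / n)
  have h2 := eval_substPow hn0 h1.1
  exact ⟨h2.1, h2.2.trans h1.2⟩

end Evaluation

/-! ### Rational functions with integral values -/

section Rationality

theorem exists_nat_smul_eq_map (u : ℚ[X]) :
    ∃ (N : ℕ) (w : ℤ[X]), N ≠ 0 ∧ (N : ℚ[X]) * u = w.map (Int.castRingHom ℚ) := by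
  induction u using Polynomial.induction_on' with
  | add u v hu hv =>
    obtain ⟨M, u', hM, hu'⟩ := hu
    obtain ⟨N, v', hN, hv'⟩ := hv
    refine ⟨M * N, N * u' + M * v', mul_ne_zero hM hN, ?_⟩
    rw [Polynomial.map_add, Polynomial.map_mul, Polynomial.map_mul, ← hu', ← hv']
    simp
    ring
  | monomial n c =>
    refine ⟨c.den, Polynomial.monomial n c.num, c.den_ne_zero, ?_⟩
    rw [Polynomial.map_monomial, ← Polynomial.C_eq_natCast, Polynomial.C_mul_monomial]
    congr 1
    rw [mul_comm]
    exact_mod_cast c.mul_den_eq_num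

/-- A rational function with integral values at all large powers of `2` is a polynomial. -/
theorem exists_eq_polynomial (f : RatFunc ℚ)
    (hf : ∀ k : ℕ, k ≠ 0 → ∃ c : ℤ, EvalsTo ((2 : ℚ) ^ k) f c) :
    ∃ u : ℚ[X], algebraMap ℚ[X] (RatFunc ℚ) u = f := by
  set v := f.denom with hv
  have hv0 : v.Monic := f.monic_denom
  set w := f.num /ₘ v with hw
  set r := f.num %ₘ v with hr
  have hdiv : r + v * w = f.num := Polynomial.modByMonic_add_div f.num v
  obtain ⟨N, w', hN, hw'⟩ := exists_nat_smul_eq_map w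
  -- Write `f = w + r / v` with `deg r < deg v`, and let `N` clear the denominators of `w`. Then `N
  -- r / v` is integral at powers of `2` and tends to `0` there, so `r` has infinitely many zeros.
  have hval : ∀ k : ℕ, k ≠ 0 → ∃ c : ℤ, (N : ℚ) * (r.eval ((2 : ℚ) ^ k) / v.eval ((2 : ℚ) ^ k)) = c := by
    intro k hk
    obtain ⟨c, hc1, hc2⟩ := hf k hk
    rw [mem_regularAt, ← hv, Polynomial.aeval_def, Algebra.algebraMap_self, Polynomial.eval₂_id] at hc1
    rw [RatFunc.eval, Algebra.algebraMap_self, Polynomial.eval₂_id, Polynomial.eval₂_id, ← hv, ← hdiv,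
      Polynomial.eval_add, Polynomial.eval_mul, add_div, mul_div_cancel_left₀ _ hc1] at hc2
    refine ⟨N * c - w'.eval (2 ^ k), ?_⟩
    have h1 := congrArg (Polynomial.eval ((2 : ℚ) ^ k)) hw'
    rw [Polynomial.eval_mul, Polynomial.eval_natCast] at h1
    have h2 : (w'.map (Int.castRingHom ℚ)).eval ((2 : ℚ) ^ k) = ((w'.eval (2 ^ k) : ℤ) : ℚ) := by
      have := Polynomial.eval_intCast_map (Int.castRingHom ℚ) w' (2 ^ k)
      simpa using this
    push_cast
    rw [← h2, ← h1, ← hc2]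
    ring
  have hlim : Filter.Tendsto (fun k : ℕ => (N : ℚ) * (r.eval ((2 : ℚ) ^ k) / v.eval ((2 : ℚ) ^ k)))
      Filter.atTop (nhds 0) := by
    have h1 := Polynomial.div_tendsto_atTop_zero_of_degree_lt r v (Polynomial.degree_modByMonic_lt _ hv0)
    have h2 : Filter.Tendsto (fun k : ℕ => (2 : ℚ) ^ k) Filter.atTop Filter.atTop :=
      tendsto_pow_atTop_atTop_of_one_lt (by norm_num)
    simpa using (h1.comp h2).const_mul (N : ℚ)
  have hev : ∀ᶠ k : ℕ in Filter.atTop, r.eval ((2 : ℚ) ^ k) = 0 := by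
    have h1 := hlim.eventually (Metric.ball_mem_nhds (0 : ℚ) one_pos)
    filter_upwards [h1, Filter.eventually_ne_atTop 0] with k hk hk0
    obtain ⟨c, hc⟩ := hval k hk0
    rw [hc] at hk
    replace hk : dist (c : ℚ) 0 < 1 := hk
    rw [dist_zero_right] at hk
    have hc0 : c = 0 := by
      rw [← Int.abs_lt_one_iff]
      have : ((|c| : ℤ) : ℝ) < 1 := by
        rw [Int.cast_abs]
        simpa [Int.norm_eq_abs] using hk
      exact_mod_cast this
    rw [hc0, Int.cast_zero, mul_eq_zero, div_eq_zero_iff] at hc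
    rcases hc with hc | hc | hc
    · exact absurd (by exact_mod_cast hc) hN
    · exact hc
    · obtain ⟨_, hreg, _⟩ := hf k hk0
      rw [mem_regularAt, ← hv, Polynomial.aeval_def, Algebra.algebraMap_self, Polynomial.eval₂_id]
        at hreg
      exact absurd hc hreg
  have hr0 : r = 0 := by
    obtain ⟨K, hK⟩ := Filter.eventually_atTop.mp hev
    refine Polynomial.eq_zero_of_infinite_isRoot r (Set.infinite_of_injective_forall_mem
      (f := fun k : ℕ => (2 : ℚ) ^ (K + k)) (fun i j hij => ?_) fun k => hK _ (Nat.le_add_right _ _))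
    have := pow_right_injective₀ (by norm_num : (0 : ℚ) < 2) (by norm_num) hij
    omega
  refine ⟨w, ?_⟩
  rw [hr0, zero_add] at hdiv
  have hdn : algebraMap ℚ[X] (RatFunc ℚ) v ≠ 0 := RatFunc.algebraMap_ne_zero f.denom_ne_zero
  have h3 := RatFunc.num_div_denom f
  rw [← hv, ← hdiv, map_mul, mul_div_cancel_left₀ _ hdn] at h3
  exact h3

end Rationality

/-! ### The Gauss valuation ring and its Frobenius lift -/

section GaussRing

/-- Integral polynomials as rational functions. -/
def ofIntPoly : ℤ[X] →+* RatFunc ℚ := (Polynomial.aeval (R := ℤ) (RatFunc.X : RatFunc ℚ)).toRingHom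

theorem ofIntPoly_eq (u : ℤ[X]) :
    ofIntPoly u = algebraMap ℚ[X] (RatFunc ℚ) (u.map (Int.castRingHom ℚ)) := by
  have h : ofIntPoly =
      (algebraMap ℚ[X] (RatFunc ℚ)).comp (Polynomial.mapRingHom (Int.castRingHom ℚ)) := by
    refine Polynomial.ringHom_ext' (RingHom.ext_int _ _) ?_
    simp [ofIntPoly]
  exact RingHom.congr_fun h u

theorem ofIntPoly_X : ofIntPoly Polynomial.X = RatFunc.X := by
  simp [ofIntPoly]

theorem ofIntPoly_injective : Function.Injective ofIntPoly := fun u v h => by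
  rw [ofIntPoly_eq, ofIntPoly_eq] at h
  exact Polynomial.map_injective _ Int.cast_injective (RatFunc.algebraMap_injective ℚ h)

theorem substPow_ofIntPoly (n : ℕ) (hn : n ≠ 0) (u : ℤ[X]) :
    substPow n hn (ofIntPoly u) = ofIntPoly (Polynomial.expand ℤ n u) := by
  have h : (substPow n hn).comp ofIntPoly =
      ofIntPoly.comp (Polynomial.expand ℤ n).toRingHom := by
    refine Polynomial.ringHom_ext' (RingHom.ext_int _ _) ?_
    simp [ofIntPoly, substPow_apply]
  exact RingHom.congr_fun h u

variable (p : ℕ) [hp : Fact p.Prime]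

/-- Reduction of coefficients. -/
abbrev redMod : ℤ[X] →+* (ZMod p)[X] := Polynomial.mapRingHom (Int.castRingHom (ZMod p))

theorem exists_eq_natCast_mul {u : ℤ[X]} (hu : redMod p u = 0) : ∃ w : ℤ[X], u = (p : ℤ[X]) * w := by
  have h : Polynomial.C (p : ℤ) ∣ u := by
    rw [Polynomial.C_dvd_iff_dvd_coeff]
    intro i
    rw [← ZMod.intCast_zmod_eq_zero_iff_dvd]
    have := congrArg (fun f => Polynomial.coeff f i) hu
    simpa [redMod] using this
  obtain ⟨w, hw⟩ := h
  exact ⟨w, by rw [hw]; simp⟩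

/-- The valuation ring of the Gauss valuation for `p`. -/
def gaussRing : Subring (RatFunc ℚ) where
  carrier := {f | ∃ u v : ℤ[X], redMod p v ≠ 0 ∧ f * ofIntPoly v = ofIntPoly u}
  zero_mem' := ⟨0, 1, by rw [map_one]; exact one_ne_zero, by simp⟩
  one_mem' := ⟨1, 1, by rw [map_one]; exact one_ne_zero, by simp⟩
  add_mem' := by
    rintro f g ⟨u, v, hv, h⟩ ⟨u', v', hv', h'⟩
    refine ⟨u * v' + u' * v, v * v', by rw [map_mul]; exact mul_ne_zero hv hv', ?_⟩
    rw [map_mul, map_add, map_mul, map_mul, ← h, ← h']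
    ring
  mul_mem' := by
    rintro f g ⟨u, v, hv, h⟩ ⟨u', v', hv', h'⟩
    refine ⟨u * u', v * v', by rw [map_mul]; exact mul_ne_zero hv hv', ?_⟩
    rw [map_mul, map_mul, ← h, ← h']
    ring
  neg_mem' := by
    rintro f ⟨u, v, hv, h⟩
    exact ⟨-u, v, hv, by rw [map_neg, ← h, neg_mul]⟩

variable {p}

theorem ofIntPoly_mem (u : ℤ[X]) : ofIntPoly u ∈ gaussRing p :=
  ⟨u, 1, by rw [map_one]; exact one_ne_zero, by rw [map_one, mul_one]⟩

theorem ofIntPoly_ne_zero {v : ℤ[X]} (hv : redMod p v ≠ 0) : ofIntPoly v ≠ 0 := fun h => by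
  rw [ofIntPoly_injective (h.trans (map_zero _).symm), map_zero] at hv
  exact hv rfl

theorem inv_ofIntPoly_mem {v : ℤ[X]} (hv : redMod p v ≠ 0) : (ofIntPoly v)⁻¹ ∈ gaussRing p :=
  ⟨1, v, hv, by rw [inv_mul_cancel₀ (ofIntPoly_ne_zero hv), map_one]⟩

theorem natCast_inv_mem {n : ℕ} (hn : ¬ p ∣ n) : ((n : RatFunc ℚ))⁻¹ ∈ gaussRing p := by
  have h : redMod p (n : ℤ[X]) ≠ 0 := by
    rw [map_natCast]
    intro h
    have := congrArg (fun f => Polynomial.coeff f 0) h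
    rw [← Polynomial.C_eq_natCast] at this
    simp only [Polynomial.coeff_C_zero, Polynomial.coeff_zero] at this
    exact hn ((ZMod.natCast_eq_zero_iff n p).mp this)
  have := inv_ofIntPoly_mem h
  rwa [map_natCast] at this

theorem substPow_mem {f : RatFunc ℚ} (hf : f ∈ gaussRing p) (n : ℕ) (hn : n ≠ 0) :
    substPow n hn f ∈ gaussRing p := by
  obtain ⟨u, v, hv, h⟩ := hf
  refine ⟨Polynomial.expand ℤ n u, Polynomial.expand ℤ n v, ?_, ?_⟩
  · rw [Polynomial.coe_mapRingHom, Polynomial.map_expand]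
    exact (Polynomial.expand_ne_zero (Nat.pos_of_ne_zero hn)).mpr hv
  · rw [← substPow_ofIntPoly n hn, ← substPow_ofIntPoly n hn, ← map_mul, h]

theorem exists_pow_sub_expand (u : ℤ[X]) :
    ∃ w : ℤ[X], u ^ p = Polynomial.expand ℤ p u + p * w := by
  obtain ⟨w, hw⟩ := exists_eq_natCast_mul p (u := u ^ p - Polynomial.expand ℤ p u) (by
    rw [map_sub, map_pow, Polynomial.coe_mapRingHom, Polynomial.map_expand, ZMod.expand_card,
      sub_self])
  exact ⟨w, by rw [← hw]; ring⟩

/-- Modulo `p`, the `p`-th power of a polynomial is the substitution `q ↦ q ^ p`; this extends to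
fractions whose denominator is nonzero modulo `p`. -/
theorem exists_pow_sub_substPow {f : RatFunc ℚ} (hf : f ∈ gaussRing p) :
    ∃ g ∈ gaussRing p, f ^ p = substPow p hp.out.ne_zero f + p * g := by
  obtain ⟨u, v, hv, h⟩ := hf
  obtain ⟨w, hw⟩ := exists_pow_sub_expand (p := p) u
  obtain ⟨w', hw'⟩ := exists_pow_sub_expand (p := p) v
  have hv' : redMod p (Polynomial.expand ℤ p v) ≠ 0 := by
    rw [Polynomial.coe_mapRingHom, Polynomial.map_expand]
    exact (Polynomial.expand_ne_zero hp.out.pos).mpr hv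
  have h1 : substPow p hp.out.ne_zero f * ofIntPoly (Polynomial.expand ℤ p v) =
      ofIntPoly (Polynomial.expand ℤ p u) := by
    rw [← substPow_ofIntPoly p hp.out.ne_zero, ← substPow_ofIntPoly p hp.out.ne_zero, ← map_mul, h]
  have h2 : f ^ p * ofIntPoly v ^ p = ofIntPoly u ^ p := by rw [← mul_pow, h]
  have hv0 := pow_ne_zero p (ofIntPoly_ne_zero hv)
  have hv0' := ofIntPoly_ne_zero hv'
  -- With `u ^ p = a + p w` and `v ^ p = b + p w'`, one has `u ^ p / v ^ p - a / b = p (w b - a w')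
  -- / (v ^ p b)`.
  refine ⟨(ofIntPoly v)⁻¹ ^ p * (ofIntPoly (Polynomial.expand ℤ p v))⁻¹ *
    ofIntPoly (w * Polynomial.expand ℤ p v - Polynomial.expand ℤ p u * w'),
    mul_mem (mul_mem (pow_mem (inv_ofIntPoly_mem hv) _) (inv_ofIntPoly_mem hv'))
      (ofIntPoly_mem _), ?_⟩
  have hw2 := congrArg ofIntPoly hw
  have hw2' := congrArg ofIntPoly hw'
  rw [map_pow, map_add, map_mul, map_natCast] at hw2 hw2'
  rw [map_sub, map_mul, map_mul, inv_pow]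
  rw [eq_div_of_mul_eq hv0 h2, eq_div_of_mul_eq hv0' h1]
  generalize ofIntPoly (Polynomial.expand ℤ p v) = b at *
  generalize ofIntPoly (Polynomial.expand ℤ p u) = a at *
  rw [hw2]
  generalize hB : ofIntPoly v ^ p = B at *
  field_simp
  rw [hw2']
  ring

/-- A rational function with integral Gauss valuations that is a polynomial has integral
coefficients. -/
theorem exists_ofIntPoly_eq {f : RatFunc ℚ} (u : ℚ[X]) (hu : algebraMap ℚ[X] (RatFunc ℚ) u = f)
    (hf : ∀ p : ℕ, ∀ _ : Fact p.Prime, f ∈ gaussRing p) : ∃ w : ℤ[X], ofIntPoly w = f := by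
  obtain ⟨N, w, hN, hw⟩ := exists_nat_smul_eq_map u
  have h : (N : RatFunc ℚ) * f = ofIntPoly w := by
    rw [ofIntPoly_eq, ← hw, map_mul, map_natCast, hu]
  clear hw
  induction N using Nat.strong_induction_on generalizing w with
  | _ N ih =>
    by_cases h1 : N = 1
    · exact ⟨w, by rw [← h, h1, Nat.cast_one, one_mul]⟩
    · obtain ⟨p, hp, M, rfl⟩ := Nat.exists_prime_and_dvd h1
      have : Fact p.Prime := ⟨hp⟩
      obtain ⟨a, v, hv, hav⟩ := hf p this
      have h2 : w * v = ((p * M : ℕ) : ℤ[X]) * a := ofIntPoly_injective (by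
        rw [map_mul, map_mul, map_natCast, ← h, ← hav, mul_assoc])
      -- Modulo `p` one has `w v = 0` with `v ≠ 0`, so `p` divides `w` and can be removed from the
      -- denominator.
      have h3 : redMod p w = 0 := by
        have h4 := congrArg (redMod p) h2
        rw [map_mul, map_mul, map_natCast, Nat.cast_mul, CharP.cast_eq_zero, zero_mul, zero_mul,
          mul_eq_zero] at h4
        exact h4.resolve_right hv
      obtain ⟨w', rfl⟩ := exists_eq_natCast_mul p h3
      have hM : M ≠ 0 := right_ne_zero_of_mul hN
      refine ih M (lt_mul_of_one_lt_left (Nat.pos_of_ne_zero hM) hp.one_lt) w' hM ?_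
      rw [map_mul, map_natCast, Nat.cast_mul, mul_assoc] at h
      exact mul_left_cancel₀ (Nat.cast_ne_zero.mpr hp.ne_zero) h

end GaussRing

/-! ### Frobenius congruences for power series -/

section PowerSeriesCongruence

theorem coeff_pow_char {R : Type*} [CommRing R] (p : ℕ) [Fact p.Prime] [CharP R p] (f : R⟦X⟧)
    (d : ℕ) : PowerSeries.coeff d (f ^ p) =
      if p ∣ d then PowerSeries.coeff (d / p) f ^ p else 0 := by
  have hp : p.Prime := Fact.out
  have : CharP R⟦X⟧ p := charP_of_injective_ringHom (f := PowerSeries.C (R := R))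
    PowerSeries.C_injective p
  -- Truncation reduces the claim to polynomials: the tail contributes to `f ^ p` only in degrees
  -- above `d`.
  have hX : (PowerSeries.X : R⟦X⟧) ^ (d + 1) ∣ f - (PowerSeries.trunc (d + 1) f : R[X]) := by
    rw [PowerSeries.X_pow_dvd_iff]
    intro j hj
    rw [map_sub, Polynomial.coeff_coe, PowerSeries.coeff_trunc, if_pos hj, sub_self]
  obtain ⟨g, hg⟩ := hX
  rw [sub_eq_iff_eq_add] at hg
  have h1 : f ^ p = PowerSeries.X ^ (d + 1) * (PowerSeries.X ^ ((d + 1) * (p - 1)) * g ^ p) +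
      ((PowerSeries.trunc (d + 1) f ^ p : R[X]) : R⟦X⟧) := by
    conv_lhs => rw [hg]
    rw [add_pow_char, mul_pow, ← pow_mul, Polynomial.coe_pow, ← mul_assoc, ← pow_add]
    congr 3
    obtain ⟨s, rfl⟩ : ∃ s, p = s + 1 := ⟨p - 1, by have := hp.pos; omega⟩
    rw [Nat.add_sub_cancel]
    ring_nf
  rw [h1, map_add, PowerSeries.coeff_X_pow_mul', if_neg (by omega), zero_add, Polynomial.coeff_coe,
    ← Polynomial.map_frobenius_expand, Polynomial.coeff_map, Polynomial.coeff_expand hp.pos]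
  split_ifs
  · rw [frobenius_def, PowerSeries.coeff_trunc,
      if_pos (lt_of_le_of_lt (Nat.div_le_self d p) (Nat.lt_succ_self d))]
  · exact map_zero _

/-- The congruence `f ^ p ≡ ∑ a_i ^ p t ^ (p i)` modulo `p`. -/
theorem exists_coeff_pow_eq {R : Type*} [CommRing R] (p : ℕ) [Fact p.Prime] (f : R⟦X⟧) (d : ℕ) :
    ∃ g : R, PowerSeries.coeff d (f ^ p) =
      (if p ∣ d then PowerSeries.coeff (d / p) f ^ p else 0) + p * g := by
  let I : Ideal R := Ideal.span {(p : R)}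
  have hpI : ((p : ℕ) : R ⧸ I) = 0 := by
    rw [← map_natCast (Ideal.Quotient.mk I), Ideal.Quotient.eq_zero_iff_mem]
    exact Ideal.mem_span_singleton_self _
  have key : Ideal.Quotient.mk I (PowerSeries.coeff d (f ^ p)) =
      Ideal.Quotient.mk I (if p ∣ d then PowerSeries.coeff (d / p) f ^ p else 0) := by
    -- The quotient is zero when `p` is a unit of `R`; otherwise it has characteristic `p`.
    rcases subsingleton_or_nontrivial (R ⧸ I) with h | h
    · exact Subsingleton.elim _ _
    · have : CharP (R ⧸ I) p := (CharP.charP_iff_prime_eq_zero Fact.out).mpr hpI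
      have h1 := coeff_pow_char p (PowerSeries.map (Ideal.Quotient.mk I) f) d
      rw [← map_pow, PowerSeries.coeff_map, PowerSeries.coeff_map] at h1
      rw [h1, apply_ite (Ideal.Quotient.mk I), map_pow, map_zero]
  rw [Ideal.Quotient.eq, Ideal.mem_span_singleton] at key
  obtain ⟨g, hg⟩ := key
  exact ⟨g, by rw [← hg]; ring⟩

end PowerSeriesCongruence

/-! ### Divisibility for the logarithm -/

section PlethysticLog

variable {p : ℕ} [hp : Fact p.Prime]

theorem exists_map_subtype {f : (RatFunc ℚ)⟦X⟧} (hf : ∀ d, PowerSeries.coeff d f ∈ gaussRing p) :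
    ∃ g : (gaussRing p)⟦X⟧, PowerSeries.map (gaussRing p).subtype g = f :=
  ⟨PowerSeries.mk fun d => ⟨_, hf d⟩, by
    ext1 d
    rw [PowerSeries.coeff_map, PowerSeries.coeff_mk]
    rfl⟩

theorem coeff_map_subtype_mem (g : (gaussRing p)⟦X⟧) (d : ℕ) :
    PowerSeries.coeff d (PowerSeries.map (gaussRing p).subtype g) ∈ gaussRing p := by
  rw [PowerSeries.coeff_map]
  exact (PowerSeries.coeff d g).2

theorem adams_eq (n : ℕ) (hn : n ≠ 0) (f : (RatFunc ℚ)⟦X⟧) :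
    adams n f = PowerSeries.map (substPow n hn) (dilate n f) := by
  ext1 d
  rw [coeff_adams hn, PowerSeries.coeff_map, dilate, PowerSeries.coeff_mk,
    apply_ite (substPow n hn), map_zero]

theorem constantCoeff_adams (n : ℕ) (hn : n ≠ 0) {f : (RatFunc ℚ)⟦X⟧}
    (hf : PowerSeries.constantCoeff f = 1) : PowerSeries.constantCoeff (adams n f) = 1 := by
  rw [← PowerSeries.coeff_zero_eq_constantCoeff_apply, coeff_adams hn, if_pos (dvd_zero n),
    Nat.zero_div, PowerSeries.coeff_zero_eq_constantCoeff_apply, hf, map_one]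

theorem logOf_adams (n : ℕ) (hn : n ≠ 0) {f : (RatFunc ℚ)⟦X⟧}
    (hf : PowerSeries.constantCoeff f = 1) :
    PowerSeries.logOf (adams n f) = adams n (PowerSeries.logOf f) := by
  rw [adams_eq n hn, adams_eq n hn, ← map_logOf _ (by rw [constantCoeff_dilate, hf])]
  exact congrArg _ (logOf_dilate hf n hn)

/-- Two Frobenius congruences combine: the power series one accounts for `t ↦ t ^ p`, and the one in
the Gauss ring, applied to each coefficient, for `q ↦ q ^ p`. -/
theorem exists_pow_eq_adams_add {f : (RatFunc ℚ)⟦X⟧}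
    (hf : ∀ d, PowerSeries.coeff d f ∈ gaussRing p) :
    ∃ g : (gaussRing p)⟦X⟧,
      f ^ p = adams p f + (p : (RatFunc ℚ)⟦X⟧) * PowerSeries.map (gaussRing p).subtype g := by
  obtain ⟨F, hF⟩ := exists_map_subtype hf
  have h : ∀ d, ∃ g : gaussRing p, PowerSeries.coeff d (f ^ p) =
      PowerSeries.coeff d (adams p f) + p * g := by
    intro d
    obtain ⟨g, hg⟩ := exists_coeff_pow_eq p F d
    have hg' := congrArg (gaussRing p).subtype hg
    have e1 : (gaussRing p).subtype (PowerSeries.coeff d (F ^ p)) = PowerSeries.coeff d (f ^ p) := by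
      rw [← PowerSeries.coeff_map, map_pow, hF]
    have e2 : ∀ j, (gaussRing p).subtype (PowerSeries.coeff j F) = PowerSeries.coeff j f := fun j => by
      rw [← PowerSeries.coeff_map, hF]
    rw [e1, map_add, map_mul, map_natCast, apply_ite (gaussRing p).subtype, map_zero,
      map_pow (gaussRing p).subtype, e2] at hg'
    rw [hg', coeff_adams hp.out.ne_zero]
    split_ifs with hpd
    · obtain ⟨g', hg1, hg2⟩ := exists_pow_sub_substPow (hf (d / p))
      refine ⟨⟨g', hg1⟩ + g, ?_⟩
      rw [hg2]
      push_cast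
      simp only [Subring.subtype_apply]
      ring
    · exact ⟨g, rfl⟩
  choose g hg using h
  refine ⟨PowerSeries.mk g, ?_⟩
  ext1 d
  rw [hg, map_add, ← map_natCast (PowerSeries.C (R := RatFunc ℚ)), PowerSeries.coeff_C_mul,
    PowerSeries.coeff_map, PowerSeries.coeff_mk]
  rfl

theorem prime_pow_div_mem {k : ℕ} (hk : k ≠ 0) : (p : RatFunc ℚ) ^ (k - 1) / k ∈ gaussRing p := by
  obtain ⟨a, b, hb, rfl⟩ := Nat.exists_eq_pow_mul_and_not_dvd hk p hp.out.ne_one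
  have hb0 : b ≠ 0 := by
    rintro rfl
    exact hb (dvd_zero p)
  -- The `p`-adic valuation `a` of `k` is at most `k - 1`, since `a < p ^ a ≤ k`.
  have hle : a ≤ p ^ a * b - 1 := by
    have h1 := Nat.lt_pow_self hp.out.one_lt (n := a)
    have h2 := Nat.le_mul_of_pos_right (p ^ a) (Nat.pos_of_ne_zero hb0)
    omega
  obtain ⟨c, hc⟩ := Nat.exists_eq_add_of_le hle
  have hp0 : (p : RatFunc ℚ) ≠ 0 := by exact_mod_cast hp.out.ne_zero
  have h : (p : RatFunc ℚ) ^ (p ^ a * b - 1) / ((p ^ a * b : ℕ) : RatFunc ℚ) =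
      (p : RatFunc ℚ) ^ c * (b : RatFunc ℚ)⁻¹ := by
    rw [hc, pow_add, Nat.cast_mul, Nat.cast_pow, mul_div_mul_left _ _ (pow_ne_zero a hp0),
      div_eq_mul_inv]
  rw [h]
  exact mul_mem (pow_mem (natCast_mem _ p) _) (natCast_inv_mem hb)

/-- The logarithm of a series congruent to `1` modulo `p` is divisible by `p`. -/
theorem exists_logOf_one_add (u : (gaussRing p)⟦X⟧) (hu : PowerSeries.constantCoeff u = 0) (d : ℕ) :
    ∃ g ∈ gaussRing p, PowerSeries.coeff d (PowerSeries.logOf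
      (1 + (p : (RatFunc ℚ)⟦X⟧) * PowerSeries.map (gaussRing p).subtype u)) = p * g := by
  set U := PowerSeries.map (gaussRing p).subtype u with hU
  have hU0 : PowerSeries.constantCoeff U = 0 := by
    rw [← PowerSeries.coeff_zero_eq_constantCoeff_apply, hU, PowerSeries.coeff_map,
      PowerSeries.coeff_zero_eq_constantCoeff_apply, hu, map_zero]
  have hs : PowerSeries.HasSubst ((p : (RatFunc ℚ)⟦X⟧) * U) :=
    PowerSeries.HasSubst.of_constantCoeff_zero' (by rw [map_mul, hU0, mul_zero])
  rw [PowerSeries.logOf_eq, add_sub_cancel_left, PowerSeries.coeff_subst' hs]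
  -- Each term of the logarithm has the factor `p ^ k / k = p (p ^ (k - 1) / k)`, with integral
  -- second factor.
  refine finsum_induction (fun y => ∃ g ∈ gaussRing p, y = p * g) ⟨0, zero_mem _, by simp⟩ ?_ ?_
  · rintro _ _ ⟨g, hg, rfl⟩ ⟨g', hg', rfl⟩
    exact ⟨g + g', add_mem hg hg', by ring⟩
  · intro k
    rw [PowerSeries.coeff_log]
    split_ifs with hk
    · exact ⟨0, zero_mem _, by simp⟩
    · obtain ⟨s, rfl⟩ := Nat.exists_eq_succ_of_ne_zero hk
      refine ⟨(-1) ^ (s + 1 + 1) * ((p : RatFunc ℚ) ^ (s + 1 - 1) / ((s + 1 : ℕ) : RatFunc ℚ)) *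
        PowerSeries.coeff d (U ^ (s + 1)), mul_mem (mul_mem (pow_mem (neg_mem (one_mem _)) _)
          (prime_pow_div_mem (Nat.succ_ne_zero s))) ?_, ?_⟩
      · rw [hU, ← map_pow]
        exact coeff_map_subtype_mem _ _
      · rw [mul_pow, ← map_natCast (PowerSeries.C (R := RatFunc ℚ)), ← map_pow,
          PowerSeries.coeff_C_mul, smul_eq_mul, map_div₀, map_pow, map_neg, map_one, map_natCast]
        rw [Nat.succ_eq_add_one, Nat.add_sub_cancel]
        ring

/-- The divisibility by `p` that makes the plethystic logarithm integral. -/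
theorem exists_logOf_sub_adams {f : (RatFunc ℚ)⟦X⟧} (hf0 : PowerSeries.constantCoeff f = 1)
    (hf : ∀ d, PowerSeries.coeff d f ∈ gaussRing p) (d : ℕ) :
    ∃ g ∈ gaussRing p, (p : RatFunc ℚ) * PowerSeries.coeff d (PowerSeries.logOf f) -
      PowerSeries.coeff d (adams p (PowerSeries.logOf f)) = p * g := by
  obtain ⟨g, hg⟩ := exists_pow_eq_adams_add hf
  obtain ⟨A, hA⟩ := exists_map_subtype (p := p) (f := adams p f) (fun j => by
    rw [coeff_adams hp.out.ne_zero]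
    split_ifs
    · exact substPow_mem (hf _) _ _
    · exact zero_mem _)
  have ha0 := constantCoeff_adams p hp.out.ne_zero hf0
  have hc : ∀ s : (gaussRing p)⟦X⟧, ((PowerSeries.constantCoeff s : gaussRing p) : RatFunc ℚ) =
      PowerSeries.constantCoeff (PowerSeries.map (gaussRing p).subtype s) := fun s => by
    rw [← PowerSeries.coeff_zero_eq_constantCoeff_apply, ← PowerSeries.coeff_zero_eq_constantCoeff_apply,
      PowerSeries.coeff_map]
    rfl
  have hA0 : PowerSeries.constantCoeff A = 1 := Subtype.ext (by rw [hc, hA, ha0]; rfl)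
  have hp0 : (p : RatFunc ℚ) ≠ 0 := Nat.cast_ne_zero.mpr hp.out.ne_zero
  have hg0 : PowerSeries.constantCoeff g = 0 := by
    refine Subtype.ext ?_
    have h1 := congrArg PowerSeries.constantCoeff hg
    rw [map_pow, hf0, one_pow, map_add, ha0, map_mul, map_natCast, ← hc] at h1
    exact (mul_eq_zero.mp (left_eq_add.mp h1)).resolve_left hp0
  set A' := PowerSeries.invOfUnit A 1 with hA'
  have hAA : A * A' = 1 := PowerSeries.mul_invOfUnit A 1 (by rw [hA0]; rfl)
  -- The series `ψ_p f` has constant coefficient `1`, so it is invertible over the Gauss ring and `f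
  -- ^ p / ψ_p f` is `1` plus `p` times an integral series. Taking logarithms gives the claim.
  have hfac : f ^ p =
      (1 + (p : (RatFunc ℚ)⟦X⟧) * PowerSeries.map (gaussRing p).subtype (g * A')) * adams p f := by
    rw [hg, ← hA, add_mul, one_mul, mul_assoc, ← map_mul, mul_assoc g, mul_comm A', hAA, mul_one]
  have hu0 : PowerSeries.constantCoeff (g * A') = 0 := by rw [map_mul, hg0, zero_mul]
  obtain ⟨y, hy, hy'⟩ := exists_logOf_one_add (g * A') hu0 d
  refine ⟨y, hy, ?_⟩
  have h2 : PowerSeries.constantCoeff (1 + (p : (RatFunc ℚ)⟦X⟧) *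
      PowerSeries.map (gaussRing p).subtype (g * A')) = 1 := by
    rw [map_add, map_mul, map_one, ← hc, hu0]
    simp
  have h3 := congrArg PowerSeries.logOf hfac
  rw [logOf_pow hf0, logOf_mul h2 ha0] at h3
  have h4 := congrArg (PowerSeries.coeff d) h3
  rw [map_add, hy', map_nsmul, nsmul_eq_mul] at h4
  rw [h4, logOf_adams p hp.out.ne_zero hf0, add_sub_cancel_right]

end PlethysticLog

/-! ### Integrality of the plethystic logarithm and the counting polynomials -/

section Integrality

/-- Each divisor `n` prime to `p` is paired with `n * p`; the divisors divisible by `p ^ 2`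
contribute nothing, as for a Möbius sum. -/
theorem sum_divisors_eq_sum_prime {M : Type*} [AddCommMonoid M] {p : ℕ} (hp : p.Prime) {d : ℕ}
    (hd : d ≠ 0) (g : ℕ → M) (hg : ∀ n, p ∣ n → g (n * p) = 0) :
    ∑ n ∈ d.divisors, g n =
      ∑ n ∈ d.divisors.filter (fun n => ¬ p ∣ n), (g n + if n * p ∣ d then g (n * p) else 0) := by
  rw [← Finset.sum_filter_add_sum_filter_not d.divisors (fun n => ¬ p ∣ n), Finset.sum_add_distrib]
  congr 1
  rw [← Finset.sum_filter, Finset.filter_filter]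
  symm
  refine Finset.sum_of_injOn (· * p) (fun a _ b _ h => Nat.eq_of_mul_eq_mul_right hp.pos h) ?_ ?_
    fun _ _ => rfl
  · intro n hn
    simp only [Finset.coe_filter, Set.mem_ofPred_eq, Nat.mem_divisors, not_not] at hn ⊢
    exact ⟨⟨hn.2.2, hd⟩, dvd_mul_left p n⟩
  · intro n hn hn'
    simp only [Finset.mem_filter, Nat.mem_divisors, not_not] at hn
    obtain ⟨⟨hnd, _⟩, n', rfl⟩ := hn
    rw [mul_comm p n'] at hn' hnd ⊢
    refine hg n' (by_contra fun h => hn' ⟨n', ?_, rfl⟩)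
    simp only [Finset.coe_filter, Set.mem_ofPred_eq, Nat.mem_divisors]
    exact ⟨⟨(dvd_mul_right n' p).trans hnd, hd⟩, h, hnd⟩

theorem rat_smul_eq (c : ℚ) (y : RatFunc ℚ) : c • y = (c : RatFunc ℚ) * y := by
  rw [RatFunc.smul_eq_C_mul, eq_ratCast (RatFunc.C : ℚ →+* RatFunc ℚ) c]

theorem substPow_substPow (n k : ℕ) (hn : n ≠ 0) (hk : k ≠ 0) (f : RatFunc ℚ) :
    substPow n hn (substPow k hk f) = substPow (n * k) (mul_ne_zero hn hk) f := by
  have h := (eval_substPow hk (b := (RatFunc.X : RatFunc ℚ) ^ n) (f := f) (by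
    rw [← pow_mul]
    exact mem_regularAt_X_pow (mul_ne_zero hn hk) f)).2
  rw [substPow_apply n, h, substPow_apply, pow_mul]

variable {p : ℕ} [hp : Fact p.Prime]

/-- For `p ∤ n` one has `μ(n p) = -μ(n)`, so the terms of `n` and `n p` together are `μ(n) / n`
times `ψ_n (log f - ψ_p (log f) / p)`. The inner series is integral by `exists_logOf_sub_adams`, and
`1 / n` is integral at `p`. -/
theorem coeff_plethLog_mem {f : (RatFunc ℚ)⟦X⟧} (hf0 : PowerSeries.constantCoeff f = 1)
    (hf : ∀ d, PowerSeries.coeff d f ∈ gaussRing p) {d : ℕ} (hd : d ≠ 0) :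
    PowerSeries.coeff d (plethLog f) ∈ gaussRing p := by
  have hp0 : (p : RatFunc ℚ) ≠ 0 := Nat.cast_ne_zero.mpr hp.out.ne_zero
  rw [plethLog, PowerSeries.coeff_mk, sum_divisors_eq_sum_prime hp.out hd]
  · refine sum_mem fun n hn => ?_
    rw [Finset.mem_filter, Nat.mem_divisors] at hn
    obtain ⟨⟨⟨j, rfl⟩, _⟩, hpn⟩ := hn
    have hn0 : n ≠ 0 := left_ne_zero_of_mul hd
    obtain ⟨g, hg, hg'⟩ := exists_logOf_sub_adams hf0 hf j
    have h1 := congrArg (substPow n hn0) hg'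
    rw [map_sub, map_mul, map_mul, map_natCast, coeff_adams hp.out.ne_zero,
      apply_ite (substPow n hn0), map_zero, substPow_substPow] at h1
    have h2 : (((ArithmeticFunction.moebius n : ℚ) / (n : ℚ)) •
        PowerSeries.coeff (n * j) (adams n (PowerSeries.logOf f)) +
        if n * p ∣ n * j then ((ArithmeticFunction.moebius (n * p) : ℚ) / ((n * p : ℕ) : ℚ)) •
          PowerSeries.coeff (n * j) (adams (n * p) (PowerSeries.logOf f)) else 0) =
        (ArithmeticFunction.moebius n : RatFunc ℚ) * (n : RatFunc ℚ)⁻¹ * substPow n hn0 g := by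
      have hmu : ArithmeticFunction.moebius (n * p) = -ArithmeticFunction.moebius n := by
        rw [ArithmeticFunction.isMultiplicative_moebius.map_mul_of_coprime
          ((Nat.Prime.coprime_iff_not_dvd hp.out).mpr hpn).symm,
          ArithmeticFunction.moebius_apply_prime hp.out, mul_neg_one]
      have hj : n * p ∣ n * j ↔ p ∣ j := Nat.mul_dvd_mul_iff_left (Nat.pos_of_ne_zero hn0)
      have hn0' : (n : RatFunc ℚ) ≠ 0 := Nat.cast_ne_zero.mpr hn0
      rw [coeff_adams hn0, if_pos (dvd_mul_right n j), Nat.mul_div_cancel_left _ (Nat.pos_of_ne_zero hn0),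
        coeff_adams (mul_ne_zero hn0 hp.out.ne_zero), hmu, rat_smul_eq, rat_smul_eq]
      simp only [hj]
      by_cases hpj : p ∣ j
      · rw [if_pos hpj] at h1
        rw [if_pos hpj, if_pos hpj, Nat.mul_div_mul_left _ _ (Nat.pos_of_ne_zero hn0)]
        push_cast
        field_simp
        linear_combination (ArithmeticFunction.moebius n : RatFunc ℚ) * h1
      · rw [if_neg hpj, sub_zero] at h1
        rw [if_neg hpj, mul_left_cancel₀ hp0 h1]
        push_cast
        ring
    rw [h2]
    exact mul_mem (mul_mem (intCast_mem _ _) (natCast_inv_mem hpn)) (substPow_mem hg n hn0)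
  · intro n hpn
    rw [ArithmeticFunction.moebius_eq_zero_of_not_squarefree, Int.cast_zero, zero_div, rat_smul_eq, Rat.cast_zero,
      zero_mul]
    intro h
    obtain ⟨c, rfl⟩ := hpn
    exact hp.out.not_isUnit (h p ⟨c, by ring⟩)

variable (p) in
/-- The units of the Gauss valuation ring, together with zero. -/
def gaussUnits : Submonoid (RatFunc ℚ) where
  carrier := {f | f ∈ gaussRing p ∧ f⁻¹ ∈ gaussRing p}
  one_mem' := ⟨one_mem _, by rw [inv_one]; exact one_mem _⟩
  mul_mem' := fun hf hg => ⟨mul_mem hf.1 hg.1, by rw [mul_inv]; exact mul_mem hf.2 hg.2⟩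

/-- Negative exponents matter because `m - 1 = -1` for `m = 0`; hence the inverse of `r_λ` must be
integral too. -/
theorem zpow_mem_gaussRing {f : RatFunc ℚ} (hf : f ∈ gaussUnits p) (e : ℤ) :
    f ^ e ∈ gaussRing p := by
  rcases e with e | e
  · exact (zpow_natCast f e).symm ▸ pow_mem hf.1 e
  · rw [zpow_negSucc, ← inv_pow]
    exact pow_mem hf.2 _

theorem X_mem_gaussUnits : (RatFunc.X : RatFunc ℚ) ∈ gaussUnits p := by
  have h : redMod p Polynomial.X ≠ 0 := by
    rw [Polynomial.coe_mapRingHom, Polynomial.map_X]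
    exact Polynomial.X_ne_zero
  rw [← ofIntPoly_X]
  exact ⟨ofIntPoly_mem _, inv_ofIntPoly_mem h⟩

theorem one_sub_mem_gaussUnits (i : ℕ) :
    (1 - (RatFunc.X : RatFunc ℚ)⁻¹ ^ (i + 1)) ∈ gaussUnits p := by
  have h : redMod p (Polynomial.X ^ (i + 1) - 1) ≠ 0 := by
    rw [map_sub, map_pow, map_one, Polynomial.coe_mapRingHom, Polynomial.map_X]
    exact Polynomial.X_pow_sub_C_ne_zero (Nat.succ_pos i) 1
  have hX := X_mem_gaussUnits (p := p)
  have h1 : (1 - (RatFunc.X : RatFunc ℚ)⁻¹ ^ (i + 1)) =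
      ofIntPoly (Polynomial.X ^ (i + 1) - 1) * (RatFunc.X : RatFunc ℚ)⁻¹ ^ (i + 1) := by
    rw [map_sub, map_pow, ofIntPoly_X, map_one, sub_mul, one_mul, ← mul_pow,
      mul_inv_cancel₀ RatFunc.X_ne_zero, one_pow]
  rw [h1]
  refine mul_mem (⟨ofIntPoly_mem _, inv_ofIntPoly_mem h⟩ : _ ∈ gaussUnits p) (pow_mem ?_ _)
  exact ⟨hX.2, by rw [inv_inv]; exact hX.1⟩

theorem rFactor_mem_gaussUnits {d : ℕ} (l : Nat.Partition d) : rFactor l ∈ gaussUnits p :=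
  prod_mem fun _ _ => mul_mem (pow_mem X_mem_gaussUnits _)
    (prod_mem fun i _ => one_sub_mem_gaussUnits i)

theorem indecFun_mem_gaussRing (m : ℕ) {d : ℕ} (hd : d ≠ 0) : indecFun m d ∈ gaussRing p := by
  refine mul_mem (sub_mem X_mem_gaussUnits.1 (one_mem _))
    (coeff_plethLog_mem (constantCoeff_partitionSeries m) (fun j => ?_) hd)
  rw [partitionSeries, PowerSeries.coeff_mk]
  exact sum_mem fun l _ => zpow_mem_gaussRing (rFactor_mem_gaussUnits l) _

/-- The polynomials that count absolutely indecomposable representations. -/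
theorem exists_indecPolynomial (m : ℕ) {d : ℕ} (hd : d ≠ 0) :
    ∃ A : ℤ[X], ofIntPoly A = indecFun m d := by
  -- The fields with `2 ^ k` elements supply infinitely many integral values.
  obtain ⟨u, hu⟩ := exists_eq_polynomial (indecFun m d) fun k hk => by
    have h := evalsTo_indecFun (GaloisField 2 k) m hd
    rw [GaloisField.card 2 k hk] at h
    exact ⟨_, by exact_mod_cast h⟩
  exact exists_ofIntPoly_eq u hu fun p _ => indecFun_mem_gaussRing m hd

theorem evalsTo_ofIntPoly (A : ℤ[X]) (q : ℕ) :
    EvalsTo (q : ℚ) (ofIntPoly A) ((A.eval (q : ℤ) : ℤ) : ℚ) := by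
  rw [ofIntPoly_eq]
  have h := evalsTo_polynomial (a := (q : ℚ)) (A.map (Int.castRingHom ℚ))
  have h1 : Polynomial.aeval (q : ℚ) (A.map (Int.castRingHom ℚ)) = ((A.eval (q : ℤ) : ℤ) : ℚ) := by
    rw [Polynomial.aeval_def, Algebra.algebraMap_self, Polynomial.eval₂_id]
    simp
  rwa [h1] at h

end Integrality

end FreeGroupRep

end

theorem mainTheorem6 (m : ℕ) :
    ∃ A : ℕ → Polynomial ℤ,
      (∀ d : ℕ, 1 ≤ d → ∀ (F : Type*) [Field F] [Finite F],
        (Nat.card (FreeGroupRep.AbsIndecClasses F (FreeGroup (Fin m)) d) : ℤ) =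
          (A d).eval (Nat.card F : ℤ)) ∧
      (PowerSeries.mk fun d : ℕ =>
          if d = 0 then 0 else Polynomial.aeval (RatFunc.X : RatFunc ℚ) (A d)) =
        PowerSeries.C (RatFunc.X - 1 : RatFunc ℚ) *
          FreeGroupRep.plethLog (FreeGroupRep.partitionSeries m) := by
  have hex : ∀ d : ℕ, ∃ A : Polynomial ℤ,
      d ≠ 0 → FreeGroupRep.ofIntPoly A = FreeGroupRep.indecFun m d := fun d => by
    by_cases hd : d = 0
    -- Neither conclusion involves the polynomial at `d = 0`, so it may be anything.
    · exact ⟨0, fun h => absurd hd h⟩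
    · obtain ⟨A, hA⟩ := FreeGroupRep.exists_indecPolynomial m hd
      exact ⟨A, fun _ => hA⟩
  choose A hA using hex
  refine ⟨A, fun d hd F _ _ => ?_, ?_⟩
  · have hd0 : d ≠ 0 := Nat.one_le_iff_ne_zero.mp hd
    have h1 := (FreeGroupRep.evalsTo_ofIntPoly (A d) (Nat.card F)).2
    rw [hA d hd0, (FreeGroupRep.evalsTo_indecFun F m hd0).2] at h1
    exact_mod_cast h1
  · ext1 d
    rw [PowerSeries.coeff_mk, PowerSeries.coeff_C_mul]
    split_ifs with hd
    · rw [hd, FreeGroupRep.plethLog, PowerSeries.coeff_mk, Nat.divisors_zero, Finset.sum_empty,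
        mul_zero]
    -- Both sides unfold to this: `ofIntPoly` is evaluation at `RatFunc.X`, and `indecFun` is the
    -- coefficient on the right.
    · exact hA d hd
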